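/- For an open set $\Omega\subset\mathbb{R}^2$, let $H^2_0(\Omega)$ be the closure of $C_c^\infty(\Omega)$ in $H^2(\Omega)$ and let $$\Lambda_1(\Omega)=\inf_{u\in H^2_0(\Omega)\setminus\{0\}}\frac{\int_\Omega(\Delta u)^2\,dx}{\int_\Omega|\nabla u|^2\,dx}$$ be the first buckling eigenvalue of $\Omega$ (with $\Lambda_1(\emptyset)=+\infty$). Let $$P(\Omega)=\sup\Big\{\int_\Omega\operatorname{div}\varphi\,dx:\ \varphi\in C^1_c(\mathbb{R}^2;\mathbb{R}^2),\ \|\varphi\|_\infty\le 1\Big\}$$ be the perimeter of $\Omega$. Proposition. For every $p>0$ the problem $$\min\{\Lambda_1(\Omega):\ \Omega\subset\mathbb{R}^2\ \text{open},\ |\Omega|<\infty,\ P(\Omega)\le p\}$$ admits a minimizer $\Omega$ that is bounded, open and convex and has maximal boundary length, that is, $P(\Omega)=\mathcal{H}^1(\partial\Omega)=p$. -/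

import Mathlib

open MeasureTheory Filter
open scoped ENNReal Topology ContDiff

noncomputable section

namespace Buckling

/-- The Euclidean space `ℝᵈ`. -/
abbrev Space (d : ℕ) : Type := EuclideanSpace ℝ (Fin d)

/-- The classical partial derivative `∂ᵢ f`. -/
def partialDeriv {d : ℕ} (i : Fin d) (f : Space d → ℝ) (x : Space d) : ℝ :=
  fderiv ℝ f x (EuclideanSpace.single i 1)

/-- `φ ∈ C_c^∞(Ω)`, a function on `ℝᵈ` with compact support contained in `Ω`. -/
structure IsTestFunction {d : ℕ} (Ω : Set (Space d)) (φ : Space d → ℝ) : Prop where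
  contDiff : ContDiff ℝ ∞ φ
  hasCompactSupport : HasCompactSupport φ
  tsupport_subset : tsupport φ ⊆ Ω

/-- `v` is the weak partial derivative `∂ᵢ u` in the open set `Ω`. -/
structure HasWeakPartialDeriv {d : ℕ} (Ω : Set (Space d)) (i : Fin d)
    (u v : Space d → ℝ) : Prop where
  locallyIntegrableOn : LocallyIntegrableOn u Ω
  locallyIntegrableOn_deriv : LocallyIntegrableOn v Ω
  integral_eq : ∀ φ : Space d → ℝ, IsTestFunction Ω φ →
    ∫ x in Ω, u x * partialDeriv i φ x = - ∫ x in Ω, v x * φ x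

/-- `u ∈ H²(Ω)`, with weak gradient `G = (∂ᵢ u)ᵢ` and weak Hessian `H = (∂ᵢ ∂ⱼ u)ᵢⱼ`. -/
structure MemH2 {d : ℕ} (Ω : Set (Space d)) (u : Space d → ℝ)
    (G : Fin d → Space d → ℝ) (H : Fin d → Fin d → Space d → ℝ) : Prop where
  memLp : MemLp u 2 (volume.restrict Ω)
  memLp_grad : ∀ i, MemLp (G i) 2 (volume.restrict Ω)
  memLp_hess : ∀ i j, MemLp (H i j) 2 (volume.restrict Ω)
  weakGrad : ∀ i, HasWeakPartialDeriv Ω i u (G i)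
  weakHess : ∀ i j, HasWeakPartialDeriv Ω i (G j) (H i j)

/-- `u ∈ H²₀(Ω)`, with weak gradient `G` and weak Hessian `H`: `u` belongs to the closure of
`C_c^∞(Ω)` in `H²(Ω)`. -/
structure MemH2Zero {d : ℕ} (Ω : Set (Space d)) (u : Space d → ℝ)
    (G : Fin d → Space d → ℝ) (H : Fin d → Fin d → Space d → ℝ) : Prop
    extends MemH2 Ω u G H where
  approx : ∃ φ : ℕ → Space d → ℝ, (∀ n, IsTestFunction Ω (φ n)) ∧
    Tendsto (fun n => eLpNorm (φ n - u) 2 (volume.restrict Ω)) atTop (𝓝 0) ∧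
    (∀ i, Tendsto (fun n => eLpNorm (partialDeriv i (φ n) - G i) 2 (volume.restrict Ω))
      atTop (𝓝 0)) ∧
    (∀ i j, Tendsto
      (fun n => eLpNorm (partialDeriv i (partialDeriv j (φ n)) - H i j) 2 (volume.restrict Ω))
      atTop (𝓝 0))

/-- The Rayleigh quotient `∫_Ω (Δu)² / ∫_Ω |∇u|²` of a function with weak gradient `G` and weak
Hessian `H`. For `0 ≠ u ∈ H²₀(Ω)` both integrals are finite and the denominator is nonzero. -/
def rayleigh {d : ℕ} (Ω : Set (Space d))
    (G : Fin d → Space d → ℝ) (H : Fin d → Fin d → Space d → ℝ) : ℝ≥0∞ :=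
  (∫⁻ x in Ω, ENNReal.ofReal ((∑ i, H i i x) ^ 2)) /
    ∫⁻ x in Ω, ENNReal.ofReal (∑ i, (G i x) ^ 2)

/-- The first buckling eigenvalue `Λ₁(Ω)`: the infimum of the Rayleigh quotient over the nonzero
functions `u ∈ H²₀(Ω)`. It is `∞` if `Ω` is empty. -/
def firstBucklingEigenvalue {d : ℕ} (Ω : Set (Space d)) : ℝ≥0∞ :=
  sInf {r | ∃ u G H, MemH2Zero Ω u G H ∧ ¬ (u =ᵐ[volume.restrict Ω] 0) ∧ r = rayleigh Ω G H}

/-- The divergence of a vector field. -/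
def divergence {d : ℕ} (φ : Space d → Space d) (x : Space d) : ℝ :=
  ∑ i, (fderiv ℝ φ x (EuclideanSpace.single i 1)) i

/-- The (De Giorgi) perimeter `P(E)` in `ℝᵈ`: the supremum of `∫_E div φ` over the fields
`φ ∈ C¹_c(ℝᵈ; ℝᵈ)` with `‖φ‖_∞ ≤ 1`. As `φ = 0` competes, the supremum is nonnegative, so it can
be taken in `[0, ∞]`. -/
def perimeter {d : ℕ} (E : Set (Space d)) : ℝ≥0∞ :=
  sSup {r | ∃ φ : Space d → Space d, ContDiff ℝ 1 φ ∧ HasCompactSupport φ ∧ (∀ x, ‖φ x‖ ≤ 1) ∧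
    r = ENNReal.ofReal (∫ x in E, divergence φ x)}

/-- The admissible class: open sets of finite Lebesgue measure and perimeter at most `p`. -/
def admissible (d : ℕ) (p : ℝ) : Set (Set (Space d)) :=
  {Ω | IsOpen Ω ∧ volume Ω < ⊤ ∧ perimeter Ω ≤ ENNReal.ofReal p}

end Buckling

end

/-!
The existence of an optimal convex shape rests on two facts about planar sets: passing to the
convex hull of a connected component does not increase the perimeter, and convex domains enjoy a
strong compactness under which the eigenvalue and the perimeter can be compared by inclusions
alone.

*Test functions.* By density the eigenvalue is the infimum of the Rayleigh quotient over test
functions. `BucklesBelow Ω M` says that some test function on `Ω` has a quotient below `M`; this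
is equivalent to `Λ₁(Ω) < M` up to strictness (`BucklesBelow.firstBucklingEigenvalue_le`,
`bucklesBelow_of_firstBucklingEigenvalue_lt`; the second uses the Gagliardo–Nirenberg–Sobolev
inequality to see that a nonzero `u` has a nonzero weak gradient). The property is monotone under
inclusion, scales by the square of the factor under similarities, and is inherited by some
connected component (`BucklesBelow.exists_component`). Hence lower semicontinuity needs no weak
convergence: if `Cₙ ⊆ (1 + δ) C`, then dilating the test functions gives `Λ₁(C) ≤ (1 + δ)²
Λ₁(Cₙ)`.

*Perimeter.* The projection of a connected part `U` of `Ω` to a line is an interval, and a field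
orthogonal to that line that jumps from `-1` to `1` inside `Ω` and decays slowly on both sides has
a flux of nearly twice the width of `U`, because `Ω` has finite measure. Superposing such fields
for `N` directions gives a lower bound of the perimeter by the sum of the widths of `U`
(`sum_width_le_perimeter`). The widths do not change when `U` is replaced by its convex hull. For
a convex domain `C` the boundary curve crosses almost every line at most twice, so its length has
the same sum of widths as an upper bound (`IsConvexDomain.eVariationOn_bdryCurve_le`). As `N → ∞`
the two constants agree, which is the Cauchy–Crofton formula in the form of an inequality
(`IsConvexDomain.eVariationOn_le_perimeter`). Together with Green's formula, proved by Riemann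
sums over inscribed triangles (`IsConvexDomain.perimeter_le_eVariationOn`), and the identification
of the length of a simple closed curve with its Hausdorff measure, it shows that the perimeter of
a convex domain is the one-dimensional Hausdorff measure of its boundary, that it is monotone
under inclusion, and that the convex hull of a component of `Ω` has at most the perimeter of `Ω`
(`convexHull_isConvexDomain`).

*Compactness.* A bound on the perimeter bounds the diameter, and a bound on the eigenvalue
prevents collapse: `∫ (∂₁∂₂φ)² ≤ ∫ (Δφ)²` gives a Hölder estimate for `φ`, so `φ` is nonzero on a
disc of controlled radius around the maximum of `|φ|` (`exists_ball_subset_of_bucklesBelow`). With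
a common disc inside, Hausdorff convergence from Blaschke's selection theorem becomes inclusion up
to dilation by `1 + δ` (`exists_convexDomain_limit`), so a minimizing sequence of convex domains
has a limit with the optimal eigenvalue (`exists_convexDomain_le`). Dilating it until its
perimeter is exactly `p` does not increase the eigenvalue.
-/

/-! ### Directions and orthonormal frames in the plane -/

namespace Buckling

/-- The unit vector of angle `θ`. -/
noncomputable def dir (θ : ℝ) : Space 2 := !₂[Real.cos θ, Real.sin θ]

@[simp] lemma dir_zero_apply (θ : ℝ) : dir θ 0 = Real.cos θ := rfl
@[simp] lemma dir_one_apply (θ : ℝ) : dir θ 1 = Real.sin θ := rfl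

lemma inner_eq_coord (x y : Space 2) : inner ℝ x y = x 0 * y 0 + x 1 * y 1 := by
  simp [PiLp.inner_apply, Fin.sum_univ_two, mul_comm]

lemma norm_sq_eq_coord (x : Space 2) : ‖x‖ ^ 2 = x 0 ^ 2 + x 1 ^ 2 := by
  rw [← real_inner_self_eq_norm_sq, inner_eq_coord]; ring

@[simp] lemma norm_dir (θ : ℝ) : ‖dir θ‖ = 1 := by
  have h := norm_sq_eq_coord (dir θ)
  simp only [dir_zero_apply, dir_one_apply, Real.cos_sq_add_sin_sq] at h
  nlinarith [norm_nonneg (dir θ)]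

lemma continuous_dir : Continuous dir := by
  unfold dir
  refine (PiLp.continuous_toLp 2 _).comp (continuous_pi fun i => ?_)
  fin_cases i <;> simp <;> fun_prop

lemma inner_dir_dir (α β : ℝ) : inner ℝ (dir α) (dir β) = Real.cos (α - β) := by
  rw [inner_eq_coord, Real.cos_sub]; simp

/-- Polar representation of a vector. -/
lemma exists_eq_norm_smul_dir (v : Space 2) :
    ∃ α ∈ Set.Ioc (-Real.pi) Real.pi, v = ‖v‖ • dir α := by
  set z : ℂ := ⟨v 0, v 1⟩ with hz
  have hn : ‖z‖ = ‖v‖ := by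
    have h1 : ‖z‖ ^ 2 = ‖v‖ ^ 2 := by
      rw [norm_sq_eq_coord, ← Complex.normSq_eq_norm_sq, Complex.normSq_apply, hz]; ring
    exact (pow_left_inj₀ (norm_nonneg _) (norm_nonneg _) two_ne_zero).1 h1
  refine ⟨z.arg, Complex.arg_mem_Ioc z, ?_⟩
  ext i
  fin_cases i
  · have := (Complex.norm_mul_cos_arg z).symm
    rwa [hn] at this
  · have := (Complex.norm_mul_sin_arg z).symm
    rwa [hn] at this

/-- The expansion of a vector in an orthonormal frame. -/
lemma frame_expand {ν τ : Space 2} (hν : ‖ν‖ = 1) (hτ : ‖τ‖ = 1) (h : inner ℝ ν τ = 0)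
    (x : Space 2) : (inner ℝ ν x) • ν + (inner ℝ τ x) • τ = x := by
  have h1 := norm_sq_eq_coord ν
  have h2 := norm_sq_eq_coord τ
  rw [hν] at h1; rw [hτ] at h2
  rw [inner_eq_coord] at h
  -- the matrix with rows `ν`, `τ` is orthogonal, so its columns are orthonormal too
  have e : τ 0 = - (ν 0 * τ 1 - ν 1 * τ 0) * ν 1 ∧ τ 1 = (ν 0 * τ 1 - ν 1 * τ 0) * ν 0 := by
    constructor
    · linear_combination τ 0 * h1 + ν 0 * h
    · linear_combination τ 1 * h1 + ν 1 * h
  have hd : (ν 0 * τ 1 - ν 1 * τ 0) ^ 2 = 1 := by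
    linear_combination -(ν 0 * τ 0 + ν 1 * τ 1) * h - (τ 0 ^ 2 + τ 1 ^ 2) * h1 - h2
  set D := ν 0 * τ 1 - ν 1 * τ 0
  ext i
  fin_cases i
  · simp only [inner_eq_coord, PiLp.add_apply, PiLp.smul_apply, smul_eq_mul, Fin.zero_eta]
    rw [e.1, e.2]
    linear_combination (-x 0) * h1 + (ν 1 ^ 2 * x 0 - ν 0 * ν 1 * x 1) * hd
  · simp only [inner_eq_coord, PiLp.add_apply, PiLp.smul_apply, smul_eq_mul, Fin.mk_one]
    rw [e.1, e.2]
    linear_combination (-x 1) * h1 + (ν 0 ^ 2 * x 1 - ν 0 * ν 1 * x 0) * hd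

/-- The coordinates in an orthonormal frame, as a measurable equivalence. -/
noncomputable def frameEquiv {ν τ : Space 2} (hν : ‖ν‖ = 1) (hτ : ‖τ‖ = 1) (h : inner ℝ ν τ = 0) :
    ℝ × ℝ ≃ᵐ Space 2 where
  toFun p := p.1 • ν + p.2 • τ
  invFun x := (inner ℝ ν x, inner ℝ τ x)
  left_inv p := by
    have h' : inner ℝ τ ν = 0 := by rw [real_inner_comm]; exact h
    simp [inner_add_right, inner_smul_right, h, h', hν, hτ]
  right_inv x := frame_expand hν hτ h x
  measurable_toFun := by
    have : Continuous (fun p : ℝ × ℝ => p.1 • ν + p.2 • τ) := by fun_prop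
    exact this.measurable
  measurable_invFun := by
    have : Continuous (fun x : Space 2 => ((inner ℝ ν x, inner ℝ τ x) : ℝ × ℝ)) := by fun_prop
    exact this.measurable

lemma inner_frameEquiv_fst {ν τ : Space 2} (hν : ‖ν‖ = 1) (hτ : ‖τ‖ = 1) (h : inner ℝ ν τ = 0)
    (p : ℝ × ℝ) : inner ℝ ν (frameEquiv hν hτ h p) = p.1 :=
  congrArg Prod.fst ((frameEquiv hν hτ h).left_inv p)

lemma inner_frameEquiv_snd {ν τ : Space 2} (hν : ‖ν‖ = 1) (hτ : ‖τ‖ = 1) (h : inner ℝ ν τ = 0)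
    (p : ℝ × ℝ) : inner ℝ τ (frameEquiv hν hτ h p) = p.2 :=
  congrArg Prod.snd ((frameEquiv hν hτ h).left_inv p)

lemma measurePreserving_frameEquiv {ν τ : Space 2} (hν : ‖ν‖ = 1) (hτ : ‖τ‖ = 1)
    (h : inner ℝ ν τ = 0) : MeasurePreserving (frameEquiv hν hτ h) volume volume := by
  have ho : Orthonormal ℝ ![ν, τ] := by
    have h' : inner ℝ τ ν = 0 := by rw [real_inner_comm]; exact h
    constructor
    · intro i; fin_cases i <;> simp [hν, hτ]
    · intro i j hij; fin_cases i <;> fin_cases j <;> simp_all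
  let b0 := basisOfOrthonormalOfCardEqFinrank ho (by simp)
  have hb0 : (b0 : Fin 2 → Space 2) = ![ν, τ] := coe_basisOfOrthonormalOfCardEqFinrank ho (by simp)
  let b : OrthonormalBasis (Fin 2) ℝ (Space 2) := b0.toOrthonormalBasis (by rw [hb0]; exact ho)
  have hb : (b : Fin 2 → Space 2) = ![ν, τ] := by simp [b, hb0]
  have m := b.measurePreserving_repr_symm.comp ((PiLp.volume_preserving_toLp (Fin 2)).comp
    (volume_preserving_finTwoArrow ℝ).symm)
  convert m using 1
  funext p
  simp only [Function.comp]
  rw [← b.sum_repr (b.repr.symm _)]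
  simp [Fin.sum_univ_two, hb, frameEquiv, MeasurableEquiv.finTwoArrow, MeasurableEquiv.piFinTwo]

lemma norm_single_one (i : Fin 2) : ‖(EuclideanSpace.single i (1:ℝ) : Space 2)‖ = 1 := by simp

lemma inner_single_zero_one :
    inner ℝ (EuclideanSpace.single 0 (1:ℝ) : Space 2) (EuclideanSpace.single 1 (1:ℝ)) = 0 := by
  simp [inner_eq_coord]

/-- The sum of `|cos|` over `N` equidistributed lines is the same for all offsets, up to a bounded
error. -/
lemma abs_sum_abs_cos_sub_le (N : ℕ) (hN : 0 < N) (β : ℝ) :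
    |∑ k ∈ Finset.range N, |Real.cos (k * (Real.pi / N) - β)| - 2 * N / Real.pi| ≤ Real.pi := by
  have hN' : (0:ℝ) < N := by exact_mod_cast hN
  have hpi := Real.pi_pos
  set h := Real.pi / N with hh
  have hpos : 0 < h := by positivity
  set f : ℝ → ℝ := fun t => |Real.cos (t - β)| with hf
  have hc : Continuous f := by fun_prop
  -- the sum is a Riemann sum of the integral of `|cos|` over a period
  have hint : ∫ t in (0:ℝ)..Real.pi, f t = 2 := by
    have hper : Function.Periodic (fun t => |Real.cos t|) Real.pi := by
      intro t; simp [Real.cos_add_pi]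
    have e1 : ∫ t in (0:ℝ)..Real.pi, f t = ∫ t in (0 - β)..(Real.pi - β), |Real.cos t| := by
      rw [← intervalIntegral.integral_comp_sub_right (fun t => |Real.cos t|)]
    have e2 : Real.pi - β = (0 - β) + Real.pi := by ring
    have e3 : Real.pi / 2 = -(Real.pi/2) + Real.pi := by ring
    rw [e1, e2, hper.intervalIntegral_add_eq (0 - β) (-(Real.pi/2)), ← e3]
    rw [intervalIntegral.integral_congr (g := Real.cos)]
    · rw [integral_cos]; simp; norm_num
    · intro t ht
      rw [Set.uIcc_of_le (by linarith)] at ht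
      exact abs_of_nonneg (Real.cos_nonneg_of_mem_Icc ht)
  have hsum : ∫ t in (0:ℝ)..Real.pi, f t
      = ∑ k ∈ Finset.range N, ∫ t in (k * h)..((k + 1 : ℕ) * h), f t := by
    rw [intervalIntegral.sum_integral_adjacent_intervals (a := fun k : ℕ => k * h)]
    · have : (N:ℝ) * h = Real.pi := by rw [hh]; field_simp
      simp [this]
    · intro k _; exact hc.intervalIntegrable _ _
  have hterm : ∀ k : ℕ, |h * f (k * h) - ∫ t in (k * h)..((k + 1 : ℕ) * h), f t| ≤ h * h := by
    intro k
    have e : h * f (k * h) = ∫ t in (k * h)..((k + 1 : ℕ) * h), f (k * h) := by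
      rw [intervalIntegral.integral_const, smul_eq_mul]; push_cast; ring
    rw [e, ← intervalIntegral.integral_sub (by simp) (hc.intervalIntegrable _ _)]
    have := intervalIntegral.norm_integral_le_of_norm_le_const (a := (k:ℝ) * h)
      (b := ((k + 1 : ℕ):ℝ) * h) (f := fun t => f (k * h) - f t) (C := h) ?_
    · rw [Real.norm_eq_abs] at this
      refine this.trans (le_of_eq ?_)
      have : ((k + 1 : ℕ):ℝ) * h - k * h = h := by push_cast; ring
      rw [this, abs_of_pos hpos]
    · intro t ht
      rw [Set.uIoc_of_le (by push_cast; nlinarith)] at ht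
      have ht2 : t - k * h ≤ h := by have := ht.2; push_cast at this; linarith
      rw [Real.norm_eq_abs]
      refine (abs_abs_sub_abs_le_abs_sub _ _).trans ?_
      have := Real.abs_cos_sub_cos_le (k * h - β) (t - β)
      refine this.trans ?_
      rw [abs_le]; constructor <;> linarith [ht.1]
  have key : |h * ∑ k ∈ Finset.range N, f (k * h) - 2| ≤ N * (h * h) := by
    rw [← hint, hsum, Finset.mul_sum, ← Finset.sum_sub_distrib]
    refine (Finset.abs_sum_le_sum_abs _ _).trans ((Finset.sum_le_sum fun k _ => hterm k).trans ?_)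
    simp
  have e : N * (h * h) = h * Real.pi := by rw [hh]; field_simp
  have e2 : ∑ k ∈ Finset.range N, f (k * h) - 2 * N / Real.pi
      = h⁻¹ * (h * ∑ k ∈ Finset.range N, f (k * h) - 2) := by
    generalize ∑ k ∈ Finset.range N, f (k * h) = S
    rw [hh]; field_simp
  change |∑ k ∈ Finset.range N, f (k * h) - 2 * N / Real.pi| ≤ Real.pi
  rw [e2, abs_mul, abs_of_pos (inv_pos.2 hpos)]
  rw [e] at key
  calc h⁻¹ * _ ≤ h⁻¹ * (h * Real.pi) := by gcongr
    _ = Real.pi := by field_simp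

/-- The sum of the components of a vector in `N` equidistributed directions is nearly
proportional to its norm. -/
lemma abs_sum_abs_inner_dir_sub_le (N : ℕ) (hN : 0 < N) (β : ℝ) (v : Space 2) :
    |∑ k ∈ Finset.range N, |inner ℝ (dir (k * (Real.pi / N) + β)) v| - 2 * N / Real.pi * ‖v‖|
      ≤ Real.pi * ‖v‖ := by
  obtain ⟨α, -, hα⟩ := exists_eq_norm_smul_dir v
  have e : ∀ k : ℕ, |inner ℝ (dir (k * (Real.pi / N) + β)) v|
      = |Real.cos (k * (Real.pi / N) - (α - β))| * ‖v‖ := by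
    intro k
    conv_lhs => rw [hα]
    rw [inner_smul_right, inner_dir_dir, abs_mul, abs_norm, mul_comm]
    congr 3; ring
  simp_rw [e]
  rw [← Finset.sum_mul, ← sub_mul, abs_mul, abs_norm]
  gcongr
  exact abs_sum_abs_cos_sub_le N hN _

end Buckling

/-! ### Slicing: a lower bound for the perimeter by widths -/

namespace Buckling

/-- The strip `{a < ⟪τ, x⟫ < b}` carries the flux `2 (b - a)` in the direction `ν` out of `Ω`: up
to an arbitrarily small error it is the integral over `Ω` of the derivative `∂_ν ψ` of a function
`ψ ∈ C¹_c` with `|ψ| ≤ 1` that lives in the strip. -/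
def HasFlux (Ω : Set (Space 2)) (ν τ : Space 2) (a b : ℝ) : Prop :=
  ∀ ε > 0, ∃ ψ : Space 2 → ℝ, ContDiff ℝ 1 ψ ∧ HasCompactSupport ψ ∧ (∀ x, |ψ x| ≤ 1) ∧
    (∀ x, inner ℝ τ x ∉ Set.Ioo a b → ψ x = 0) ∧ 2 * (b - a) - ε ≤ ∫ x in Ω, fderiv ℝ ψ x ν

lemma HasFlux.self (Ω : Set (Space 2)) (ν τ : Space 2) (a : ℝ) : HasFlux Ω ν τ a a := by
  intro ε hε
  refine ⟨fun _ => 0, contDiff_const, HasCompactSupport.zero, by simp, by simp, ?_⟩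
  simp [hε.le]

lemma integrable_fderiv_apply {d : ℕ} {ψ : Space d → ℝ} (h1 : ContDiff ℝ 1 ψ)
    (h2 : HasCompactSupport ψ) (v : Space d) : Integrable (fun x => fderiv ℝ ψ x v) := by
  refine Continuous.integrable_of_hasCompactSupport
    ((h1.continuous_fderiv one_ne_zero).clm_apply continuous_const) ?_
  exact (h2.fderiv ℝ).mono fun x hx hx0 => hx (by simp [hx0])

lemma HasFlux.trans {Ω : Set (Space 2)} {ν τ : Space 2} {a b c : ℝ} (hab : a ≤ b) (hbc : b ≤ c)
    (h1 : HasFlux Ω ν τ a b) (h2 : HasFlux Ω ν τ b c) : HasFlux Ω ν τ a c := by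
  intro ε hε
  obtain ⟨f, f1, f2, f3, f4, f5⟩ := h1 (ε / 2) (by positivity)
  obtain ⟨g, g1, g2, g3, g4, g5⟩ := h2 (ε / 2) (by positivity)
  refine ⟨f + g, f1.add g1, f2.add g2, fun x => ?_, fun x hx => ?_, ?_⟩
  · by_cases hx : inner ℝ τ x < b
    · simpa [g4 x (fun h => absurd h.1 (not_lt.2 hx.le))] using f3 x
    · simpa [f4 x (fun h => hx h.2)] using g3 x
  · simp only [Pi.add_apply]
    rw [f4 x (fun h => hx ⟨h.1, h.2.trans_le hbc⟩), g4 x (fun h => hx ⟨hab.trans_lt h.1, h.2⟩)]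
    simp
  · have e : ∀ x, fderiv ℝ (f + g) x ν = fderiv ℝ f x ν + fderiv ℝ g x ν := by
      intro x
      rw [fderiv_add (f1.differentiable one_ne_zero x) (g1.differentiable one_ne_zero x)]
      simp
    simp_rw [e]
    rw [integral_add (integrable_fderiv_apply f1 f2 ν).integrableOn
      (integrable_fderiv_apply g1 g2 ν).integrableOn]
    linarith

lemma exists_deriv_smoothTransition_le :
    ∃ M > 0, ∀ s, deriv Real.smoothTransition s ≤ M := by
  have hc : Continuous (deriv Real.smoothTransition) :=
    (Real.smoothTransition.contDiff (n := 1)).continuous_deriv le_rfl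
  obtain ⟨C, hC⟩ := (isCompact_Icc (a := (0:ℝ)) (b := 1)).exists_bound_of_continuousOn
    hc.continuousOn
  refine ⟨max C 1, by positivity, fun s => ?_⟩
  by_cases hs : s ∈ Set.Icc (0:ℝ) 1
  · exact (le_abs_self _).trans ((hC s hs).trans (le_max_left _ _))
  · have : deriv Real.smoothTransition s = 0 := by
      rw [Set.mem_Icc, not_and_or, not_le, not_le] at hs
      rcases hs with hs | hs
      · have : Real.smoothTransition =ᶠ[𝓝 s] fun _ => 0 := by
          filter_upwards [Iio_mem_nhds hs] with t ht
          exact Real.smoothTransition.zero_of_nonpos ht.le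
        rw [this.deriv_eq]; simp
      · have : Real.smoothTransition =ᶠ[𝓝 s] fun _ => 1 := by
          filter_upwards [Ioi_mem_nhds hs] with t ht
          exact Real.smoothTransition.one_of_one_le ht.le
        rw [this.deriv_eq]; simp
    rw [this]; positivity

lemma hasDerivAt_smoothTransition_affine (x δ s : ℝ) :
    HasDerivAt (fun s => Real.smoothTransition ((s - x) / δ))
      (deriv Real.smoothTransition ((s - x) / δ) / δ) s := by
  have h : HasDerivAt Real.smoothTransition (deriv Real.smoothTransition ((s - x) / δ))
      ((s - x) / δ) :=
    ((Real.smoothTransition.contDiff (n := 1)).differentiable one_ne_zero _).hasDerivAt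
  have h2 := h.comp s (((hasDerivAt_id s).sub_const x).div_const δ)
  exact h2.congr_deriv (by ring)

/-- A rectangle contained in `Ω` produces flux through its strip: `ψ` jumps from `-1` to `1` inside
the rectangle and decays to `0` over a long distance on both sides, which costs little since `Ω` has
finite measure. -/
lemma HasFlux.of_rectangle {Ω : Set (Space 2)} (hvol : volume Ω < ⊤)
    {ν τ : Space 2} (hν : ‖ν‖ = 1) (hτ : ‖τ‖ = 1) (h : inner ℝ ν τ = 0) {a b x δ : ℝ}
    (hδ : 0 < δ)
    (hsub : ∀ s ∈ Set.Icc x (x + δ), ∀ t ∈ Set.Icc a b, s • ν + t • τ ∈ Ω) :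
    HasFlux Ω ν τ a b := by
  intro ε hε
  obtain ⟨M, hM, hMle⟩ := exists_deriv_smoothTransition_le
  set T := Real.smoothTransition with hT
  have hTd : ContDiff ℝ 1 T := Real.smoothTransition.contDiff
  have hTmono : Monotone T := Real.smoothTransition.monotone
  have hT'0 : ∀ s, 0 ≤ deriv T s := fun s => hTmono.deriv_nonneg
  -- the length `R` over which `ψ` decays, and the width `e` of the cut-off in the strip
  set V := (volume Ω).toReal with hV
  have hV0 : 0 ≤ V := ENNReal.toReal_nonneg
  set R : ℝ := 4 * M * (V + 1) / ε with hR
  have hRpos : 0 < R := by positivity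
  set e : ℝ := ε / 8 with he
  have hepos : 0 < e := by positivity
  set χ : ℝ → ℝ := fun t => T ((t - a) / e) * T ((b - t) / e) with hχ
  set η : ℝ → ℝ := fun s => 2 * T ((s - x) / δ) - T ((s - (x - R)) / R) - T ((s - (x + δ)) / R)
    with hη
  set κ : ℝ → ℝ := fun s => 2 * (deriv T ((s - x) / δ) / δ) with hκ
  set β : ℝ → ℝ := fun s => deriv T ((s - (x - R)) / R) / R + deriv T ((s - (x + δ)) / R) / R
    with hβ
  have hηd : ∀ s, HasDerivAt η (κ s - β s) s := by
    intro s
    have h1 := (hasDerivAt_smoothTransition_affine x δ s).const_mul 2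
    have h2 := hasDerivAt_smoothTransition_affine (x - R) R s
    have h3 := hasDerivAt_smoothTransition_affine (x + δ) R s
    exact ((h1.sub h2).sub h3).congr_deriv (by simp only [hκ, hβ]; ring)
  -- in the derivative of the profile `η`, `κ` comes from the jump and `-β` from the decay
  have hκ0 : ∀ s, 0 ≤ κ s := fun s => by
    have := hT'0 ((s - x) / δ); simp only [hκ]; positivity
  have hβle : ∀ s, β s ≤ 2 * M / R := fun s => by
    have h1 := hMle ((s - (x - R)) / R)
    have h2 := hMle ((s - (x + δ)) / R)
    simp only [hβ]
    rw [← add_div]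
    gcongr; linarith
  have hβ0 : ∀ s, 0 ≤ β s := fun s => by
    have h1 := hT'0 ((s - (x - R)) / R)
    have h2 := hT'0 ((s - (x + δ)) / R)
    simp only [hβ]; positivity
  have T01 : ∀ s, 0 ≤ T s ∧ T s ≤ 1 := fun s =>
    ⟨Real.smoothTransition.nonneg s, Real.smoothTransition.le_one s⟩
  have hχ01 : ∀ t, 0 ≤ χ t ∧ χ t ≤ 1 := fun t => by
    have h1 := T01 ((t - a) / e); have h2 := T01 ((b - t) / e)
    exact ⟨mul_nonneg h1.1 h2.1, mul_le_one₀ h1.2 h2.1 h2.2⟩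
  have hχ_out : ∀ t, t ∉ Set.Ioo a b → χ t = 0 := fun t ht => by
    simp only [hχ]
    rcases le_or_gt t a with h1 | h1
    · rw [hT, Real.smoothTransition.zero_of_nonpos (div_nonpos_of_nonpos_of_nonneg (by linarith)
        hepos.le), zero_mul]
    · have h2 : b ≤ t := not_lt.1 fun h2 => ht ⟨h1, h2⟩
      rw [hT, Real.smoothTransition.zero_of_nonpos (x := (b - t) / e)
        (div_nonpos_of_nonpos_of_nonneg (by linarith) hepos.le), mul_zero]
  have hη1 : ∀ s, |η s| ≤ 1 := fun s => by
    have h1 := T01 ((s - x) / δ)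
    have h2 := T01 ((s - (x - R)) / R)
    have h3 := T01 ((s - (x + δ)) / R)
    simp only [hη]
    rcases le_or_gt s x with hs | hs
    · have e1 : T ((s - x) / δ) = 0 := Real.smoothTransition.zero_of_nonpos
        (div_nonpos_of_nonpos_of_nonneg (by linarith) hδ.le)
      have e2 : T ((s - (x + δ)) / R) = 0 := Real.smoothTransition.zero_of_nonpos
        (div_nonpos_of_nonpos_of_nonneg (by linarith) hRpos.le)
      rw [e1, e2, abs_le]; constructor <;> linarith
    · have e1 : T ((s - (x - R)) / R) = 1 := Real.smoothTransition.one_of_one_le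
        ((one_le_div hRpos).2 (by linarith))
      rw [e1]
      rcases le_or_gt s (x + δ) with hs2 | hs2
      · have e2 : T ((s - (x + δ)) / R) = 0 := Real.smoothTransition.zero_of_nonpos
          (div_nonpos_of_nonpos_of_nonneg (by linarith) hRpos.le)
        rw [e2, abs_le]; constructor <;> linarith
      · have e2 : T ((s - x) / δ) = 1 := Real.smoothTransition.one_of_one_le
          ((one_le_div hδ).2 (by linarith))
        rw [e2, abs_le]; constructor <;> linarith
  have hη_out : ∀ s, s ∉ Set.Icc (x - R) (x + δ + R) → η s = 0 := fun s hs => by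
    simp only [hη]
    rw [Set.mem_Icc, not_and_or, not_le, not_le] at hs
    rcases hs with hs | hs
    · rw [hT, Real.smoothTransition.zero_of_nonpos (x := (s - x) / δ)
          (div_nonpos_of_nonpos_of_nonneg (by linarith) hδ.le),
        Real.smoothTransition.zero_of_nonpos (x := (s - (x - R)) / R)
          (div_nonpos_of_nonpos_of_nonneg (by linarith) hRpos.le),
        Real.smoothTransition.zero_of_nonpos (x := (s - (x + δ)) / R)
          (div_nonpos_of_nonpos_of_nonneg (by linarith) hRpos.le)]
      ring
    · rw [hT, Real.smoothTransition.one_of_one_le (x := (s - x) / δ)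
          ((one_le_div hδ).2 (by linarith)),
        Real.smoothTransition.one_of_one_le (x := (s - (x - R)) / R)
          ((one_le_div hRpos).2 (by linarith)),
        Real.smoothTransition.one_of_one_le (x := (s - (x + δ)) / R)
          ((one_le_div hRpos).2 (by linarith))]
      ring
  have hκ_out : ∀ s, s ∉ Set.Icc x (x + δ) → κ s = 0 := fun s hs => by
    have hg : ∀ c : ℝ, (fun s => T ((s - x) / δ)) =ᶠ[𝓝 s] (fun _ => c) → κ s = 0 := by
      intro c hc
      have h1 := (hasDerivAt_smoothTransition_affine x δ s).unique
        ((hasDerivAt_const s c).congr_of_eventuallyEq hc)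
      simp only [hκ]; rw [h1, mul_zero]
    rw [Set.mem_Icc, not_and_or, not_le, not_le] at hs
    rcases hs with hs | hs
    · apply hg 0
      filter_upwards [Iio_mem_nhds hs] with t ht
      exact Real.smoothTransition.zero_of_nonpos
        (div_nonpos_of_nonpos_of_nonneg (by linarith [Set.mem_Iio.1 ht]) hδ.le)
    · apply hg 1
      filter_upwards [Ioi_mem_nhds hs] with t ht
      exact Real.smoothTransition.one_of_one_le ((one_le_div hδ).2 (by linarith [Set.mem_Ioi.1 ht]))
  have hχc : ContDiff ℝ 1 χ := by
    simp only [hχ]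
    exact (hTd.comp (by fun_prop)).mul (hTd.comp (by fun_prop))
  have hηc : ContDiff ℝ 1 η := by
    simp only [hη]
    exact ((contDiff_const.mul (hTd.comp (by fun_prop))).sub (hTd.comp (by fun_prop))).sub
      (hTd.comp (by fun_prop))
  have hκc : Continuous κ := by
    have := hTd.continuous_deriv le_rfl
    simp only [hκ]; fun_prop
  have hκi : Integrable κ := hκc.integrable_of_hasCompactSupport
    (HasCompactSupport.intro isCompact_Icc hκ_out)
  have hχi : Integrable χ := hχc.continuous.integrable_of_hasCompactSupport
    (HasCompactSupport.intro (isCompact_Icc (a := a) (b := b))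
      fun t ht => hχ_out t fun h => ht ⟨h.1.le, h.2.le⟩)
  have hκint : ∫ s, κ s = 2 := by
    have := integral_of_hasDerivAt_of_tendsto (f := fun s => 2 * T ((s - x) / δ)) (f' := κ)
      (m := 0) (n := 2) (fun s => (hasDerivAt_smoothTransition_affine x δ s).const_mul 2) hκi ?_ ?_
    · rw [this]; norm_num
    · refine tendsto_const_nhds.congr' ?_
      filter_upwards [eventually_le_atBot x] with s hs
      rw [hT, Real.smoothTransition.zero_of_nonpos (div_nonpos_of_nonpos_of_nonneg (by linarith)
        hδ.le), mul_zero]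
    · refine tendsto_const_nhds.congr' ?_
      filter_upwards [eventually_ge_atTop (x + δ)] with s hs
      rw [hT, Real.smoothTransition.one_of_one_le ((one_le_div hδ).2 (by linarith)), mul_one]
  have hχint : b - a - 2 * e ≤ ∫ t, χ t := by
    rcases le_or_gt (b - a) (2 * e) with hbe | hbe
    · have : 0 ≤ ∫ t, χ t := integral_nonneg fun t => (hχ01 t).1
      linarith
    · calc b - a - 2 * e = ∫ t in Set.Icc (a + e) (b - e), (1:ℝ) := by
            simp only [integral_const, smul_eq_mul, mul_one, Measure.real, MeasurableSet.univ,
              Measure.restrict_apply, Set.univ_inter, Real.volume_Icc]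
            rw [ENNReal.toReal_ofReal (by linarith)]; ring
        _ = ∫ t in Set.Icc (a + e) (b - e), χ t := by
            refine setIntegral_congr_fun measurableSet_Icc fun t ht => ?_
            simp only [hχ, hT]
            rw [Real.smoothTransition.one_of_one_le ((one_le_div hepos).2 (by linarith [ht.1])),
              Real.smoothTransition.one_of_one_le ((one_le_div hepos).2 (by linarith [ht.2])),
              mul_one]
        _ ≤ ∫ t, χ t := setIntegral_le_integral hχi (Eventually.of_forall fun t => (hχ01 t).1)
  set ψ : Space 2 → ℝ := fun y => χ (inner ℝ τ y) * η (inner ℝ ν y) with hψ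
  have hψc : ContDiff ℝ 1 ψ :=
    (hχc.comp (contDiff_const.inner ℝ contDiff_id)).mul
      (hηc.comp (contDiff_const.inner ℝ contDiff_id))
  have hψs : HasCompactSupport ψ := by
    refine HasCompactSupport.intro (K := (fun p : ℝ × ℝ => p.1 • ν + p.2 • τ) ''
      (Set.Icc (x - R) (x + δ + R) ×ˢ Set.Icc a b)) ?_ fun y hy => ?_
    · exact (isCompact_Icc.prod isCompact_Icc).image (by fun_prop)
    · by_contra hne
      apply hy
      refine ⟨(inner ℝ ν y, inner ℝ τ y), ⟨?_, ?_⟩, frame_expand hν hτ h y⟩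
      · by_contra h1; exact hne (by simp only [hψ]; rw [hη_out _ h1, mul_zero])
      · by_contra h1
        exact hne (by
          simp only [hψ]; rw [hχ_out _ fun h2 => h1 ⟨h2.1.le, h2.2.le⟩, zero_mul])
  have hderiv : ∀ y, fderiv ℝ ψ y ν = χ (inner ℝ τ y) * (κ (inner ℝ ν y) - β (inner ℝ ν y)) := by
    intro y
    have h1 : HasFDerivAt ψ (fderiv ℝ ψ y) y :=
      (hψc.differentiable one_ne_zero y).hasFDerivAt
    have h2 : HasDerivAt (fun s : ℝ => ψ (y + s • ν)) (fderiv ℝ ψ y ν) 0 := by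
      have hline : HasDerivAt (fun s : ℝ => y + s • ν) ν 0 := by
        simpa using ((hasDerivAt_id (0:ℝ)).smul_const ν).const_add y
      have h1' : HasFDerivAt ψ (fderiv ℝ ψ y) (y + (0:ℝ) • ν) := by simpa using h1
      exact h1'.comp_hasDerivAt (0:ℝ) hline
    have h3 : HasDerivAt (fun s : ℝ => ψ (y + s • ν))
        (χ (inner ℝ τ y) * (κ (inner ℝ ν y) - β (inner ℝ ν y))) 0 := by
      have hτν : inner ℝ τ ν = 0 := by rw [real_inner_comm]; exact h
      have e : (fun s : ℝ => ψ (y + s • ν))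
          = fun s => χ (inner ℝ τ y) * η (inner ℝ ν y + s) := by
        funext s
        simp only [hψ, inner_add_right, inner_smul_right, hτν, mul_zero, add_zero,
          real_inner_self_eq_norm_sq, hν, one_pow, mul_one]
      rw [e]
      have h4 := hηd (inner ℝ ν y + 0)
      have h5 := h4.comp (0:ℝ) ((hasDerivAt_id (0:ℝ)).const_add (inner ℝ ν y))
      simpa using h5.const_mul (χ (inner ℝ τ y))
    exact h2.unique h3
  refine ⟨ψ, hψc, hψs, fun y => ?_, fun y hy => ?_, ?_⟩
  · simp only [hψ]
    rw [abs_mul, abs_of_nonneg (hχ01 _).1]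
    exact mul_le_one₀ (hχ01 _).2 (abs_nonneg _) (hη1 _)
  · simp only [hψ]; rw [hχ_out _ hy, zero_mul]
  · -- lower bound: the jump counts in full, the decay costs at most `2 M / R` on `Ω`
    have hF := measurePreserving_frameEquiv hν hτ h
    set g : Space 2 → ℝ := fun y => κ (inner ℝ ν y) * χ (inner ℝ τ y) with hg
    have hgint : ∫ y, g y = 2 * ∫ t, χ t := by
      rw [← hF.integral_comp (frameEquiv hν hτ h).measurableEmbedding]
      simp only [hg, inner_frameEquiv_fst, inner_frameEquiv_snd]
      rw [← hκint, Measure.volume_eq_prod, integral_prod_mul]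
    have hgi : Integrable g := by
      rw [← hF.integrable_comp_emb (frameEquiv hν hτ h).measurableEmbedding]
      have : Integrable (fun p : ℝ × ℝ => κ p.1 * χ p.2) (volume.prod volume) := hκi.mul_prod hχi
      refine this.congr (Eventually.of_forall fun p => ?_)
      simp only [hg, Function.comp, inner_frameEquiv_fst, inner_frameEquiv_snd]
    have hgΩ : ∫ y in Ω, g y = ∫ y, g y := by
      refine setIntegral_eq_integral_of_forall_compl_eq_zero fun y hy => ?_
      by_contra hne
      apply hy
      rw [← frame_expand hν hτ h y]
      refine hsub _ ?_ _ ?_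
      · by_contra h1; exact hne (by simp only [hg]; rw [hκ_out _ h1, zero_mul])
      · by_contra h1
        exact hne (by
          simp only [hg]; rw [hχ_out _ fun h2 => h1 ⟨h2.1.le, h2.2.le⟩, mul_zero])
    have hconst : IntegrableOn (fun _ : Space 2 => 2 * M / R) Ω := integrableOn_const hvol.ne
    have hle : ∫ y in Ω, (g y - 2 * M / R) ≤ ∫ y in Ω, fderiv ℝ ψ y ν := by
      refine integral_mono (hgi.integrableOn.sub hconst)
        (integrable_fderiv_apply hψc hψs ν).integrableOn fun y => ?_
      simp only [hderiv, hg]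
      have h1 := hχ01 (inner ℝ τ y)
      have h2 := hβ0 (inner ℝ ν y)
      have h3 := hβle (inner ℝ ν y)
      nlinarith
    rw [integral_sub hgi.integrableOn hconst, hgΩ, hgint] at hle
    have hc : ∫ _ in Ω, 2 * M / R = V * (2 * M / R) := by
      rw [setIntegral_const, smul_eq_mul]; rfl
    rw [hc] at hle
    have hsmall : V * (2 * M / R) ≤ ε / 2 := by
      rw [hR]
      have : V * (2 * M / (4 * M * (V + 1) / ε)) = (V / (V + 1)) * (ε / 2) := by
        field_simp; ring
      rw [this]
      have : V / (V + 1) ≤ 1 := (div_le_one (by positivity)).2 (by linarith)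
      nlinarith
    linarith

/-- The flux out of `Ω` through any strip that is covered by the projection of `Ω`. -/
lemma HasFlux.of_image {Ω : Set (Space 2)} (hΩ : IsOpen Ω) (hvol : volume Ω < ⊤)
    {ν τ : Space 2} (hν : ‖ν‖ = 1) (hτ : ‖τ‖ = 1) (h : inner ℝ ν τ = 0) {a b : ℝ}
    (hab : a ≤ b) (hsub : Set.Icc a b ⊆ (fun x => inner ℝ τ x) '' Ω) :
    HasFlux Ω ν τ a b := by
  -- locally there is a rectangle around a preimage; strips are then glued along `[a, b]`
  have hloc : ∀ y : Set.Icc a b, ∃ r > 0, ∀ a' b' : ℝ, |a' - y| < r → |b' - y| < r →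
      HasFlux Ω ν τ a' b' := by
    rintro ⟨y, hy⟩
    obtain ⟨z, hz, hzy⟩ := hsub hy
    obtain ⟨r, hr, hball⟩ := Metric.isOpen_iff.1 hΩ z hz
    refine ⟨r / 4, by positivity, fun a' b' ha hb => ?_⟩
    refine HasFlux.of_rectangle hvol hν hτ h (x := inner ℝ ν z) (δ := r / 4)
      (by positivity) fun s hs t ht => hball ?_
    rw [mem_ball_iff_norm]
    have e : s • ν + t • τ - z = (s - inner ℝ ν z) • ν + (t - inner ℝ τ z) • τ := by
      conv_lhs => rw [← frame_expand hν hτ h z]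
      module
    rw [e]
    have h1 : |s - inner ℝ ν z| ≤ r / 4 := by
      rw [abs_le]; constructor <;> linarith [hs.1, hs.2]
    have h2 : |t - inner ℝ τ z| ≤ r / 4 := by
      have hzy' : inner ℝ τ z = y := hzy
      rw [hzy', abs_le]
      rw [abs_lt] at ha hb
      constructor <;> linarith [ht.1, ht.2, ha.1, hb.2]
    calc _ ≤ ‖(s - inner ℝ ν z) • ν‖ + ‖(t - inner ℝ τ z) • τ‖ := norm_add_le _ _
      _ = |s - inner ℝ ν z| + |t - inner ℝ τ z| := by simp [norm_smul, hν, hτ]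
      _ < r := by linarith
  choose r hr hr2 using hloc
  obtain ⟨t, ht0, htm, ⟨m, hm⟩, hti⟩ := exists_monotone_Icc_subset_open_cover_Icc hab
    (c := fun i : Set.Icc a b => Metric.ball i (r i)) (fun i => Metric.isOpen_ball)
    (fun i _ => Set.mem_iUnion.2 ⟨i, Metric.mem_ball_self (hr i)⟩)
  have hind : ∀ n, HasFlux Ω ν τ a (t n) := by
    intro n
    induction n with
    | zero => rw [ht0]; exact HasFlux.self _ _ _ _
    | succ n ih =>
      refine ih.trans (t n).2.1 (htm (Nat.le_succ n)) ?_
      obtain ⟨i, hi⟩ := hti n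
      have h1 := hi (Set.left_mem_Icc.2 (htm (Nat.le_succ n)))
      have h2 := hi (Set.right_mem_Icc.2 (htm (Nat.le_succ n)))
      exact hr2 i _ _ h1 h2
  have := hind m
  rwa [hm m le_rfl] at this

/-- The width of `U` in the direction `τ`: the length of its projection to the line `ℝ τ`. -/
noncomputable def width (U : Set (Space 2)) (τ : Space 2) : ℝ≥0∞ :=
  volume ((fun x => inner ℝ τ x) '' U)

lemma width_mono {U V : Set (Space 2)} (h : U ⊆ V) (τ : Space 2) : width U τ ≤ width V τ :=
  measure_mono (Set.image_mono h)

/-- A linear image of a planar set and of its convex hull have the same length if the set is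
connected. -/
lemma width_convexHull {U : Set (Space 2)} (hU : IsPreconnected U) (τ : Space 2) :
    width (convexHull ℝ U) τ = width U τ := by
  unfold width
  have h1 : IsPreconnected ((fun x => inner ℝ τ x) '' U) := hU.image _ (by fun_prop)
  have h2 : Convex ℝ ((fun x => inner ℝ τ x) '' U) := Real.convex_iff_isPreconnected.2 h1
  congr 1
  have := (innerSL ℝ τ).toLinearMap.image_convexHull U
  exact this.trans h2.convexHull_eq

lemma exists_Icc_subset_of_lt_volume {J : Set ℝ} (hJ : J.OrdConnected) (hne : J.Nonempty) {r : ℝ}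
    (h : r < 0 ∨ ENNReal.ofReal r < volume J) : ∃ a b, a ≤ b ∧ Set.Icc a b ⊆ J ∧ r ≤ b - a := by
  by_contra hcon
  push Not at hcon
  have hd : ∀ x ∈ J, ∀ y ∈ J, y - x < r := by
    intro x hx y hy
    rcases le_total x y with hxy | hxy
    · exact hcon x y hxy (hJ.out hx hy)
    · have := hcon x x le_rfl (by simpa using hx)
      linarith
  obtain ⟨z, hz⟩ := hne
  have hr0 : 0 < r := by simpa using hd z hz z hz
  have hle : volume J ≤ ENNReal.ofReal r := by
    refine (Real.volume_le_diam J).trans ?_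
    refine Metric.ediam_le fun x hx y hy => ?_
    rw [edist_dist]
    apply ENNReal.ofReal_le_ofReal
    rw [Real.dist_eq, abs_le]
    constructor <;> linarith [hd x hx y hy, hd y hy x hx]
  rcases h with h | h
  · linarith
  · exact absurd h (not_lt.2 hle)

/-- Superposition of fields in several directions. The constant `c` bounds the norm of the
combined field. -/
lemma ofReal_sum_le_perimeter {ι : Type*} (s : Finset ι) {Ω : Set (Space 2)} (ν τ : ι → Space 2)
    {c : ℝ} (hc : 0 < c) (hle : ∀ v : Space 2, ∑ k ∈ s, |inner ℝ (ν k) v| ≤ c * ‖v‖)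
    (a b : ι → ℝ) (hf : ∀ k ∈ s, HasFlux Ω (ν k) (τ k) (a k) (b k)) :
    ENNReal.ofReal (∑ k ∈ s, 2 * (b k - a k)) ≤ ENNReal.ofReal c * perimeter Ω := by
  refine ENNReal.le_of_forall_pos_le_add fun ε hε _ => ?_
  set e : ℝ := ε / (s.card + 1) with he
  have hεr : (0:ℝ) < ε := hε
  have hepos : 0 < e := by positivity
  have hf' : ∀ k : ι, ∃ ψ : Space 2 → ℝ, k ∈ s → ContDiff ℝ 1 ψ ∧ HasCompactSupport ψ ∧
      (∀ x, |ψ x| ≤ 1) ∧ 2 * (b k - a k) - e ≤ ∫ x in Ω, fderiv ℝ ψ x (ν k) := by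
    intro k
    by_cases hk : k ∈ s
    · obtain ⟨ψ, h1, h2, h3, -, h5⟩ := hf k hk e hepos
      exact ⟨ψ, fun _ => ⟨h1, h2, h3, h5⟩⟩
    · exact ⟨0, fun h => absurd h hk⟩
  choose ψ hψ using hf'
  set φ : Space 2 → Space 2 := fun x => c⁻¹ • ∑ k ∈ s, ψ k x • ν k with hφ
  have hφd : ∀ x, HasFDerivAt φ (c⁻¹ • ∑ k ∈ s, (fderiv ℝ (ψ k) x).smulRight (ν k)) x := by
    intro x
    refine (HasFDerivAt.fun_sum fun k hk => ?_).const_smul c⁻¹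
    exact (((hψ k hk).1.differentiable one_ne_zero x).hasFDerivAt).smul_const (ν k)
  have hdiv : ∀ x, divergence φ x = c⁻¹ * ∑ k ∈ s, fderiv ℝ (ψ k) x (ν k) := by
    intro x
    have e1 : ∀ k, fderiv ℝ (ψ k) x (ν k) = ∑ i, fderiv ℝ (ψ k) x (EuclideanSpace.single i 1) *
        ν k i := by
      intro k
      have e2 : ν k = ∑ i, ν k i • (EuclideanSpace.single i (1:ℝ) : Space 2) := by
        ext j; fin_cases j <;> simp [Fin.sum_univ_two]
      conv_lhs => rw [e2, map_sum]
      refine Finset.sum_congr rfl fun i _ => ?_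
      rw [map_smul, smul_eq_mul, mul_comm]
    simp only [divergence, (hφd x).fderiv]
    simp only [e1, Finset.sum_comm (s := s), Finset.mul_sum]
    refine Finset.sum_congr rfl fun i _ => ?_
    simp [Finset.mul_sum]
  have hφ1 : ContDiff ℝ 1 φ := by
    have h1 : ContDiff ℝ 1 fun x => ∑ k ∈ s, ψ k x • ν k :=
      ContDiff.sum fun k hk => (hψ k hk).1.smul (contDiff_const (c := ν k))
    exact h1.const_smul c⁻¹
  have hφ2 : HasCompactSupport φ := by
    refine HasCompactSupport.intro (K := ⋃ k ∈ s, tsupport (ψ k))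
      (s.finite_toSet.isCompact_biUnion fun k hk => (hψ k hk).2.1) fun x hx => ?_
    simp only [hφ]
    rw [Finset.sum_eq_zero, smul_zero]
    intro k hk
    rw [image_eq_zero_of_notMem_tsupport fun h => hx (Set.mem_biUnion hk h), zero_smul]
  have hφ3 : ∀ x, ‖φ x‖ ≤ 1 := by
    intro x
    have h1 : ‖φ x‖ * ‖φ x‖ ≤ 1 * ‖φ x‖ := by
      calc ‖φ x‖ * ‖φ x‖ = inner ℝ (φ x) (φ x) := (real_inner_self_eq_norm_mul_norm _).symm
        _ = c⁻¹ * ∑ k ∈ s, ψ k x * inner ℝ (ν k) (φ x) := by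
            conv_lhs => rw [show φ x = c⁻¹ • ∑ k ∈ s, ψ k x • ν k from rfl]
            rw [real_inner_smul_left, sum_inner]
            congr 1
            refine Finset.sum_congr rfl fun k _ => ?_
            rw [real_inner_smul_left]
        _ ≤ c⁻¹ * ∑ k ∈ s, |inner ℝ (ν k) (φ x)| := by
            gcongr with k hk
            refine (le_abs_self _).trans ?_
            rw [abs_mul]
            exact mul_le_of_le_one_left (abs_nonneg _) ((hψ k hk).2.2.1 x)
        _ ≤ c⁻¹ * (c * ‖φ x‖) := by gcongr; exact hle _
        _ = 1 * ‖φ x‖ := by field_simp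
    by_contra hcon
    push Not at hcon
    nlinarith
  have hP : ENNReal.ofReal (∫ x in Ω, divergence φ x) ≤ perimeter Ω :=
    le_sSup ⟨φ, hφ1, hφ2, hφ3, rfl⟩
  have hint : ∫ x in Ω, divergence φ x = c⁻¹ * ∑ k ∈ s, ∫ x in Ω, fderiv ℝ (ψ k) x (ν k) := by
    simp_rw [hdiv]
    rw [integral_const_mul, integral_finsetSum]
    exact fun k hk => (integrable_fderiv_apply (hψ k hk).1 (hψ k hk).2.1 _).integrableOn
  have hlow : ∑ k ∈ s, 2 * (b k - a k) ≤ c * (∫ x in Ω, divergence φ x) + ε := by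
    rw [hint, ← mul_assoc, mul_inv_cancel₀ hc.ne', one_mul]
    have h1 : ∑ k ∈ s, (2 * (b k - a k) - e) ≤ ∑ k ∈ s, ∫ x in Ω, fderiv ℝ (ψ k) x (ν k) :=
      Finset.sum_le_sum fun k hk => (hψ k hk).2.2.2
    rw [Finset.sum_sub_distrib] at h1
    have h2 : ∑ k ∈ s, e ≤ ε := by
      rw [Finset.sum_const, nsmul_eq_mul, he]
      have : (s.card : ℝ) * (ε / (s.card + 1)) = ε * (s.card / (s.card + 1)) := by ring
      rw [this]
      exact mul_le_of_le_one_right hεr.le ((div_le_one (by positivity)).2 (by linarith))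
    linarith
  calc ENNReal.ofReal (∑ k ∈ s, 2 * (b k - a k))
      ≤ ENNReal.ofReal (c * (∫ x in Ω, divergence φ x) + ε) := ENNReal.ofReal_le_ofReal hlow
    _ ≤ ENNReal.ofReal (c * ∫ x in Ω, divergence φ x) + ENNReal.ofReal ε := ENNReal.ofReal_add_le
    _ ≤ ENNReal.ofReal c * perimeter Ω + ε := by
        rw [ENNReal.ofReal_mul hc.le, ENNReal.ofReal_coe_nnreal]
        gcongr

/-- A connected part `U` of `Ω` has at least two boundary crossings on almost every line that meets
it, so its widths bound the perimeter of `Ω` from below. -/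
theorem sum_width_le_perimeter {ι : Type*} (s : Finset ι) {Ω U : Set (Space 2)} (hΩ : IsOpen Ω)
    (hvol : volume Ω < ⊤) (hUΩ : U ⊆ Ω) (hU : IsConnected U) (ν τ : ι → Space 2)
    (hν : ∀ k, ‖ν k‖ = 1) (hτ : ∀ k, ‖τ k‖ = 1) (h : ∀ k, inner ℝ (ν k) (τ k) = 0)
    {c : ℝ} (hc : 0 < c) (hle : ∀ v : Space 2, ∑ k ∈ s, |inner ℝ (ν k) v| ≤ c * ‖v‖) :
    ∑ k ∈ s, 2 * width U (τ k) ≤ ENNReal.ofReal c * perimeter Ω := by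
  have hJ : ∀ k, ((fun x => inner ℝ (τ k) x) '' U).OrdConnected := fun k =>
    (hU.isPreconnected.image _ (by fun_prop)).ordConnected
  have hJne : ∀ k, ((fun x => inner ℝ (τ k) x) '' U).Nonempty := fun k => hU.nonempty.image _
  have hflux : ∀ k a b, a ≤ b → Set.Icc a b ⊆ (fun x => inner ℝ (τ k) x) '' U →
      HasFlux Ω (ν k) (τ k) a b := fun k a b hab hsub =>
    HasFlux.of_image hΩ hvol (hν k) (hτ k) (h k) hab (hsub.trans (Set.image_mono hUΩ))
  rcases eq_or_ne (perimeter Ω) ⊤ with htop | htop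
  · rw [htop, ENNReal.mul_top (by simpa using hc)]; exact le_top
  -- a single direction shows that the widths are finite
  have hfin : ∀ k, width U (τ k) < ⊤ := by
    intro k
    by_contra hcon
    rw [not_lt, top_le_iff] at hcon
    obtain ⟨a, b, hab, hsub, hr⟩ := exists_Icc_subset_of_lt_volume (hJ k) (hJne k)
      (r := (perimeter Ω).toReal + 1) (Or.inr (by
        change _ < width U (τ k); rw [hcon]; exact ENNReal.ofReal_lt_top))
    have h1 := ofReal_sum_le_perimeter (Finset.univ : Finset Unit) (Ω := Ω) (fun _ => ν k)
      (fun _ => τ k) one_pos (fun v => by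
        simpa [hν k] using abs_real_inner_le_norm (ν k) v) (fun _ => a) (fun _ => b)
      (fun _ _ => hflux k a b hab hsub)
    simp only [Finset.univ_unique, Finset.sum_singleton, ENNReal.ofReal_one, one_mul] at h1
    have h2 := (ENNReal.ofReal_le_iff_le_toReal htop).1 h1
    have h3 : 0 ≤ (perimeter Ω).toReal := ENNReal.toReal_nonneg
    linarith
  refine ENNReal.le_of_forall_pos_le_add fun ε hε _ => ?_
  set e : ℝ := ε / (2 * (s.card + 1)) with he
  have hεr : (0:ℝ) < ε := hε
  have hepos : 0 < e := by positivity
  have hex : ∀ k, ∃ a b, a ≤ b ∧ Set.Icc a b ⊆ (fun x => inner ℝ (τ k) x) '' U ∧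
      (width U (τ k)).toReal - e ≤ b - a := by
    intro k
    refine exists_Icc_subset_of_lt_volume (hJ k) (hJne k) ?_
    rcases lt_or_ge ((width U (τ k)).toReal - e) 0 with h1 | h1
    · exact Or.inl h1
    · exact Or.inr ((ENNReal.ofReal_lt_iff_lt_toReal h1 (hfin k).ne).2
        (sub_lt_self (width U (τ k)).toReal hepos))
  choose a b hab hsub hr using hex
  have h1 := ofReal_sum_le_perimeter s ν τ hc hle a b
    (fun k _ => hflux k _ _ (hab k) (hsub k))
  have h2 : ∑ k ∈ s, 2 * (width U (τ k)).toReal ≤ ∑ k ∈ s, 2 * (b k - a k) + ε := by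
    have h3 : ∑ k ∈ s, 2 * ((width U (τ k)).toReal - e) ≤ ∑ k ∈ s, 2 * (b k - a k) :=
      Finset.sum_le_sum fun k _ => by linarith [hr k]
    simp only [mul_sub, Finset.sum_sub_distrib] at h3 ⊢
    have h4 : ∑ k ∈ s, 2 * e ≤ ε := by
      rw [Finset.sum_const, nsmul_eq_mul, he]
      have : (s.card : ℝ) * (2 * (ε / (2 * (s.card + 1)))) = ε * (s.card / (s.card + 1)) := by
        field_simp
      rw [this]
      exact mul_le_of_le_one_right hεr.le ((div_le_one (by positivity)).2 (by linarith))
    linarith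
  calc ∑ k ∈ s, 2 * width U (τ k) = ENNReal.ofReal (∑ k ∈ s, 2 * (width U (τ k)).toReal) := by
        rw [ENNReal.ofReal_sum_of_nonneg fun k _ => by positivity]
        refine Finset.sum_congr rfl fun k _ => ?_
        rw [ENNReal.ofReal_mul two_pos.le, ENNReal.ofReal_toReal (hfin k).ne]
        simp
    _ ≤ ENNReal.ofReal (∑ k ∈ s, 2 * (b k - a k) + ε) := ENNReal.ofReal_le_ofReal h2
    _ ≤ ENNReal.ofReal (∑ k ∈ s, 2 * (b k - a k)) + ENNReal.ofReal ε := ENNReal.ofReal_add_le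
    _ ≤ ENNReal.ofReal c * perimeter Ω + ε := by
        rw [ENNReal.ofReal_coe_nnreal]
        gcongr

end Buckling

/-! ### Hausdorff measure of curves -/

namespace Buckling

/-- An arc of a curve is at least as long as its chord. -/
lemma edist_le_hausdorffMeasure_image {X : Type*} [MetricSpace X] [MeasurableSpace X] [BorelSpace X]
    {γ : ℝ → X} (hγ : Continuous γ) {a b : ℝ} (hab : a ≤ b) :
    edist (γ b) (γ a) ≤ Measure.hausdorffMeasure 1 (γ '' Set.Ioc a b) := by
  rcases hab.eq_or_lt with rfl | hlt
  · simp
  -- the distance to the end point maps the arc onto an interval whose length is that of the chord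
  set g : X → ℝ := fun x => dist x (γ b) with hg
  have hgl : LipschitzWith 1 g := LipschitzWith.dist_left (γ b)
  have h1 : Set.Ico 0 (dist (γ a) (γ b)) ⊆ g '' (γ '' Set.Ioc a b) := by
    intro t ht
    have hc : ContinuousOn (fun θ => g (γ θ)) (Set.Icc a b) := by fun_prop
    have := intermediate_value_Icc' hab hc
    simp only [hg, dist_self] at this
    obtain ⟨θ, hθ, he⟩ := this (Set.Ico_subset_Icc_self ht)
    refine ⟨γ θ, ⟨θ, ⟨lt_of_le_of_ne hθ.1 ?_, hθ.2⟩, rfl⟩, he⟩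
    rintro rfl
    exact absurd he ht.2.ne'
  calc edist (γ b) (γ a) = volume (Set.Ico 0 (dist (γ a) (γ b))) := by
        rw [Real.volume_Ico, sub_zero, edist_dist, dist_comm]
    _ ≤ volume (g '' (γ '' Set.Ioc a b)) := measure_mono h1
    _ = Measure.hausdorffMeasure 1 (g '' (γ '' Set.Ioc a b)) := by rw [hausdorffMeasure_real]
    _ ≤ Measure.hausdorffMeasure 1 (γ '' Set.Ioc a b) := by
        simpa using hgl.hausdorffMeasure_image_le zero_le_one (γ '' Set.Ioc a b)

/-- Chords are bounded by the measures of the disjoint arcs above them. -/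
lemma eVariationOn_le_hausdorffMeasure {X : Type*} [MetricSpace X] [MeasurableSpace X]
    [BorelSpace X] {γ : ℝ → X} (hγ : Continuous γ) {a b : ℝ}
    (hinj : Set.InjOn γ (Set.Ioc a b)) :
    eVariationOn γ (Set.Icc a b) ≤ Measure.hausdorffMeasure 1 (γ '' Set.Ioc a b) := by
  refine iSup_le fun ⟨n, u, hu, hmem⟩ => ?_
  have hsub : ∀ i, Set.Ioc (u i) (u (i + 1)) ⊆ Set.Ioc a b := fun i =>
    Set.Ioc_subset_Ioc (hmem i).1 (hmem (i + 1)).2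
  calc ∑ i ∈ Finset.range n, edist (γ (u (i + 1))) (γ (u i))
      ≤ ∑ i ∈ Finset.range n, Measure.hausdorffMeasure 1 (γ '' Set.Ioc (u i) (u (i + 1))) :=
        Finset.sum_le_sum fun i _ => edist_le_hausdorffMeasure_image hγ (hu (Nat.le_succ i))
    _ = Measure.hausdorffMeasure 1 (⋃ i ∈ Finset.range n, γ '' Set.Ioc (u i) (u (i + 1))) := by
        rw [measure_biUnion_finset]
        · intro i _ j _ hij
          refine Set.disjoint_image_image fun x hx y hy hxy => ?_
          have := hinj (hsub i hx) (hsub j hy) hxy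
          subst this
          exact Set.disjoint_left.1 (hu.pairwise_disjoint_on_Ioc_succ hij) hx hy
        · intro i _
          exact measurableSet_Ioc.image_of_continuousOn_injOn hγ.continuousOn
            (hinj.mono (hsub i))
    _ ≤ Measure.hausdorffMeasure 1 (γ '' Set.Ioc a b) :=
        measure_mono (Set.iUnion₂_subset fun i _ => Set.image_mono (hsub i))

/-- The arcs of a subdivision have diameters that are bounded by their lengths. -/
lemma hausdorffMeasure_le_eVariationOn {X : Type*} [MetricSpace X] [MeasurableSpace X]
    [BorelSpace X] {γ : ℝ → X} (hγ : Continuous γ) {a b : ℝ} (hab : a ≤ b) :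
    Measure.hausdorffMeasure 1 (γ '' Set.Icc a b) ≤ eVariationOn γ (Set.Icc a b) := by
  -- the uniform subdivision of `[a, b]` into `n + 1` intervals, constant from index `n + 1` on
  set u : ℕ → ℕ → ℝ := fun n i => a + (b - a) * (min (i : ℝ) (n + 1) / (n + 1 : ℝ)) with hu
  have humono : ∀ n, Monotone (u n) := by
    intro n i j hij
    simp only [hu]
    have : 0 ≤ b - a := by linarith
    gcongr
  have hu0 : ∀ n, u n 0 = a := by
    intro n; simp only [hu, Nat.cast_zero]; rw [min_eq_left (by positivity)]; simp
  have hun : ∀ n, u n (n + 1) = b := by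
    intro n; simp only [hu]; push_cast; rw [min_self, div_self (by positivity)]; ring
  have hcover : ∀ n, Set.Icc a b ⊆ ⋃ i ∈ Finset.range (n + 1), Set.Icc (u n i) (u n (i + 1)) := by
    intro n x hx
    by_contra hcon
    simp only [Set.mem_iUnion, Finset.mem_range, not_exists] at hcon
    have hind : ∀ i, i ≤ n + 1 → u n i ≤ x := by
      intro i
      induction i with
      | zero => intro _; rw [hu0]; exact hx.1
      | succ i ih =>
        intro hi
        have h1 := ih (by omega)
        by_contra h2
        exact hcon i (by omega) ⟨h1, (not_le.1 h2).le⟩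
    have h1 := hind n (by omega)
    exact hcon n (by omega) ⟨h1, by rw [hun]; exact hx.2⟩
  have hstep : ∀ n i, u n (i + 1) - u n i ≤ (b - a) / (n + 1) := by
    intro n i
    have h0 : 0 ≤ b - a := by linarith
    have h1 : (min ((i + 1 : ℕ) : ℝ) (n + 1) : ℝ) ≤ min (i : ℝ) (n + 1) + 1 := by
      rcases le_total (i : ℝ) (n + 1) with h | h
      · rw [min_eq_left h]; exact (min_le_left _ _).trans (by push_cast; linarith)
      · rw [min_eq_right h]; exact (min_le_right _ _).trans (by linarith)
    have h2 : u n (i + 1) - u n i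
        = (b - a) * ((min ((i + 1 : ℕ) : ℝ) (n + 1) - min (i : ℝ) (n + 1)) / (n + 1)) := by
      simp only [hu]; ring
    rw [h2, div_eq_mul_one_div (b - a)]
    gcongr
    linarith
  have hmem : ∀ n i, u n i ∈ Set.Icc a b := by
    intro n i
    refine ⟨by rw [← hu0 n]; exact humono n (Nat.zero_le i), ?_⟩
    rcases le_total i (n + 1) with h | h
    · rw [← hun n]; exact humono n h
    · have : u n i = u n (n + 1) := by
        simp only [hu]
        rw [min_eq_right (by exact_mod_cast h)]; push_cast; rw [min_self]
      rw [this, hun]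
  -- the arcs of the uniform subdivision form covers of vanishing mesh
  set A : (n : ℕ) → Fin (n + 1) → Set X := fun n i => γ '' Set.Icc (u n i) (u n (i + 1)) with hA
  set r : ℕ → ℝ≥0∞ := fun n => ⨆ i, Metric.ediam (A n i) with hr
  have hr0 : Tendsto r atTop (𝓝 0) := by
    have huc := isCompact_Icc.uniformContinuousOn_of_continuous (hγ.continuousOn (s := Set.Icc a b))
    rw [Metric.uniformContinuousOn_iff] at huc
    refine ENNReal.tendsto_nhds_zero.2 fun ε hε => ?_
    obtain ⟨ε', hε', hε'2⟩ : ∃ ε' : ℝ, 0 < ε' ∧ ENNReal.ofReal ε' ≤ ε := by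
      rcases eq_or_ne ε ⊤ with rfl | htop
      · exact ⟨1, one_pos, le_top⟩
      · exact ⟨ε.toReal, ENNReal.toReal_pos hε.ne' htop, ENNReal.ofReal_toReal_le⟩
    obtain ⟨δ, hδ, hd⟩ := huc ε' hε'
    have ht : Tendsto (fun n : ℕ => (b - a) / (n + 1 : ℝ)) atTop (𝓝 0) :=
      tendsto_const_nhds.div_atTop (tendsto_atTop_add_const_right _ _ tendsto_natCast_atTop_atTop)
    filter_upwards [ht.eventually (gt_mem_nhds hδ)] with n hn
    refine iSup_le fun i => Metric.ediam_le ?_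
    rintro _ ⟨x, hx, rfl⟩ _ ⟨y, hy, rfl⟩
    have hx' : x ∈ Set.Icc a b := Set.Icc_subset_Icc (hmem _ _).1 (hmem _ _).2 hx
    have hy' : y ∈ Set.Icc a b := Set.Icc_subset_Icc (hmem _ _).1 (hmem _ _).2 hy
    rw [edist_dist]
    refine (ENNReal.ofReal_le_ofReal (hd x hx' y hy' ?_).le).trans hε'2
    have := hstep n i
    rw [Real.dist_eq, abs_lt]
    constructor <;> linarith [hx.1, hx.2, hy.1, hy.2]
  have hmain := Measure.hausdorffMeasure_le_liminf_sum 1 (γ '' Set.Icc a b) r hr0 A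
    (Eventually.of_forall fun n i => le_iSup (fun i => Metric.ediam (A n i)) i)
    (Eventually.of_forall fun n => by
      rintro _ ⟨x, hx, rfl⟩
      have := hcover n hx
      simp only [Set.mem_iUnion, Finset.mem_range] at this
      obtain ⟨i, hi, hxi⟩ := this
      exact Set.mem_iUnion.2 ⟨⟨i, hi⟩, x, hxi, rfl⟩)
  refine hmain.trans ?_
  have hsum : ∀ n, ∑ i, Metric.ediam (A n i) ^ (1:ℝ) ≤ eVariationOn γ (Set.Icc a b) := by
    intro n
    have h1 := eVariationOn.sum' γ (humono n) (n := n + 1)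
    rw [hu0, hun] at h1
    rw [← h1, Finset.sum_range]
    refine Finset.sum_le_sum fun i _ => ?_
    rw [ENNReal.rpow_one]
    refine Metric.ediam_le ?_
    rintro _ ⟨x, hx, rfl⟩ _ ⟨y, hy, rfl⟩
    exact eVariationOn.edist_le γ hx hy
  exact (liminf_le_liminf (Eventually.of_forall hsum)).trans (by simp)

/-- The length of a closed simple curve is the one-dimensional Hausdorff measure of its range. -/
lemma hausdorffMeasure_eq_eVariationOn {X : Type*} [MetricSpace X] [MeasurableSpace X]
    [BorelSpace X] {γ : ℝ → X} (hγ : Continuous γ) {a b : ℝ} (hab : a ≤ b)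
    (hinj : Set.InjOn γ (Set.Ioc a b)) :
    Measure.hausdorffMeasure 1 (γ '' Set.Ioc a b) = eVariationOn γ (Set.Icc a b) :=
  le_antisymm ((measure_mono (Set.image_mono Set.Ioc_subset_Icc_self)).trans
    (hausdorffMeasure_le_eVariationOn hγ hab)) (eVariationOn_le_hausdorffMeasure hγ hinj)

/-! ### The boundary curve of a planar convex domain -/

/-- A bounded open convex set that contains the origin. -/
structure IsConvexDomain (C : Set (Space 2)) : Prop where
  isOpen : IsOpen C
  convex : Convex ℝ C
  isBounded : Bornology.IsBounded C
  zero_mem : (0 : Space 2) ∈ C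

/-- The distance from the origin to the boundary of `C` in the direction of angle `θ`. -/
noncomputable def radial (C : Set (Space 2)) (θ : ℝ) : ℝ := (gauge C (dir θ))⁻¹

/-- The boundary of `C` as a curve, parametrized by the polar angle. -/
noncomputable def bdryCurve (C : Set (Space 2)) (θ : ℝ) : Space 2 := radial C θ • dir θ

namespace IsConvexDomain

variable {C : Set (Space 2)}

lemma mem_nhds (hC : IsConvexDomain C) : C ∈ 𝓝 (0 : Space 2) := hC.isOpen.mem_nhds hC.zero_mem

lemma gauge_dir_pos (hC : IsConvexDomain C) (θ : ℝ) : 0 < gauge C (dir θ) := by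
  rw [gauge_pos (absorbent_nhds_zero hC.mem_nhds)
    ((NormedSpace.isVonNBounded_iff ℝ).2 hC.isBounded)]
  intro h
  have := norm_dir θ
  rw [h] at this; simp at this

lemma radial_pos (hC : IsConvexDomain C) (θ : ℝ) : 0 < radial C θ :=
  inv_pos.2 (hC.gauge_dir_pos θ)

lemma continuous_radial (hC : IsConvexDomain C) : Continuous (radial C) :=
  ((continuous_gauge hC.convex hC.mem_nhds).comp continuous_dir).inv₀
    fun θ => (hC.gauge_dir_pos θ).ne'

lemma continuous_bdryCurve (hC : IsConvexDomain C) : Continuous (bdryCurve C) :=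
  hC.continuous_radial.smul continuous_dir

lemma gauge_smul_dir (hC : IsConvexDomain C) {r : ℝ} (hr : 0 ≤ r) (θ : ℝ) :
    gauge C (r • dir θ) = r / radial C θ := by
  have := hC.gauge_dir_pos θ
  rw [gauge_smul_of_nonneg hr, radial, smul_eq_mul, div_inv_eq_mul]

lemma smul_dir_mem_iff (hC : IsConvexDomain C) {r : ℝ} (hr : 0 ≤ r) (θ : ℝ) :
    r • dir θ ∈ C ↔ r < radial C θ := by
  rw [← div_lt_one (hC.radial_pos θ), ← hC.gauge_smul_dir hr,
    gauge_lt_one_iff_mem_interior hC.convex hC.mem_nhds, hC.isOpen.interior_eq]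

lemma bdryCurve_mem_frontier (hC : IsConvexDomain C) (θ : ℝ) : bdryCurve C θ ∈ frontier C := by
  rw [← gauge_eq_one_iff_mem_frontier hC.convex hC.mem_nhds, bdryCurve,
    hC.gauge_smul_dir (hC.radial_pos θ).le, div_self (hC.radial_pos θ).ne']

lemma frontier_eq (hC : IsConvexDomain C) :
    frontier C = bdryCurve C '' Set.Ioc (-Real.pi) Real.pi := by
  apply Set.Subset.antisymm
  · intro x hx
    obtain ⟨α, hα, he⟩ := exists_eq_norm_smul_dir x
    refine ⟨α, hα, ?_⟩
    rw [← gauge_eq_one_iff_mem_frontier hC.convex hC.mem_nhds, he,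
      hC.gauge_smul_dir (norm_nonneg x), div_eq_one_iff_eq (hC.radial_pos α).ne'] at hx
    rw [bdryCurve, ← hx, ← he]
  · rintro _ ⟨θ, -, rfl⟩
    exact hC.bdryCurve_mem_frontier θ

lemma injOn_bdryCurve (hC : IsConvexDomain C) :
    Set.InjOn (bdryCurve C) (Set.Ioc (-Real.pi) Real.pi) := by
  intro α hα β hβ h
  have hn : radial C α = radial C β := by
    have := congrArg norm h
    simpa [bdryCurve, norm_smul, abs_of_pos (hC.radial_pos _)] using this
  have hd : dir α = dir β := by
    simp only [bdryCurve, hn] at h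
    exact smul_right_injective _ (hC.radial_pos β).ne' h
  have h1 := Real.Angle.cos_sin_inj (congrArg (fun v : Space 2 => v 0) hd)
    (congrArg (fun v : Space 2 => v 1) hd)
  have h2 := congrArg Real.Angle.toReal h1
  rwa [Real.Angle.toReal_coe_eq_self_iff_mem_Ioc.2 hα,
    Real.Angle.toReal_coe_eq_self_iff_mem_Ioc.2 hβ] at h2

lemma bdryCurve_neg_pi : bdryCurve C (-Real.pi) = bdryCurve C Real.pi := by
  have : dir (-Real.pi) = dir Real.pi := by
    ext i; fin_cases i <;> simp
  rw [bdryCurve, bdryCurve, radial, radial, this]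

lemma hausdorffMeasure_frontier (hC : IsConvexDomain C) :
    Measure.hausdorffMeasure 1 (frontier C)
      = eVariationOn (bdryCurve C) (Set.Icc (-Real.pi) Real.pi) := by
  rw [hC.frontier_eq]
  exact hausdorffMeasure_eq_eVariationOn hC.continuous_bdryCurve (by linarith [Real.pi_pos])
    hC.injOn_bdryCurve

/-- Boundary points on the same side of an interior point of a line coincide. -/
lemma eq_of_mem_frontier_of_mul_pos (hC : IsConvexDomain C) {w ν x y : Space 2} {a b : ℝ}
    (hw : w ∈ C) (hx : x ∈ frontier C) (hy : y ∈ frontier C) (hxw : x = w + a • ν)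
    (hyw : y = w + b • ν) (hab : 0 < a * b) : x = y := by
  have key : ∀ {x y : Space 2} {a b : ℝ}, x ∈ frontier C → y ∈ frontier C → x = w + a • ν →
      y = w + b • ν → 0 < a * b → ¬ |a| < |b| := by
    intro x y a b hx hy hxw hyw hab hlt
    have hb : b ≠ 0 := fun h => by simp [h] at hab
    have hpos : 0 < a / b := by
      have : a / b = a * b / b ^ 2 := by field_simp
      rw [this]; positivity
    have hlt1 : a / b < 1 := by
      rw [← abs_of_pos hpos, abs_div, div_lt_one (abs_pos.2 hb)]; exact hlt
    have hmem : x ∈ interior C := by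
      refine hC.convex.openSegment_interior_closure_subset_interior
        (by rwa [hC.isOpen.interior_eq]) hy.1 ⟨1 - a / b, a / b, by linarith, hpos, by ring, ?_⟩
      rw [hxw, hyw, smul_add, smul_smul, div_mul_cancel₀ a hb]
      module
    exact hx.2 hmem
  have h1 := key hx hy hxw hyw hab
  have h2 := key hy hx hyw hxw (by linarith)
  have h3 : |a| = |b| := le_antisymm (not_lt.1 h2) (not_lt.1 h1)
  have h4 : a = b := by
    rcases abs_eq_abs.1 h3 with h | h
    · exact h
    · rw [h] at hab; nlinarith [sq_nonneg b]
  rw [hxw, hyw, h4]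

/-- A line through the interior meets the boundary in at most two points. -/
lemma not_three_on_line (hC : IsConvexDomain C) {τ : Space 2} (hτ : ‖τ‖ = 1) {t : ℝ}
    (ht : t ∈ (fun x => inner ℝ τ x) '' C) {x y z : Space 2} (hx : x ∈ frontier C)
    (hy : y ∈ frontier C) (hz : z ∈ frontier C) (hxt : inner ℝ τ x = t) (hyt : inner ℝ τ y = t)
    (hzt : inner ℝ τ z = t) (hxy : x ≠ y) (hyz : y ≠ z) (hxz : x ≠ z) : False := by
  obtain ⟨w, hw, hwt⟩ := ht
  set ν : Space 2 := !₂[-τ 1, τ 0] with hν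
  have hτ2 := norm_sq_eq_coord τ
  rw [hτ] at hτ2
  have hν1 : ‖ν‖ = 1 := by
    have h := norm_sq_eq_coord ν
    simp [hν] at h
    nlinarith [norm_nonneg ν]
  have hντ : inner ℝ ν τ = 0 := by rw [inner_eq_coord]; simp [hν]; ring
  have hline : ∀ p : Space 2, inner ℝ τ p = t → p = w + (inner ℝ ν (p - w)) • ν := by
    intro p hp
    have h1 := frame_expand hν1 hτ hντ (p - w)
    rw [inner_sub_right τ, hp, show inner ℝ τ w = t from hwt, sub_self, zero_smul, add_zero] at h1
    rw [h1]; abel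
  have hne : ∀ p ∈ frontier C, inner ℝ τ p = t → inner ℝ ν (p - w) ≠ 0 := by
    intro p hp hpt h0
    have h1 := hline p hpt
    rw [h0, zero_smul, add_zero] at h1
    rw [hC.isOpen.frontier_eq] at hp
    exact hp.2 (h1 ▸ hw)
  have h1 := hne x hx hxt
  have h2 := hne y hy hyt
  have h3 := hne z hz hzt
  have k1 := mt (hC.eq_of_mem_frontier_of_mul_pos hw hx hy (hline x hxt) (hline y hyt)) hxy
  have k2 := mt (hC.eq_of_mem_frontier_of_mul_pos hw hy hz (hline y hyt) (hline z hzt)) hyz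
  have k3 := mt (hC.eq_of_mem_frontier_of_mul_pos hw hx hz (hline x hxt) (hline z hzt)) hxz
  rw [not_lt] at k1 k2 k3
  -- two of three nonzero reals have the same sign
  rcases lt_or_gt_of_ne h1 with h1 | h1 <;> rcases lt_or_gt_of_ne h2 with h2 | h2 <;>
    rcases lt_or_gt_of_ne h3 with h3 | h3 <;> nlinarith

/-- A value strictly between those at two boundary points is taken inside. -/
lemma mem_image_of_mem_uIoo (hC : IsConvexDomain C) {τ p q : Space 2} {t : ℝ}
    (hp : p ∈ frontier C) (hq : q ∈ frontier C) (h1 : inner ℝ τ p < t) (h2 : t < inner ℝ τ q) :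
    t ∈ (fun x => inner ℝ τ x) '' C := by
  have hoc : ((fun x => inner ℝ τ x) '' C).OrdConnected :=
    (hC.convex.isPreconnected.image _ (by fun_prop)).ordConnected
  have hcont : Continuous fun x : Space 2 => inner ℝ τ x := by fun_prop
  obtain ⟨x, hx1, hx⟩ := mem_closure_iff.1 hp.1 _ (isOpen_Iio.preimage hcont) h1
  obtain ⟨y, hy1, hy⟩ := mem_closure_iff.1 hq.1 _ (isOpen_Ioi.preimage hcont) h2
  exact hoc.out ⟨x, hx, rfl⟩ ⟨y, hy, rfl⟩ ⟨le_of_lt hx1, le_of_lt hy1⟩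

/-- The boundary curve crosses almost every line at most twice, so its variation in a direction is
at most twice the width. -/
lemma sum_edist_inner_le (hC : IsConvexDomain C) {τ : Space 2} (hτ : ‖τ‖ = 1) (n : ℕ) {u : ℕ → ℝ}
    (hu : Monotone u) (hmem : ∀ i, u i ∈ Set.Icc (-Real.pi) Real.pi) :
    ∑ i ∈ Finset.range n, ENNReal.ofReal
      |inner ℝ τ (bdryCurve C (u (i + 1)) - bdryCurve C (u i))| ≤ 2 * width C τ := by
  set f : ℝ → ℝ := fun θ => inner ℝ τ (bdryCurve C θ) with hf
  have hfc : Continuous f := continuous_const.inner hC.continuous_bdryCurve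
  set I : ℕ → Set ℝ := fun i => Set.Ioo (min (f (u i)) (f (u (i + 1))))
    (max (f (u i)) (f (u (i + 1)))) with hI
  have hvol : ∀ i, ENNReal.ofReal |inner ℝ τ (bdryCurve C (u (i + 1)) - bdryCurve C (u i))|
      = volume (I i) := by
    intro i
    rw [hI, Real.volume_Ioo, inner_sub_right, max_sub_min_eq_abs]
  have hImg : ∀ i t, t ∈ I i → t ∈ (fun x => inner ℝ τ x) '' C := by
    intro i t ht
    have hp := hC.bdryCurve_mem_frontier (u i)
    have hq := hC.bdryCurve_mem_frontier (u (i + 1))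
    rcases le_total (f (u i)) (f (u (i + 1))) with hle | hle
    · simp only [hI, min_eq_left hle, max_eq_right hle] at ht
      exact hC.mem_image_of_mem_uIoo hp hq ht.1 ht.2
    · simp only [hI, min_eq_right hle, max_eq_left hle] at ht
      exact hC.mem_image_of_mem_uIoo hq hp ht.1 ht.2
  have hcross : ∀ i t, t ∈ I i → ∃ θ ∈ Set.Ioc (u i) (u (i + 1)), f θ = t := by
    intro i t ht
    have hle := hu (Nat.le_succ i)
    have h1 := intermediate_value_uIcc (a := u i) (b := u (i + 1)) hfc.continuousOn
    have h2 : t ∈ Set.uIcc (f (u i)) (f (u (i + 1))) := Set.Ioo_subset_Icc_self ht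
    obtain ⟨θ, hθ, he⟩ := h1 h2
    rw [Set.uIcc_of_le hle] at hθ
    refine ⟨θ, ⟨lt_of_le_of_ne hθ.1 ?_, hθ.2⟩, he⟩
    rintro rfl
    simp only [hI, he, Set.mem_Ioo] at ht
    rcases le_total t (f (u (i + 1))) with hle | hle
    · rw [min_eq_left hle] at ht; exact lt_irrefl _ ht.1
    · rw [max_eq_left hle] at ht; exact lt_irrefl _ ht.2
  have hsub : ∀ i, Set.Ioc (u i) (u (i + 1)) ⊆ Set.Ioc (-Real.pi) Real.pi := fun i =>
    Set.Ioc_subset_Ioc (hmem i).1 (hmem (i + 1)).2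
  -- a level `t` attained inside `C` lies in at most two of the intervals between consecutive values
  have hcard : ∀ t, ∑ i ∈ Finset.range n, (I i).indicator (fun _ => (1:ℝ≥0∞)) t
      ≤ ((fun x => inner ℝ τ x) '' C).indicator (fun _ => (2:ℝ≥0∞)) t := by
    classical
    intro t
    by_cases htC : t ∈ (fun x => inner ℝ τ x) '' C
    · rw [Set.indicator_of_mem htC]
      simp only [Set.indicator_apply]
      rw [Finset.sum_ite, Finset.sum_const_zero, add_zero, Finset.sum_const, nsmul_eq_mul, mul_one]
      by_contra hcon
      rw [not_le] at hcon
      have h2 : 2 < (Finset.filter (fun i => t ∈ I i) (Finset.range n)).card := by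
        exact_mod_cast hcon
      obtain ⟨i, j, k, hi, hj, hk, hij, hik, hjk⟩ := Finset.two_lt_card_iff.1 h2
      have hpt : ∀ i ∈ Finset.filter (fun i => t ∈ I i) (Finset.range n),
          ∃ θ ∈ Set.Ioc (u i) (u (i + 1)), f θ = t := fun i hi =>
        hcross i t (Finset.mem_filter.1 hi).2
      obtain ⟨θ₁, h11, h12⟩ := hpt i hi
      obtain ⟨θ₂, h21, h22⟩ := hpt j hj
      obtain ⟨θ₃, h31, h32⟩ := hpt k hk
      have hdis : ∀ {i j : ℕ} {α β : ℝ}, i ≠ j → α ∈ Set.Ioc (u i) (u (i + 1)) →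
          β ∈ Set.Ioc (u j) (u (j + 1)) → bdryCurve C α ≠ bdryCurve C β := by
        intro i j α β hij hα hβ he
        have := hC.injOn_bdryCurve (hsub i hα) (hsub j hβ) he
        subst this
        exact Set.disjoint_left.1 (hu.pairwise_disjoint_on_Ioc_succ hij) hα hβ
      exact hC.not_three_on_line hτ htC (hC.bdryCurve_mem_frontier θ₁)
        (hC.bdryCurve_mem_frontier θ₂) (hC.bdryCurve_mem_frontier θ₃) h12 h22 h32
        (hdis hij h11 h21) (hdis hjk h21 h31) (hdis hik h11 h31)
    · rw [Set.indicator_of_notMem htC]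
      refine le_of_eq (Finset.sum_eq_zero fun i _ => ?_)
      exact Set.indicator_of_notMem (fun h => htC (hImg i t h)) _
  have hmeas : MeasurableSet ((fun x => inner ℝ τ x) '' C) :=
    (hC.convex.isPreconnected.image _ (by fun_prop)).ordConnected.measurableSet
  calc _ = ∑ i ∈ Finset.range n, ∫⁻ t, (I i).indicator (fun _ => (1:ℝ≥0∞)) t := by
        refine Finset.sum_congr rfl fun i _ => ?_
        rw [hvol i, lintegral_indicator measurableSet_Ioo, setLIntegral_one]
    _ = ∫⁻ t, ∑ i ∈ Finset.range n, (I i).indicator (fun _ => (1:ℝ≥0∞)) t := by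
        rw [lintegral_finsetSum]
        exact fun i _ => measurable_const.indicator measurableSet_Ioo
    _ ≤ ∫⁻ t, ((fun x => inner ℝ τ x) '' C).indicator (fun _ => (2:ℝ≥0∞)) t :=
        lintegral_mono hcard
    _ = 2 * width C τ := by
        rw [lintegral_indicator hmeas]; simp [width]

/-- The length of the boundary is bounded by the sum of the widths in finitely many directions. -/
lemma eVariationOn_bdryCurve_le (hC : IsConvexDomain C) {ι : Type*} (s : Finset ι)
    (τ : ι → Space 2) (hτ : ∀ k, ‖τ k‖ = 1) {c : ℝ}
    (hle : ∀ v : Space 2, c * ‖v‖ ≤ ∑ k ∈ s, |inner ℝ (τ k) v|) (hc : 0 < c) :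
    ENNReal.ofReal c * eVariationOn (bdryCurve C) (Set.Icc (-Real.pi) Real.pi)
      ≤ ∑ k ∈ s, 2 * width C (τ k) := by
  rw [eVariationOn, ENNReal.mul_iSup]
  refine iSup_le fun ⟨n, u, hu, hmem⟩ => ?_
  rw [Finset.mul_sum]
  calc _ ≤ ∑ i ∈ Finset.range n, ∑ k ∈ s,
          ENNReal.ofReal |inner ℝ (τ k) (bdryCurve C (u (i + 1)) - bdryCurve C (u i))| := by
        refine Finset.sum_le_sum fun i _ => ?_
        rw [← ENNReal.ofReal_sum_of_nonneg fun _ _ => abs_nonneg _, edist_dist, dist_eq_norm,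
          ← ENNReal.ofReal_mul hc.le]
        exact ENNReal.ofReal_le_ofReal (hle _)
    _ ≤ _ := by
        rw [Finset.sum_comm]
        exact Finset.sum_le_sum fun k _ => hC.sum_edist_inner_le (hτ k) n hu hmem

end IsConvexDomain

end Buckling

/-! ### Green's formula: the perimeter of a convex domain is at most the length of its boundary -/

namespace Buckling

/-- The determinant of two vectors of the plane. -/
noncomputable def cross (a b : Space 2) : ℝ := a 0 * b 1 - a 1 * b 0

lemma abs_cross_le (a b : Space 2) : |cross a b| ≤ ‖a‖ * ‖b‖ := by
  refine abs_le_of_sq_le_sq ?_ (by positivity)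
  rw [mul_pow, norm_sq_eq_coord, norm_sq_eq_coord, cross]
  nlinarith [sq_nonneg (a 0 * b 0 + a 1 * b 1)]

lemma contDiff_cross {E : Type*} [NormedAddCommGroup E] [NormedSpace ℝ E] {n : WithTop ℕ∞}
    {f g : E → Space 2} (hf : ContDiff ℝ n f) (hg : ContDiff ℝ n g) :
    ContDiff ℝ n fun x => cross (f x) (g x) := by
  have h : ∀ (u : E → Space 2) (i : Fin 2), ContDiff ℝ n u → ContDiff ℝ n fun x => u x i :=
    fun u i hu => (contDiff_euclidean.1 hu) i
  exact ((h f 0 hf).mul (h g 1 hg)).sub ((h f 1 hf).mul (h g 0 hg))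

lemma hasDerivAt_cross {f g : ℝ → Space 2} {f' g' : Space 2} {t : ℝ} (hf : HasDerivAt f f' t)
    (hg : HasDerivAt g g' t) :
    HasDerivAt (fun s => cross (f s) (g s)) (cross f' (g t) + cross (f t) g') t := by
  have h : ∀ (u : ℝ → Space 2) (u' : Space 2) (i : Fin 2), HasDerivAt u u' t →
      HasDerivAt (fun s => u s i) (u' i) t := fun u u' i hu =>
    ((EuclideanSpace.proj (𝕜 := ℝ) i).hasFDerivAt).comp_hasDerivAt t hu
  have := ((h f f' 0 hf).mul (h g g' 1 hg)).sub ((h f f' 1 hf).mul (h g g' 0 hg))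
  exact this.congr_deriv (by simp only [Buckling.cross]; ring)

/-- The trace of a linear map of the plane in terms of determinants. -/
lemma cross_apply_sub (A : Space 2 →L[ℝ] Space 2) (x v : Space 2) :
    cross (A x) v - cross (A v) x
      = (∑ i, (A (EuclideanSpace.single i 1)) i) * cross x v := by
  have e : ∀ y : Space 2, A y = y 0 • A (EuclideanSpace.single 0 1)
      + y 1 • A (EuclideanSpace.single 1 1) := by
    intro y
    rw [← map_smul, ← map_smul, ← map_add]
    congr 1
    ext j; fin_cases j <;> simp
  rw [e x, e v]
  simp only [cross, Fin.sum_univ_two, PiLp.add_apply, PiLp.smul_apply, smul_eq_mul]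
  ring

/-- The weighted mean `∫₀¹ s f(s x) ds` of a function along the segment from the origin to `x`. -/
noncomputable def rayMean (f : Space 2 → ℝ) (x : Space 2) : ℝ := ∫ s in (0:ℝ)..1, s * f (s • x)

lemma continuous_rayMean {f : Space 2 → ℝ} (hf : Continuous f) : Continuous (rayMean f) := by
  apply intervalIntegral.continuous_parametric_intervalIntegral_of_continuous'
  fun_prop

lemma continuous_divergence {φ : Space 2 → Space 2} (hφ : ContDiff ℝ 1 φ) :
    Continuous (divergence φ) := by
  refine continuous_finsetSum _ fun i _ => ?_
  have h := (hφ.continuous_fderiv one_ne_zero).clm_apply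
    (continuous_const (y := (EuclideanSpace.single i 1 : Space 2)))
  exact (EuclideanSpace.proj (𝕜 := ℝ) i).continuous.comp h

/-- Green's formula on the triangle with vertices `0`, `a`, `b`, as an identity between signed
integrals. -/
lemma green_triangle {φ : Space 2 → Space 2} (hφ : ContDiff ℝ 1 φ) (a b : Space 2) :
    cross a b * ∫ t in (0:ℝ)..1, rayMean (divergence φ) (a + t • (b - a))
      = (∫ t in (0:ℝ)..1, cross (φ (a + t • (b - a))) (b - a))
        + (∫ s in (0:ℝ)..1, cross (φ (s • a)) a) - ∫ s in (0:ℝ)..1, cross (φ (s • b)) b := by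
  -- the triangle is parametrized by `(t, s) ↦ s (a + t v)` on the unit square, and `(f, g)` is the
  -- pullback of `φ` whose divergence is that of `φ` times the Jacobian
  set v := b - a with hv
  set f : ℝ × ℝ → ℝ := fun p => - cross (φ (p.2 • (a + p.1 • v))) (a + p.1 • v) with hf
  set g : ℝ × ℝ → ℝ := fun p => cross (φ (p.2 • (a + p.1 • v))) (p.2 • v) with hg
  have hfc : ContDiff ℝ 1 f := (contDiff_cross (hφ.comp (by fun_prop)) (by fun_prop)).neg
  have hgc : ContDiff ℝ 1 g := contDiff_cross (hφ.comp (by fun_prop)) (by fun_prop)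
  have hφd : ∀ x, HasFDerivAt φ (fderiv ℝ φ x) x := fun x =>
    (hφ.differentiable one_ne_zero x).hasFDerivAt
  have hf1 : ∀ t s, fderiv ℝ f (t, s) (1, 0)
      = -(cross (fderiv ℝ φ (s • (a + t • v)) (s • v)) (a + t • v)
        + cross (φ (s • (a + t • v))) v) := by
    intro t s
    have h1 : HasDerivAt (fun t' : ℝ => f (t', s)) (fderiv ℝ f (t, s) (1, 0)) t :=
      HasFDerivAt.comp_hasDerivAt (f := fun t' : ℝ => (t', s)) t
        (hfc.differentiable one_ne_zero (t, s)).hasFDerivAt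
        ((hasDerivAt_id t).prodMk (hasDerivAt_const t s))
    have hx : HasDerivAt (fun t' : ℝ => a + t' • v) v t := by
      simpa using ((hasDerivAt_id t).smul_const v).const_add a
    have hz : HasDerivAt (fun t' : ℝ => φ (s • (a + t' • v)))
        (fderiv ℝ φ (s • (a + t • v)) (s • v)) t :=
      HasFDerivAt.comp_hasDerivAt (f := fun t' : ℝ => s • (a + t' • v)) t (hφd _) (hx.const_smul s)
    exact h1.unique (hasDerivAt_cross hz hx).neg
  have hg1 : ∀ t s, fderiv ℝ g (t, s) (0, 1)
      = cross (fderiv ℝ φ (s • (a + t • v)) (a + t • v)) (s • v)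
        + cross (φ (s • (a + t • v))) v := by
    intro t s
    have h1 : HasDerivAt (fun s' : ℝ => g (t, s')) (fderiv ℝ g (t, s) (0, 1)) s :=
      HasFDerivAt.comp_hasDerivAt (f := fun s' : ℝ => (t, s')) s
        (hgc.differentiable one_ne_zero (t, s)).hasFDerivAt
        ((hasDerivAt_const s t).prodMk (hasDerivAt_id s))
    have hx : HasDerivAt (fun s' : ℝ => s' • (a + t • v)) (a + t • v) s := by
      simpa using (hasDerivAt_id s).smul_const (a + t • v)
    have hy : HasDerivAt (fun s' : ℝ => s' • v) v s := by
      simpa using (hasDerivAt_id s).smul_const v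
    have hz : HasDerivAt (fun s' : ℝ => φ (s' • (a + t • v)))
        (fderiv ℝ φ (s • (a + t • v)) (a + t • v)) s :=
      HasFDerivAt.comp_hasDerivAt (f := fun s' : ℝ => s' • (a + t • v)) s (hφd _) hx
    exact h1.unique (hasDerivAt_cross hz hy)
  have hsum : ∀ t s, fderiv ℝ f (t, s) (1, 0) + fderiv ℝ g (t, s) (0, 1)
      = s * divergence φ (s • (a + t • v)) * cross a b := by
    intro t s
    have h1 := cross_apply_sub (fderiv ℝ φ (s • (a + t • v))) (a + t • v) v
    have h2 : cross (a + t • v) v = cross a b := by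
      simp only [cross, hv, PiLp.add_apply, PiLp.smul_apply, PiLp.sub_apply, smul_eq_mul]; ring
    have h3 : ∀ y z : Space 2, cross (s • y) z = s * cross y z := fun y z => by
      simp only [cross, PiLp.smul_apply, smul_eq_mul]; ring
    have h4 : ∀ y z : Space 2, cross y (s • z) = s * cross y z := fun y z => by
      simp only [cross, PiLp.smul_apply, smul_eq_mul]; ring
    rw [h2] at h1
    rw [hf1, hg1, map_smul, h3, h4, divergence]
    linear_combination s * h1
  have hdiv := integral2_divergence_prod_of_hasFDerivAt f g (fderiv ℝ f) (fderiv ℝ g) 0 0 1 1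
    hfc.continuous.continuousOn hgc.continuous.continuousOn
    (fun x _ => (hfc.differentiable one_ne_zero x).hasFDerivAt)
    (fun x _ => (hgc.differentiable one_ne_zero x).hasFDerivAt)
    (by
      refine ContinuousOn.integrableOn_compact (isCompact_uIcc.prod isCompact_uIcc) ?_
      exact (((hfc.continuous_fderiv one_ne_zero).clm_apply continuous_const).add
        ((hgc.continuous_fderiv one_ne_zero).clm_apply continuous_const)).continuousOn)
  simp only [hsum] at hdiv
  have e1 : (∫ t in (0:ℝ)..1, ∫ s in (0:ℝ)..1, s * divergence φ (s • (a + t • v)) * cross a b)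
      = cross a b * ∫ t in (0:ℝ)..1, rayMean (divergence φ) (a + t • v) := by
    simp only [intervalIntegral.integral_mul_const, rayMean]
    ring
  rw [e1] at hdiv
  rw [hdiv]
  have e2 : a + v = b := by rw [hv]; abel
  have hzero : ∀ y : Space 2, cross y 0 = 0 := fun y => by simp [cross]
  simp only [hf, hg, one_smul, zero_smul, add_zero, e2, hzero, intervalIntegral.integral_zero,
    intervalIntegral.integral_neg]
  ring

namespace IsConvexDomain

variable {C : Set (Space 2)}

lemma radial_le (hC : IsConvexDomain C) : ∃ R, 0 < R ∧ ∀ θ, radial C θ ≤ R := by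
  obtain ⟨R, hR⟩ := hC.isBounded.closure.subset_closedBall 0
  have h : ∀ θ, radial C θ ≤ R := fun θ => by
    have h1 := hR (hC.bdryCurve_mem_frontier θ).1
    rw [mem_closedBall_zero_iff, bdryCurve, norm_smul, norm_dir, mul_one, Real.norm_eq_abs,
      abs_of_pos (hC.radial_pos θ)] at h1
    exact h1
  exact ⟨R, (hC.radial_pos 0).trans_le (h 0), h⟩

/-- Integration over a convex domain in polar coordinates. -/
lemma setIntegral_eq (hC : IsConvexDomain C) {f : Space 2 → ℝ} (hf : Continuous f) :
    ∫ x in C, f x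
      = ∫ θ in (-Real.pi)..Real.pi, radial C θ ^ 2 * rayMean f (bdryCurve C θ) := by
  obtain ⟨R, hR0, hR⟩ := hC.radial_le
  have hE := measurePreserving_frameEquiv (norm_single_one 0) (norm_single_one 1)
    inner_single_zero_one
  set E := frameEquiv (norm_single_one 0) (norm_single_one 1) inner_single_zero_one with hEdef
  have hpolar : ∀ p : ℝ × ℝ, E (polarCoord.symm p) = p.1 • dir p.2 := by
    intro p
    ext i
    fin_cases i <;> simp [hEdef, frameEquiv, polarCoord]
  set G : Set (ℝ × ℝ) := {p | p.1 < radial C p.2} with hG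
  have hGm : MeasurableSet G :=
    (isOpen_lt continuous_fst (hC.continuous_radial.comp continuous_snd)).measurableSet
  set F : ℝ × ℝ → ℝ := G.indicator fun p => p.1 * f (p.1 • dir p.2) with hF
  have hFc : Continuous fun p : ℝ × ℝ => p.1 * f (p.1 • dir p.2) :=
    continuous_fst.mul (hf.comp (continuous_fst.smul (continuous_dir.comp continuous_snd)))
  have h1 : ∫ x in C, f x = ∫ p in polarCoord.target, F p := by
    rw [← integral_indicator hC.isOpen.measurableSet, ← hE.integral_comp E.measurableEmbedding,
      ← integral_comp_polarCoord_symm]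
    refine setIntegral_congr_fun polarCoord.open_target.measurableSet fun p hp => ?_
    have hp0 : 0 < p.1 := by
      simp only [polarCoord, Set.mem_prod, Set.mem_Ioi] at hp; exact hp.1
    have hiff := hC.smul_dir_mem_iff hp0.le p.2
    simp only [hpolar, hF]
    by_cases hlt : p ∈ G
    · rw [Set.indicator_of_mem (hiff.2 hlt), Set.indicator_of_mem hlt, smul_eq_mul]
    · rw [Set.indicator_of_notMem (mt hiff.1 hlt), Set.indicator_of_notMem hlt, smul_zero]
  have htarget : polarCoord.target = Set.Ioi (0:ℝ) ×ˢ Set.Ioo (-Real.pi) Real.pi := rfl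
  have hint : IntegrableOn F polarCoord.target := by
    rw [htarget, hF]
    rw [IntegrableOn, integrable_indicator_iff hGm, IntegrableOn, Measure.restrict_restrict hGm]
    refine (hFc.continuousOn.integrableOn_compact
      (isCompact_Icc (a := (0:ℝ)) (b := R) |>.prod
        (isCompact_Icc (a := -Real.pi) (b := Real.pi)))).mono_set ?_
    rintro p ⟨hp1, hp2, hp3⟩
    exact ⟨⟨le_of_lt hp2, (le_of_lt hp1).trans (hR _)⟩, hp3.1.le, hp3.2.le⟩
  have h2 : ∫ p in polarCoord.target, F p
      = ∫ θ in Set.Ioo (-Real.pi) Real.pi, ∫ r in Set.Ioi (0:ℝ), F (r, θ) := by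
    rw [htarget] at hint ⊢
    rw [IntegrableOn, Measure.volume_eq_prod, ← Measure.prod_restrict] at hint
    rw [Measure.volume_eq_prod, ← Measure.prod_restrict, integral_prod_symm _ hint]
  rw [h1, h2, intervalIntegral.integral_of_le (by linarith [Real.pi_pos]),
    integral_Ioc_eq_integral_Ioo]
  refine setIntegral_congr_fun measurableSet_Ioo fun θ _ => ?_
  have hρ := hC.radial_pos θ
  have h3 : ∫ r in Set.Ioi (0:ℝ), F (r, θ) = ∫ r in (0:ℝ)..radial C θ, r * f (r • dir θ) := by
    have e : (fun r => F (r, θ)) = (Set.Iio (radial C θ)).indicator fun r => r * f (r • dir θ) := by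
      funext r
      simp only [hF, hG, Set.indicator_apply, Set.mem_ofPred_eq, Set.mem_Iio]
    rw [e, setIntegral_indicator measurableSet_Iio, Set.Ioi_inter_Iio,
      intervalIntegral.integral_of_le hρ.le, integral_Ioc_eq_integral_Ioo]
  have h4 := intervalIntegral.mul_integral_comp_mul_right (a := 0) (b := 1)
    (f := fun r => r * f (r • dir θ)) (radial C θ)
  rw [zero_mul, one_mul] at h4
  simp only [h3, ← h4, rayMean, bdryCurve]
  rw [sq, mul_assoc]
  congr 1
  rw [← intervalIntegral.integral_const_mul]
  refine intervalIntegral.integral_congr fun s _ => ?_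
  simp only [smul_smul]; ring

/-- The Riemann sums of Green's formula over the triangles inscribed in the boundary converge to the
integral of the divergence. -/
lemma setIntegral_divergence_le (hC : IsConvexDomain C) {φ : Space 2 → Space 2}
    (hφ : ContDiff ℝ 1 φ) (hφ1 : ∀ x, ‖φ x‖ ≤ 1)
    (hV : eVariationOn (bdryCurve C) (Set.Icc (-Real.pi) Real.pi) ≠ ⊤) :
    ∫ x in C, divergence φ x
      ≤ (eVariationOn (bdryCurve C) (Set.Icc (-Real.pi) Real.pi)).toReal := by
  have hpi := Real.pi_pos
  rw [hC.setIntegral_eq (continuous_divergence hφ)]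
  set γ := bdryCurve C with hγdef
  set ρ := radial C with hρdef
  set k := rayMean (divergence φ) with hkdef
  have hk : Continuous k := continuous_rayMean (continuous_divergence hφ)
  have hγ : Continuous γ := hC.continuous_bdryCurve
  have hρ : Continuous ρ := hC.continuous_radial
  set Φ : ℝ × ℝ → ℝ := fun q => ρ q.1 * ρ q.2 * ∫ t in (0:ℝ)..1, k (γ q.1 + t • (γ q.2 - γ q.1))
    with hΦ
  have hΦc : Continuous Φ := by
    refine ((hρ.comp continuous_fst).mul (hρ.comp continuous_snd)).mul ?_
    apply intervalIntegral.continuous_parametric_intervalIntegral_of_continuous'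
    exact hk.comp (by fun_prop)
  -- the polar integrand is the diagonal value of `Φ`; its Riemann sums may use nearby points
  have hdiag : ∀ θ, ρ θ ^ 2 * k (γ θ) = Φ (θ, θ) := by
    intro θ; simp [hΦ, sq]
  simp only [hdiag]
  have hdi : ∀ α β : ℝ, IntervalIntegrable (fun θ => Φ (θ, θ)) volume α β := fun α β =>
    (hΦc.comp (by fun_prop : Continuous fun θ : ℝ => (θ, θ))).intervalIntegrable α β
  set I := ∫ θ in (-Real.pi)..Real.pi, Φ (θ, θ) with hI
  -- the uniform subdivision of `[-π, π]` into `n + 1` arcs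
  set δ : ℕ → ℝ := fun n => 2 * Real.pi / (n + 1) with hδ
  have hδpos : ∀ n, 0 < δ n := fun n => by simp only [hδ]; positivity
  have hδ0 : Tendsto δ atTop (𝓝 0) := tendsto_const_nhds.div_atTop
    (tendsto_atTop_add_const_right _ _ tendsto_natCast_atTop_atTop)
  set u : ℕ → ℕ → ℝ := fun n i => -Real.pi + i * δ n with hu
  have hun : ∀ n, u n (n + 1) = Real.pi := by
    intro n; simp only [hu, hδ]; push_cast; field_simp; ring
  have hmem : ∀ n i, i ≤ n + 1 → u n i ∈ Set.Icc (-Real.pi) Real.pi := by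
    intro n i hi
    have h0 := hδpos n
    refine ⟨by simp only [hu]; nlinarith [(Nat.cast_nonneg i : (0:ℝ) ≤ i)], ?_⟩
    rw [← hun n]; simp only [hu]
    have : (i:ℝ) ≤ (n + 1 : ℕ) := by exact_mod_cast hi
    nlinarith
  have hstep : ∀ n i, u n (i + 1) = u n i + δ n := by
    intro n i; simp only [hu]; push_cast; ring
  set A : ℕ → ℝ := fun n => ∑ i ∈ Finset.range (n + 1), δ n * Φ (u n i, u n (i + 1)) with hA
  have hAlim : Tendsto A atTop (𝓝 I) := by
    rw [Metric.tendsto_atTop]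
    intro ε hε
    have huc := (isCompact_Icc (a := -Real.pi) (b := Real.pi) |>.prod
      (isCompact_Icc (a := -Real.pi) (b := Real.pi))).uniformContinuousOn_of_continuous
        hΦc.continuousOn
    rw [Metric.uniformContinuousOn_iff] at huc
    obtain ⟨η, hη, hd⟩ := huc (ε / (4 * Real.pi)) (by positivity)
    obtain ⟨N, hN⟩ := (hδ0.eventually (gt_mem_nhds hη)).exists_forall_of_atTop
    refine ⟨N, fun n hn => ?_⟩
    have hsum : I = ∑ i ∈ Finset.range (n + 1), ∫ θ in (u n i)..(u n (i + 1)), Φ (θ, θ) := by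
      rw [intervalIntegral.sum_integral_adjacent_intervals, hun]
      · simp [hu, hI]
      · intro i _
        exact hdi _ _
    have hterm : ∀ i ∈ Finset.range (n + 1),
        |δ n * Φ (u n i, u n (i + 1)) - ∫ θ in (u n i)..(u n (i + 1)), Φ (θ, θ)|
          ≤ ε / (4 * Real.pi) * δ n := by
      intro i hi
      have hi' := Finset.mem_range.1 hi
      have m1 := hmem n i (by omega)
      have m2 := hmem n (i + 1) (by omega)
      have e : δ n * Φ (u n i, u n (i + 1))
          = ∫ θ in (u n i)..(u n (i + 1)), Φ (u n i, u n (i + 1)) := by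
        rw [intervalIntegral.integral_const, smul_eq_mul, hstep]; ring
      rw [e, ← intervalIntegral.integral_sub intervalIntegrable_const (hdi _ _)]
      have := intervalIntegral.norm_integral_le_of_norm_le_const (a := u n i) (b := u n (i + 1))
        (f := fun θ => Φ (u n i, u n (i + 1)) - Φ (θ, θ)) (C := ε / (4 * Real.pi)) ?_
      · rw [Real.norm_eq_abs] at this
        refine this.trans (le_of_eq ?_)
        rw [hstep, add_sub_cancel_left, abs_of_pos (hδpos n)]
      · intro θ hθ
        rw [Set.uIoc_of_le (by rw [hstep]; linarith [hδpos n])] at hθ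
        have h3 : δ n < η := hN n hn
        have hθ2 := hθ.2
        rw [hstep] at hθ2
        refine (hd (u n i, u n (i + 1)) ⟨m1, m2⟩ (θ, θ)
          ⟨⟨m1.1.trans hθ.1.le, hθ.2.trans m2.2⟩, ⟨m1.1.trans hθ.1.le, hθ.2.trans m2.2⟩⟩ ?_).le
        rw [Prod.dist_eq, max_lt_iff, Real.dist_eq, Real.dist_eq, abs_lt, abs_lt]
        simp only [hstep]
        refine ⟨⟨?_, ?_⟩, ?_, ?_⟩ <;> linarith [hθ.1]
    rw [Real.dist_eq, hsum, hA, ← Finset.sum_sub_distrib]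
    refine ((Finset.abs_sum_le_sum_abs _ _).trans (Finset.sum_le_sum hterm)).trans_lt ?_
    rw [Finset.sum_const, Finset.card_range, nsmul_eq_mul]
    have : ((n + 1 : ℕ) : ℝ) * (ε / (4 * Real.pi) * δ n) = ε / 2 := by
      simp only [hδ]; push_cast; field_simp; ring
    rw [this]; linarith
  have hsinc : Tendsto (fun n => Real.sinc (δ n) * A n) atTop (𝓝 (1 * I)) := by
    refine Tendsto.mul ?_ hAlim
    have := (Real.continuous_sinc.tendsto 0).comp hδ0
    rwa [Real.sinc_zero] at this
  rw [one_mul] at hsinc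
  refine le_of_tendsto hsinc (Eventually.of_forall fun n => ?_)
  -- the factor `sinc (δ n)` turns `ρ α * ρ β * δ n` into twice the area of the inscribed triangle
  have hcross : ∀ α β, cross (γ α) (γ β) = ρ α * ρ β * Real.sin (β - α) := by
    intro α β
    simp only [hγdef, bdryCurve, cross, PiLp.smul_apply, smul_eq_mul, dir_zero_apply,
      dir_one_apply, Real.sin_sub, hρdef]
    ring
  have e1 : Real.sinc (δ n) * A n = ∑ i ∈ Finset.range (n + 1),
      cross (γ (u n i)) (γ (u n (i + 1)))
        * ∫ t in (0:ℝ)..1, k (γ (u n i) + t • (γ (u n (i + 1)) - γ (u n i))) := by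
    rw [hA, Finset.mul_sum]
    refine Finset.sum_congr rfl fun i _ => ?_
    rw [hcross, Real.sinc_of_ne_zero (hδpos n).ne', hstep, add_sub_cancel_left, hΦ]
    have := (hδpos n).ne'
    field_simp
  -- by Green's formula on the triangles; the contributions of the radii telescope
  have e2 : Real.sinc (δ n) * A n = ∑ i ∈ Finset.range (n + 1),
      ∫ t in (0:ℝ)..1, cross (φ (γ (u n i) + t • (γ (u n (i + 1)) - γ (u n i))))
        (γ (u n (i + 1)) - γ (u n i)) := by
    have htel := Finset.sum_range_sub'
      (fun i => ∫ s in (0:ℝ)..1, cross (φ (s • γ (u n i))) (γ (u n i))) (n + 1)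
    have h0 : u n 0 = -Real.pi := by simp [hu]
    rw [hun, h0, hγdef, bdryCurve_neg_pi, sub_self] at htel
    rw [e1]
    have : ∀ i ∈ Finset.range (n + 1), cross (γ (u n i)) (γ (u n (i + 1)))
        * ∫ t in (0:ℝ)..1, k (γ (u n i) + t • (γ (u n (i + 1)) - γ (u n i)))
        = (∫ t in (0:ℝ)..1, cross (φ (γ (u n i) + t • (γ (u n (i + 1)) - γ (u n i))))
          (γ (u n (i + 1)) - γ (u n i)))
          + ((∫ s in (0:ℝ)..1, cross (φ (s • γ (u n i))) (γ (u n i)))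
          - ∫ s in (0:ℝ)..1, cross (φ (s • γ (u n (i + 1)))) (γ (u n (i + 1)))) := by
      intro i _
      rw [hkdef, green_triangle hφ]; ring
    rw [Finset.sum_congr rfl this, Finset.sum_add_distrib, htel, add_zero]
  have hle : ∀ i, (∫ t in (0:ℝ)..1, cross (φ (γ (u n i) + t • (γ (u n (i + 1)) - γ (u n i))))
        (γ (u n (i + 1)) - γ (u n i))) ≤ dist (γ (u n (i + 1))) (γ (u n i)) := by
    intro i
    refine (le_abs_self _).trans ?_
    have := intervalIntegral.norm_integral_le_of_norm_le_const (a := 0) (b := 1)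
      (f := fun t : ℝ => cross (φ (γ (u n i) + t • (γ (u n (i + 1)) - γ (u n i))))
        (γ (u n (i + 1)) - γ (u n i))) (C := dist (γ (u n (i + 1))) (γ (u n i))) ?_
    · simpa using this
    · intro t _
      rw [Real.norm_eq_abs, dist_eq_norm]
      exact (abs_cross_le _ _).trans (mul_le_of_le_one_left (norm_nonneg _) (hφ1 _))
  rw [e2]
  refine (Finset.sum_le_sum fun i _ => hle i).trans ?_
  have hvar := eVariationOn.sum_le_of_monotoneOn_Iic (f := γ) (s := Set.Icc (-Real.pi) Real.pi)
    (n := n + 1) (u := u n) (fun i _ j _ hij => by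
      simp only [hu]
      have : (i:ℝ) ≤ j := by exact_mod_cast hij
      nlinarith [hδpos n]) (fun i hi => hmem n i hi)
  rw [← ENNReal.toReal_ofReal (Finset.sum_nonneg fun i _ => dist_nonneg)]
  refine ENNReal.toReal_mono hV (le_trans (le_of_eq ?_) hvar)
  rw [ENNReal.ofReal_sum_of_nonneg fun i _ => dist_nonneg]
  simp only [edist_dist]

lemma perimeter_le_eVariationOn (hC : IsConvexDomain C) :
    perimeter C ≤ eVariationOn (bdryCurve C) (Set.Icc (-Real.pi) Real.pi) := by
  by_cases hV : eVariationOn (bdryCurve C) (Set.Icc (-Real.pi) Real.pi) = ⊤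
  · rw [hV]; exact le_top
  refine sSup_le ?_
  rintro _ ⟨φ, h1, -, h3, rfl⟩
  exact ENNReal.ofReal_le_of_le_toReal (hC.setIntegral_divergence_le h1 h3 hV)

end IsConvexDomain

end Buckling

/-! ### The perimeter of convex domains and of convex hulls -/

namespace Buckling

lemma integral_comp_smul_add (f : Space 2 → ℝ) (t : ℝ) (c : Space 2) :
    ∫ x, f (t • x + c) = (t ^ 2)⁻¹ * ∫ x, f x := by
  have h := Measure.integral_comp_smul (volume : Measure (Space 2)) (fun y => f (y + c)) t
  rw [h, integral_add_right_eq_self f c]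
  simp

lemma fderiv_comp_smul_add {F : Type*} [NormedAddCommGroup F] [NormedSpace ℝ F]
    {φ : Space 2 → F} (hφ : Differentiable ℝ φ) (t : ℝ) (c x v : Space 2) :
    fderiv ℝ (fun x => φ (t • x + c)) x v = t • fderiv ℝ φ (t • x + c) v := by
  have h1 : HasFDerivAt (fun x : Space 2 => t • x + c) (t • ContinuousLinearMap.id ℝ (Space 2)) x :=
    ((hasFDerivAt_id x).const_smul t).add_const c
  have h2 := (hφ (t • x + c)).hasFDerivAt.comp x h1
  have h3 : fderiv ℝ (fun x => φ (t • x + c)) x = _ := h2.fderiv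
  rw [h3]
  simp

/-- The similarity `x ↦ t x + c` as a homeomorphism. -/
noncomputable def similarity {t : ℝ} (ht : 0 < t) (c : Space 2) : Space 2 ≃ₜ Space 2 :=
  (Homeomorph.smulOfNeZero t ht.ne').trans (Homeomorph.addRight c)

lemma hasCompactSupport_comp_smul_add {F : Type*} [Zero F]
    {φ : Space 2 → F} (hφ : HasCompactSupport φ) {t : ℝ} (ht : 0 < t) (c : Space 2) :
    HasCompactSupport fun x => φ (t • x + c) :=
  hφ.comp_homeomorph (similarity ht c)

lemma convex_preimage_smul_add {C : Set (Space 2)} (hC : Convex ℝ C) (t : ℝ) (c : Space 2) :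
    Convex ℝ ((fun x => t • x + c) ⁻¹' C) := by
  intro x hx y hy a b ha hb hab
  have h := hC hx hy ha hb hab
  have e : t • (a • x + b • y) + c = a • (t • x + c) + b • (t • y + c) := by
    have hc : c = a • c + b • c := by rw [← add_smul, hab, one_smul]
    conv_lhs => rw [hc]
    module
  simpa only [Set.mem_preimage, e] using h

lemma perimeter_preimage_le {E : Set (Space 2)} (hE : MeasurableSet E) {t : ℝ} (ht : 0 < t)
    (c : Space 2) :
    perimeter ((fun x => t • x + c) ⁻¹' E) ≤ ENNReal.ofReal t⁻¹ * perimeter E := by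
  refine sSup_le ?_
  rintro _ ⟨φ, h1, h2, h3, rfl⟩
  have ht' : 0 < t⁻¹ := inv_pos.2 ht
  set c' : Space 2 := -(t⁻¹ • c) with hc'
  set ψ : Space 2 → Space 2 := fun y => φ (t⁻¹ • y + c') with hψ
  have hinv : ∀ x, t⁻¹ • (t • x + c) + c' = x := by
    intro x; rw [smul_add, smul_smul, inv_mul_cancel₀ ht.ne', one_smul, hc']; abel
  have hdiv : ∀ x, divergence ψ (t • x + c) = t⁻¹ * divergence φ x := by
    intro x
    simp only [divergence, hψ, Finset.mul_sum]
    refine Finset.sum_congr rfl fun i _ => ?_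
    rw [fderiv_comp_smul_add (h1.differentiable one_ne_zero), hinv]
    simp
  have hEm : MeasurableSet ((fun x : Space 2 => t • x + c) ⁻¹' E) :=
    hE.preimage (by fun_prop : Continuous fun x : Space 2 => t • x + c).measurable
  have hint : ∫ x in (fun x => t • x + c) ⁻¹' E, divergence φ x
      = t⁻¹ * ∫ y in E, divergence ψ y := by
    rw [← integral_indicator hEm, ← integral_indicator hE]
    have h := integral_comp_smul_add (E.indicator (divergence ψ)) t c
    have e : (fun x => E.indicator (divergence ψ) (t • x + c))
        = fun x => t⁻¹ * ((fun x => t • x + c) ⁻¹' E).indicator (divergence φ) x := by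
      funext x
      by_cases hx : t • x + c ∈ E
      · have hx' : x ∈ (fun x => t • x + c) ⁻¹' E := hx
        rw [Set.indicator_of_mem hx, Set.indicator_of_mem hx', hdiv]
      · have hx' : x ∉ (fun x => t • x + c) ⁻¹' E := hx
        rw [Set.indicator_of_notMem hx, Set.indicator_of_notMem hx', mul_zero]
    rw [e, integral_const_mul] at h
    have h4 : ∫ x, ((fun x => t • x + c) ⁻¹' E).indicator (divergence φ) x
        = t * (t⁻¹ * ∫ x, ((fun x => t • x + c) ⁻¹' E).indicator (divergence φ) x) := by
      rw [← mul_assoc, mul_inv_cancel₀ ht.ne', one_mul]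
    rw [h4, h]
    field_simp
  rw [hint, ENNReal.ofReal_mul ht'.le]
  gcongr
  refine le_sSup ⟨ψ, h1.comp (by fun_prop), hasCompactSupport_comp_smul_add h2 ht' c',
    fun x => h3 _, rfl⟩

/-- The behaviour of the perimeter under similarities of the plane. -/
lemma perimeter_preimage {E : Set (Space 2)} (hE : MeasurableSet E) {t : ℝ} (ht : 0 < t)
    (c : Space 2) :
    perimeter ((fun x => t • x + c) ⁻¹' E) = ENNReal.ofReal t⁻¹ * perimeter E := by
  refine le_antisymm (perimeter_preimage_le hE ht c) ?_
  have hEm : MeasurableSet ((fun x : Space 2 => t • x + c) ⁻¹' E) :=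
    hE.preimage (by fun_prop : Continuous fun x : Space 2 => t • x + c).measurable
  have h := perimeter_preimage_le hEm (inv_pos.2 ht) (-(t⁻¹ • c))
  have e : (fun x => t⁻¹ • x + -(t⁻¹ • c)) ⁻¹' ((fun x : Space 2 => t • x + c) ⁻¹' E) = E := by
    ext x
    simp only [Set.mem_preimage, smul_add, smul_smul, mul_inv_cancel₀ ht.ne', one_smul, smul_neg,
      neg_add_cancel_right]
  rw [e, inv_inv] at h
  calc ENNReal.ofReal t⁻¹ * perimeter E
      ≤ ENNReal.ofReal t⁻¹ * (ENNReal.ofReal t * perimeter ((fun x => t • x + c) ⁻¹' E)) := by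
        gcongr
    _ = perimeter ((fun x => t • x + c) ⁻¹' E) := by
        rw [← mul_assoc, ← ENNReal.ofReal_mul (inv_pos.2 ht).le, inv_mul_cancel₀ ht.ne',
          ENNReal.ofReal_one, one_mul]

lemma two_mul_width_le_perimeter {Ω U : Set (Space 2)} (hΩ : IsOpen Ω)
    (hvol : volume Ω < ⊤) (hUΩ : U ⊆ Ω) (hU : IsConnected U) {ν τ : Space 2}
    (hν : ‖ν‖ = 1) (hτ : ‖τ‖ = 1) (h : inner ℝ ν τ = 0) :
    2 * width U τ ≤ perimeter Ω := by
  have := sum_width_le_perimeter (Finset.univ : Finset Unit) hΩ hvol hUΩ hU (fun _ => ν)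
    (fun _ => τ) (fun _ => hν) (fun _ => hτ) (fun _ => h) one_pos
    (fun v => by simpa [hν] using abs_real_inner_le_norm ν v)
  simpa using this

/-- A connected part of a planar set has diameter at most the perimeter of the set. -/
lemma dist_le_perimeter {Ω U : Set (Space 2)} (hΩ : IsOpen Ω) (hvol : volume Ω < ⊤)
    (hP : perimeter Ω ≠ ⊤) (hUΩ : U ⊆ Ω) (hU : IsConnected U) {x y : Space 2} (hx : x ∈ U)
    (hy : y ∈ U) : dist x y ≤ (perimeter Ω).toReal := by
  have key : ∀ {ν τ : Space 2}, ‖ν‖ = 1 → ‖τ‖ = 1 → inner ℝ ν τ = 0 → ∀ {x y : Space 2}, x ∈ U →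
      y ∈ U → inner ℝ τ y - inner ℝ τ x ≤ (perimeter Ω).toReal / 2 := by
    intro ν τ hν hτ h x y hx hy
    have h1 := two_mul_width_le_perimeter hΩ hvol hUΩ hU hν hτ h
    have hJ : ((fun x => inner ℝ τ x) '' U).OrdConnected :=
      (hU.isPreconnected.image _ (by fun_prop)).ordConnected
    have h2 : ENNReal.ofReal (inner ℝ τ y - inner ℝ τ x) ≤ width U τ := by
      rw [← Real.volume_Icc]
      exact measure_mono (hJ.out ⟨x, hx, rfl⟩ ⟨y, hy, rfl⟩)
    have h3 : ENNReal.ofReal (2 * (inner ℝ τ y - inner ℝ τ x)) ≤ perimeter Ω := by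
      rw [ENNReal.ofReal_mul two_pos.le]
      refine le_trans ?_ h1
      simpa using mul_le_mul_right h2 2
    have h4 := (ENNReal.ofReal_le_iff_le_toReal hP).1 h3
    linarith
  have n0 := norm_single_one 0
  have n1 := norm_single_one 1
  have n01 := inner_single_zero_one
  have n10 : inner ℝ (EuclideanSpace.single 1 (1:ℝ) : Space 2) (EuclideanSpace.single 0 (1:ℝ))
      = 0 := by rw [real_inner_comm]; exact n01
  have e := frame_expand n0 n1 n01 (x - y)
  rw [dist_eq_norm, ← e]
  refine (norm_add_le _ _).trans ?_
  rw [norm_smul, norm_smul, n0, n1, mul_one, mul_one, Real.norm_eq_abs, Real.norm_eq_abs,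
    inner_sub_right, inner_sub_right]
  have a1 := abs_le.2 ⟨by linarith [key n1 n0 n10 hx hy], key n1 n0 n10 hy hx⟩
  have a2 := abs_le.2 ⟨by linarith [key n0 n1 n01 hx hy], key n0 n1 n01 hy hx⟩
  linarith

namespace IsConvexDomain

variable {C : Set (Space 2)}

lemma volume_lt_top (hC : IsConvexDomain C) : volume C < ⊤ := hC.isBounded.measure_lt_top

/-- The Cauchy–Crofton comparison: the length of the boundary of a convex domain inside the convex
hull of a connected part `U` of `Ω` is at most the perimeter of `Ω`, since both sides are compared
with the mean width of `U`. -/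
theorem eVariationOn_le_perimeter (hC : IsConvexDomain C) {Ω U : Set (Space 2)} (hΩ : IsOpen Ω)
    (hvol : volume Ω < ⊤) (hUΩ : U ⊆ Ω) (hU : IsConnected U) (hCU : C ⊆ convexHull ℝ U) :
    eVariationOn (bdryCurve C) (Set.Icc (-Real.pi) Real.pi) ≤ perimeter Ω := by
  have hpi := Real.pi_pos
  set V := eVariationOn (bdryCurve C) (Set.Icc (-Real.pi) Real.pi) with hV
  set a : ℕ → ℝ := fun N => 2 * N / Real.pi + Real.pi with ha
  set b : ℕ → ℝ := fun N => 2 * N / Real.pi - Real.pi with hb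
  have hN : ∀ N : ℕ, 0 < N → 0 < b N →
      ENNReal.ofReal (b N) * V ≤ ENNReal.ofReal (a N) * perimeter Ω := by
    intro N hN hbN
    have haN : 0 < a N := by simp only [ha]; positivity
    have h0 : ∀ k : ℕ, inner ℝ (dir (k * (Real.pi / N) + 0))
        (dir (k * (Real.pi / N) + Real.pi / 2)) = 0 := by
      intro k; rw [inner_dir_dir, add_zero, sub_add_cancel_left, Real.cos_neg, Real.cos_pi_div_two]
    have h1 := hC.eVariationOn_bdryCurve_le (Finset.range N)
      (fun k => dir (k * (Real.pi / N) + Real.pi / 2)) (fun k => norm_dir _) (c := b N)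
      (fun v => by
        have := (abs_le.1 (abs_sum_abs_inner_dir_sub_le N hN (Real.pi / 2) v)).1
        simp only [hb]; linarith) hbN
    have h2 := sum_width_le_perimeter (Finset.range N) hΩ hvol hUΩ hU
      (fun k : ℕ => dir (k * (Real.pi / N) + 0)) (fun k => dir (k * (Real.pi / N) + Real.pi / 2))
      (fun k => norm_dir _) (fun k => norm_dir _) h0 haN
      (fun v => by
        have := (abs_le.1 (abs_sum_abs_inner_dir_sub_le N hN 0 v)).2
        simp only [ha]; linarith)
    refine h1.trans (le_trans (Finset.sum_le_sum fun k _ => ?_) h2)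
    gcongr 2 * ?_
    exact (width_mono hCU _).trans_eq (width_convexHull hU.isPreconnected _)
  rcases eq_or_ne (perimeter Ω) ⊤ with htop | htop
  · rw [htop]; exact le_top
  have hcast : Tendsto (fun N : ℕ => 2 * (N:ℝ) / Real.pi) atTop atTop :=
    (tendsto_natCast_atTop_atTop.const_mul_atTop two_pos).atTop_div_const hpi
  have hbt : Tendsto b atTop atTop := tendsto_atTop_add_const_right _ _ hcast
  -- both constants are `2 N / π` up to a bounded error
  have hratio : Tendsto (fun N => a N / b N) atTop (𝓝 1) := by
    have h1 : Tendsto (fun N => 1 + 2 * Real.pi / b N) atTop (𝓝 (1 + 0)) :=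
      tendsto_const_nhds.add (tendsto_const_nhds.div_atTop hbt)
    rw [add_zero] at h1
    refine h1.congr' ?_
    filter_upwards [hbt.eventually_gt_atTop 0] with N hbN
    have : a N = b N + 2 * Real.pi := by simp only [ha, hb]; ring
    rw [this, add_div, div_self hbN.ne']
  have hlim : Tendsto (fun N => ENNReal.ofReal (a N / b N) * perimeter Ω) atTop
      (𝓝 (ENNReal.ofReal 1 * perimeter Ω)) :=
    ENNReal.Tendsto.mul_const (ENNReal.tendsto_ofReal hratio) (Or.inr htop)
  rw [ENNReal.ofReal_one, one_mul] at hlim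
  refine ge_of_tendsto hlim ?_
  filter_upwards [hbt.eventually_gt_atTop 0, eventually_gt_atTop 0] with N hbN hN0
  have h := hN N hN0 hbN
  rw [ENNReal.ofReal_div_of_pos hbN, ENNReal.mul_comm_div, ← mul_div_assoc,
    ENNReal.le_div_iff_mul_le (Or.inl (by simpa using hbN)) (Or.inl ENNReal.ofReal_ne_top),
    mul_comm]
  exact h

lemma isConnected (hC : IsConvexDomain C) : IsConnected C :=
  ⟨⟨0, hC.zero_mem⟩, hC.convex.isPreconnected⟩

lemma perimeter_eq_eVariationOn (hC : IsConvexDomain C) :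
    perimeter C = eVariationOn (bdryCurve C) (Set.Icc (-Real.pi) Real.pi) :=
  le_antisymm hC.perimeter_le_eVariationOn
    (hC.eVariationOn_le_perimeter hC.isOpen hC.volume_lt_top subset_rfl hC.isConnected
      (subset_convexHull ℝ C))

lemma hausdorffMeasure_frontier_eq_perimeter (hC : IsConvexDomain C) :
    Measure.hausdorffMeasure 1 (frontier C) = perimeter C := by
  rw [hC.hausdorffMeasure_frontier, hC.perimeter_eq_eVariationOn]

lemma perimeter_mono (hC : IsConvexDomain C) {C' : Set (Space 2)} (hC' : IsConvexDomain C')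
    (h : C ⊆ C') : perimeter C ≤ perimeter C' := by
  rw [hC.perimeter_eq_eVariationOn]
  exact hC.eVariationOn_le_perimeter hC'.isOpen hC'.volume_lt_top subset_rfl hC'.isConnected
    (h.trans (subset_convexHull ℝ C'))

lemma perimeter_pos (hC : IsConvexDomain C) : 0 < perimeter C := by
  have h := two_mul_width_le_perimeter hC.isOpen hC.volume_lt_top subset_rfl hC.isConnected
    (norm_single_one 0) (norm_single_one 1) inner_single_zero_one
  refine lt_of_lt_of_le ?_ h
  have h1 : width C (EuclideanSpace.single 1 1) ≠ 0 := by
    have hJ : ((fun x => inner ℝ (EuclideanSpace.single 1 1 : Space 2) x) '' C).OrdConnected :=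
      (hC.convex.isPreconnected.image _ (by fun_prop)).ordConnected
    obtain ⟨r, hr, hball⟩ := Metric.isOpen_iff.1 hC.isOpen 0 hC.zero_mem
    have hmem : EuclideanSpace.single 1 (r / 2) ∈ C := hball (by
      rw [mem_ball_zero_iff]; simp [abs_of_pos hr]; linarith)
    have h2 : Set.Icc (0:ℝ) (r / 2)
        ⊆ (fun x => inner ℝ (EuclideanSpace.single 1 1 : Space 2) x) '' C :=
      hJ.out ⟨0, hC.zero_mem, by simp⟩ ⟨_, hmem, by simp [inner_eq_coord]⟩
    have h3 := measure_mono (μ := volume) h2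
    rw [Real.volume_Icc] at h3
    have h4 : 0 < ENNReal.ofReal (r / 2 - 0) := by simpa using hr
    exact (h4.trans_le h3).ne'
  exact pos_iff_ne_zero.2 (mul_ne_zero two_ne_zero h1)

lemma preimage_smul (hC : IsConvexDomain C) {t : ℝ} (ht : 0 < t) :
    IsConvexDomain ((fun x => t • x + 0) ⁻¹' C) where
  isOpen := hC.isOpen.preimage (by fun_prop)
  convex := convex_preimage_smul_add hC.convex t 0
  isBounded := by
    obtain ⟨R, hR⟩ := hC.isBounded.subset_closedBall 0
    refine (Metric.isBounded_closedBall (x := (0 : Space 2)) (r := t⁻¹ * R)).subset fun x hx => ?_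
    have h : t • x + 0 ∈ Metric.closedBall 0 R := hR hx
    rw [mem_closedBall_zero_iff, add_zero, norm_smul, Real.norm_eq_abs, abs_of_pos ht] at h
    rw [mem_closedBall_zero_iff]
    rwa [le_inv_mul_iff₀ ht]
  zero_mem := by simpa using hC.zero_mem

end IsConvexDomain

/-- The convex hull of a connected open part of `Ω`, translated to contain the origin, is a convex
domain whose perimeter is at most that of `Ω`. -/
theorem convexHull_isConvexDomain {Ω U : Set (Space 2)} (hΩ : IsOpen Ω)
    (hvol : volume Ω < ⊤) (hP : perimeter Ω ≠ ⊤) (hUΩ : U ⊆ Ω) (hU : IsConnected U)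
    (hUo : IsOpen U) {c : Space 2} (hc : c ∈ U) :
    IsConvexDomain ((fun x => (1:ℝ) • x + c) ⁻¹' convexHull ℝ U) ∧
      perimeter ((fun x => (1:ℝ) • x + c) ⁻¹' convexHull ℝ U) ≤ perimeter Ω := by
  have hbU : Bornology.IsBounded U :=
    Metric.isBounded_iff.2 ⟨_, fun x hx y hy => dist_le_perimeter hΩ hvol hP hUΩ hU hx hy⟩
  have hCD : IsConvexDomain ((fun x => (1:ℝ) • x + c) ⁻¹' convexHull ℝ U) := by
    refine ⟨(hUo.convexHull).preimage (by fun_prop),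
      convex_preimage_smul_add (convex_convexHull ℝ U) 1 c, ?_, ?_⟩
    · obtain ⟨R, hR⟩ := (isBounded_convexHull.2 hbU).subset_closedBall c
      refine (Metric.isBounded_closedBall (x := (0 : Space 2)) (r := R)).subset fun x hx => ?_
      have h := hR hx
      simpa [mem_closedBall_iff_norm] using h
    · simpa using subset_convexHull ℝ U hc
  refine ⟨hCD, ?_⟩
  rw [hCD.perimeter_eq_eVariationOn]
  have hS : Continuous fun x : Space 2 => (1:ℝ) • x + c := by fun_prop
  have hpre : perimeter ((fun x => (1:ℝ) • x + c) ⁻¹' Ω) = perimeter Ω := by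
    rw [perimeter_preimage hΩ.measurableSet one_pos]; simp
  rw [← hpre]
  have himg : ∀ W : Set (Space 2), (fun x : Space 2 => (1:ℝ) • x + c) ⁻¹' W
      = (fun x => x + -c) '' W := by
    intro W; ext x
    simp only [one_smul, Set.mem_preimage, Set.mem_image]
    exact ⟨fun h => ⟨_, h, by simp⟩, by rintro ⟨y, hy, rfl⟩; simpa using hy⟩
  refine hCD.eVariationOn_le_perimeter (U := (fun x => (1:ℝ) • x + c) ⁻¹' U)
    (hΩ.preimage hS) ?_ (Set.preimage_mono hUΩ) ?_ ?_
  · simp only [one_smul]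
    rwa [measure_preimage_add_right]
  · rw [himg]; exact hU.image _ (by fun_prop)
  · rw [himg, himg]
    have := (((LinearMap.id : Space 2 →ₗ[ℝ] Space 2).toAffineMap
      + AffineMap.const ℝ (Space 2) (-c)).image_convexHull U)
    simp only [AffineMap.coe_add, LinearMap.coe_toAffineMap, LinearMap.id_coe, AffineMap.coe_const]
      at this
    exact this.subset

end Buckling

/-! ### Test functions and their energies -/

namespace Buckling

lemma contDiff_partialDeriv {φ : Space 2 → ℝ} (hφ : ContDiff ℝ ∞ φ) (i : Fin 2) :
    ContDiff ℝ ∞ (partialDeriv i φ) :=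
  (hφ.fderiv_right (m := ∞) le_rfl).clm_apply contDiff_const

lemma tsupport_partialDeriv_subset (φ : Space 2 → ℝ) (i : Fin 2) :
    tsupport (partialDeriv i φ) ⊆ tsupport φ := by
  refine (closure_mono fun x hx => ?_).trans (tsupport_fderiv_subset ℝ (f := φ))
  exact fun h0 => hx (by simp [partialDeriv, h0])

namespace IsTestFunction

variable {Ω : Set (Space 2)} {φ ψ : Space 2 → ℝ}

lemma partialDeriv (hφ : IsTestFunction Ω φ) (i : Fin 2) :
    IsTestFunction Ω (partialDeriv i φ) where
  contDiff := contDiff_partialDeriv hφ.contDiff i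
  hasCompactSupport := hφ.hasCompactSupport.of_isClosed_subset (isClosed_tsupport _)
    (tsupport_partialDeriv_subset φ i)
  tsupport_subset := (tsupport_partialDeriv_subset φ i).trans hφ.tsupport_subset

lemma mono {Ω' : Set (Space 2)} (hφ : IsTestFunction Ω φ) (h : Ω ⊆ Ω') : IsTestFunction Ω' φ :=
  ⟨hφ.contDiff, hφ.hasCompactSupport, hφ.tsupport_subset.trans h⟩

lemma continuous (hφ : IsTestFunction Ω φ) : Continuous φ := hφ.contDiff.continuous

lemma eq_zero_of_notMem (hφ : IsTestFunction Ω φ) {x : Space 2} (hx : x ∉ Ω) : φ x = 0 :=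
  image_eq_zero_of_notMem_tsupport fun h => hx (hφ.tsupport_subset h)

lemma integrable (hφ : IsTestFunction Ω φ) : Integrable φ :=
  hφ.continuous.integrable_of_hasCompactSupport hφ.hasCompactSupport

lemma add (hφ : IsTestFunction Ω φ) (hψ : IsTestFunction Ω ψ) : IsTestFunction Ω (φ + ψ) where
  contDiff := hφ.contDiff.add hψ.contDiff
  hasCompactSupport := hφ.hasCompactSupport.add hψ.hasCompactSupport
  tsupport_subset := (tsupport_add φ ψ).trans (Set.union_subset hφ.tsupport_subset
    hψ.tsupport_subset)

lemma mul_right (hφ : IsTestFunction Ω φ) (hψ : ContDiff ℝ ∞ ψ) : IsTestFunction Ω (φ * ψ) where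
  contDiff := hφ.contDiff.mul hψ
  hasCompactSupport := hφ.hasCompactSupport.mul_right
  tsupport_subset := (closure_mono (Function.support_mul_subset_left φ ψ)).trans hφ.tsupport_subset

lemma integrable_mul (hφ : IsTestFunction Ω φ) (hψ : ContDiff ℝ ∞ ψ) :
    Integrable (fun x => φ x * ψ x) := (hφ.mul_right hψ).integrable

lemma memLp (hφ : IsTestFunction Ω φ) : MemLp φ 2 :=
  hφ.continuous.memLp_of_hasCompactSupport hφ.hasCompactSupport

lemma integral_mul_partialDeriv (hφ : ContDiff ℝ ∞ φ) (hψ : IsTestFunction Ω ψ) (i : Fin 2) :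
    ∫ x, φ x * Buckling.partialDeriv i ψ x = - ∫ x, Buckling.partialDeriv i φ x * ψ x := by
  have h1 := (hψ.integrable_mul (contDiff_partialDeriv hφ i))
  have h2 := ((hψ.partialDeriv i).integrable_mul hφ)
  have h3 := hψ.integrable_mul hφ
  refine integral_mul_fderiv_eq_neg_fderiv_mul_of_integrable ?_ ?_ ?_ ?_ ?_
  · exact h1.congr (Eventually.of_forall fun x => mul_comm _ _)
  · exact h2.congr (Eventually.of_forall fun x => mul_comm _ _)
  · exact h3.congr (Eventually.of_forall fun x => mul_comm _ _)
  · exact fun x _ => hφ.differentiable (by simp) x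
  · exact fun x _ => hψ.contDiff.differentiable (by simp) x

end IsTestFunction

lemma partialDeriv_comm {φ : Space 2 → ℝ} (hφ : ContDiff ℝ ∞ φ) (i j : Fin 2) :
    partialDeriv i (partialDeriv j φ) = partialDeriv j (partialDeriv i φ) := by
  have key : ∀ (i j : Fin 2) (x : Space 2), partialDeriv i (partialDeriv j φ) x
      = fderiv ℝ (fderiv ℝ φ) x (EuclideanSpace.single i 1) (EuclideanSpace.single j 1) := by
    intro i j x
    have hd : DifferentiableAt ℝ (fderiv ℝ φ) x :=
      (hφ.fderiv_right (m := ∞) le_rfl).differentiable (by simp) x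
    have h := fderiv_clm_apply hd (differentiableAt_const (EuclideanSpace.single j (1:ℝ) : Space 2))
    change fderiv ℝ (fun y => fderiv ℝ φ y (EuclideanSpace.single j 1)) x _ = _
    rw [h]; simp
  funext x
  rw [key, key]
  exact (hφ.contDiffAt (x := x)).isSymmSndFDerivAt (by
    simp only [minSmoothness_of_isRCLikeNormedField]
    exact WithTop.coe_le_coe.2 (le_top (a := (2 : ℕ∞)))) _ _

/-- The Laplacian of a smooth function of two variables. -/
noncomputable def lap (φ : Space 2 → ℝ) (x : Space 2) : ℝ :=
  ∑ i, partialDeriv i (partialDeriv i φ) x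

/-- The squared length of the gradient of a smooth function of two variables. -/
noncomputable def gradSq (φ : Space 2 → ℝ) (x : Space 2) : ℝ := ∑ i, partialDeriv i φ x ^ 2

/-- The numerator `∫ (Δφ)²` of the Rayleigh quotient of a test function. -/
noncomputable def lapEnergy (φ : Space 2 → ℝ) : ℝ := ∫ x, lap φ x ^ 2

/-- The denominator `∫ |∇φ|²` of the Rayleigh quotient of a test function. -/
noncomputable def gradEnergy (φ : Space 2 → ℝ) : ℝ := ∫ x, gradSq φ x

lemma lapEnergy_nonneg (φ : Space 2 → ℝ) : 0 ≤ lapEnergy φ := integral_nonneg fun _ => sq_nonneg _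

lemma gradEnergy_nonneg (φ : Space 2 → ℝ) : 0 ≤ gradEnergy φ :=
  integral_nonneg fun _ => Finset.sum_nonneg fun _ _ => sq_nonneg _

/-- Some test function on `Ω` has a Rayleigh quotient below `M`. -/
def BucklesBelow (Ω : Set (Space 2)) (M : ℝ) : Prop :=
  ∃ φ, IsTestFunction Ω φ ∧ lapEnergy φ < M * gradEnergy φ

lemma BucklesBelow.mono {Ω Ω' : Set (Space 2)} {M M' : ℝ} (h : BucklesBelow Ω M) (hΩ : Ω ⊆ Ω')
    (hM : M ≤ M') : BucklesBelow Ω' M' := by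
  obtain ⟨φ, h1, h2⟩ := h
  exact ⟨φ, h1.mono hΩ, h2.trans_le (mul_le_mul_of_nonneg_right hM (gradEnergy_nonneg φ))⟩

lemma BucklesBelow.pos {Ω : Set (Space 2)} {M : ℝ} (h : BucklesBelow Ω M) : 0 < M := by
  obtain ⟨φ, -, h2⟩ := h
  by_contra hM
  have := mul_nonpos_of_nonpos_of_nonneg (not_lt.1 hM) (gradEnergy_nonneg φ)
  linarith [lapEnergy_nonneg φ]

namespace IsTestFunction

variable {Ω : Set (Space 2)} {φ : Space 2 → ℝ}

lemma lap (hφ : IsTestFunction Ω φ) : IsTestFunction Ω (lap φ) := by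
  have h := ((hφ.partialDeriv 0).partialDeriv 0).add ((hφ.partialDeriv 1).partialDeriv 1)
  have e : Buckling.lap φ = Buckling.partialDeriv 0 (Buckling.partialDeriv 0 φ)
      + Buckling.partialDeriv 1 (Buckling.partialDeriv 1 φ) := by
    funext x; simp [Buckling.lap, Fin.sum_univ_two]
  rwa [e]

lemma integrable_sq (hφ : IsTestFunction Ω φ) : Integrable fun x => φ x ^ 2 := by
  simpa only [sq] using hφ.integrable_mul hφ.contDiff

lemma gradEnergy_eq (hφ : IsTestFunction Ω φ) :
    gradEnergy φ = ∑ i, ∫ x, Buckling.partialDeriv i φ x ^ 2 :=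
  integral_finsetSum _ fun i _ => (hφ.partialDeriv i).integrable_sq

lemma gradEnergy_eq_neg_integral (hφ : IsTestFunction Ω φ) :
    gradEnergy φ = - ∫ x, φ x * Buckling.lap φ x := by
  have h : ∀ i, ∫ x, Buckling.partialDeriv i φ x ^ 2
      = - ∫ x, φ x * Buckling.partialDeriv i (Buckling.partialDeriv i φ) x := by
    intro i
    rw [integral_mul_partialDeriv hφ.contDiff (hφ.partialDeriv i) i, neg_neg]
    simp only [sq]
  rw [hφ.gradEnergy_eq]
  simp only [h, Fin.sum_univ_two, Buckling.lap, mul_add]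
  rw [integral_add (hφ.integrable_mul ((hφ.partialDeriv 0).partialDeriv 0).contDiff)
    (hφ.integrable_mul ((hφ.partialDeriv 1).partialDeriv 1).contDiff)]
  ring

/-- The gradient energy is controlled by the Laplacian. -/
lemma gradEnergy_sq_le (hφ : IsTestFunction Ω φ) :
    gradEnergy φ ^ 2 ≤ (∫ x, φ x ^ 2) * lapEnergy φ := by
  have hl := hφ.lap
  -- the discriminant of the nonnegative polynomial `t ↦ ∫ (t φ + Δφ)²`
  have h : ∀ t : ℝ, 0 ≤ (∫ x, φ x ^ 2) * (t * t) + (-2 * gradEnergy φ) * t + lapEnergy φ := by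
    intro t
    have h0 : 0 ≤ ∫ x, (t * φ x + Buckling.lap φ x) ^ 2 := integral_nonneg fun _ => sq_nonneg _
    have e : ∀ x, (t * φ x + Buckling.lap φ x) ^ 2
        = (t * t) * φ x ^ 2 + (2 * t) * (φ x * Buckling.lap φ x) + Buckling.lap φ x ^ 2 := by
      intro x; ring
    simp_rw [e] at h0
    have i1 := hφ.integrable_sq.const_mul (t * t)
    have i2 := (hφ.integrable_mul hl.contDiff).const_mul (2 * t)
    have i12 : Integrable fun x =>
        (t * t) * φ x ^ 2 + (2 * t) * (φ x * Buckling.lap φ x) := i1.add i2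
    rw [integral_add i12 hl.integrable_sq, integral_add i1 i2, integral_const_mul,
      integral_const_mul] at h0
    rw [hφ.gradEnergy_eq_neg_integral, lapEnergy]
    linarith
  have := discrim_le_zero h
  rw [discrim] at this
  nlinarith

/-- The mixed second derivative is controlled by the Laplacian, as `∫ ∂₀²φ ∂₁²φ = ∫ (∂₁∂₀φ)²`. -/
lemma integral_mixed_sq_le (hφ : IsTestFunction Ω φ) :
    ∫ x, Buckling.partialDeriv 1 (Buckling.partialDeriv 0 φ) x ^ 2 ≤ lapEnergy φ := by
  set a := Buckling.partialDeriv 0 (Buckling.partialDeriv 0 φ) with ha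
  set b := Buckling.partialDeriv 1 (Buckling.partialDeriv 1 φ) with hb
  set c := Buckling.partialDeriv 1 (Buckling.partialDeriv 0 φ) with hc
  have ta : IsTestFunction Ω a := (hφ.partialDeriv 0).partialDeriv 0
  have tb : IsTestFunction Ω b := (hφ.partialDeriv 1).partialDeriv 1
  have tc : IsTestFunction Ω c := (hφ.partialDeriv 0).partialDeriv 1
  have hab : ∫ x, b x * a x = ∫ x, c x ^ 2 := by
    rw [ha, integral_mul_partialDeriv tb.contDiff (hφ.partialDeriv 0) 0, hb,
      partialDeriv_comm (hφ.partialDeriv 1).contDiff 0 1]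
    have h := integral_mul_partialDeriv (φ := Buckling.partialDeriv 0 φ)
      (hφ.partialDeriv 0).contDiff ((hφ.partialDeriv 1).partialDeriv 0) 1
    simp only [mul_comm _ (Buckling.partialDeriv 0 φ _)]
    rw [h, neg_neg, partialDeriv_comm hφ.contDiff 0 1]
    simp only [sq, hc]
  have e : lapEnergy φ = ∫ x, (a x ^ 2 + 2 * (b x * a x) + b x ^ 2) := by
    simp only [lapEnergy, Buckling.lap, Fin.sum_univ_two]
    congr 1; funext x; ring
  have i1 := ta.integrable_sq
  have i2 := (tb.integrable_mul ta.contDiff).const_mul 2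
  have i3 := tb.integrable_sq
  have i12 : Integrable fun x => a x ^ 2 + 2 * (b x * a x) := i1.add i2
  rw [e, integral_add i12 i3, integral_add i1 i2, integral_const_mul, hab]
  have h1 : 0 ≤ ∫ x, a x ^ 2 := integral_nonneg fun _ => sq_nonneg _
  have h2 : 0 ≤ ∫ x, b x ^ 2 := integral_nonneg fun _ => sq_nonneg _
  have h3 : 0 ≤ ∫ x, c x ^ 2 := integral_nonneg fun _ => sq_nonneg _
  linarith

end IsTestFunction

/-! ### Similarities -/

lemma partialDeriv_comp_smul_add {φ : Space 2 → ℝ} (hφ : Differentiable ℝ φ) (t : ℝ) (c : Space 2)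
    (i : Fin 2) : partialDeriv i (fun x => φ (t • x + c))
      = fun x => t * partialDeriv i φ (t • x + c) := by
  funext x
  exact fderiv_comp_smul_add hφ t c x _

/-- The behaviour of the Rayleigh quotient under similarities of the plane. -/
lemma BucklesBelow.preimage {Ω : Set (Space 2)} {M t : ℝ} (h : BucklesBelow Ω M) (ht : 0 < t)
    (c : Space 2) : BucklesBelow ((fun x => t • x + c) ⁻¹' Ω) (t ^ 2 * M) := by
  obtain ⟨φ, h1, h2⟩ := h
  have hd : Differentiable ℝ φ := h1.contDiff.differentiable (by simp)
  have h3 : ∀ i, partialDeriv i (partialDeriv i (fun x => φ (t • x + c)))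
      = fun x => t ^ 2 * partialDeriv i (partialDeriv i φ) (t • x + c) := by
    intro i
    have hd' : Differentiable ℝ (partialDeriv i φ) :=
      (h1.partialDeriv i).contDiff.differentiable (by simp)
    rw [partialDeriv_comp_smul_add hd]
    funext x
    have h4 : DifferentiableAt ℝ (fun x => partialDeriv i φ (t • x + c)) x :=
      (hd' _).comp x (by fun_prop)
    have h5 := congrFun (partialDeriv_comp_smul_add hd' t c i) x
    simp only [partialDeriv] at h4 h5 ⊢
    rw [fderiv_const_mul h4]
    simp only [smul_apply, smul_eq_mul]
    rw [h5]; ring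
  have hN : lapEnergy (fun x => φ (t • x + c)) = t ^ 2 * lapEnergy φ := by
    have e : ∀ x, lap (fun x => φ (t • x + c)) x ^ 2 = t ^ 4 * lap φ (t • x + c) ^ 2 := by
      intro x; simp only [lap, h3, ← Finset.mul_sum]; ring
    simp only [lapEnergy, e]
    rw [integral_const_mul, integral_comp_smul_add (fun y => lap φ y ^ 2) t c]
    field_simp
  have hD : gradEnergy (fun x => φ (t • x + c)) = gradEnergy φ := by
    have e : ∀ x, gradSq (fun x => φ (t • x + c)) x = t ^ 2 * gradSq φ (t • x + c) := by
      intro x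
      simp only [gradSq, partialDeriv_comp_smul_add hd, mul_pow, ← Finset.mul_sum]
    simp only [gradEnergy, e]
    rw [integral_const_mul, integral_comp_smul_add (gradSq φ) t c]
    field_simp
  refine ⟨fun x => φ (t • x + c), ⟨h1.contDiff.comp (by fun_prop),
    hasCompactSupport_comp_smul_add h1.hasCompactSupport ht c, ?_⟩, ?_⟩
  · intro x hx
    exact h1.tsupport_subset (tsupport_comp_subset_preimage φ
      (f := fun x : Space 2 => t • x + c) (by fun_prop) hx)
  · rw [hN, hD, mul_assoc]
    have : 0 < t ^ 2 := by positivity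
    exact mul_lt_mul_of_pos_left h2 this

end Buckling

/-! ### Restriction to connected components -/

namespace Buckling

/-- Cutting a function off to an open set `V` that meets its support in a closed set commutes with
differentiation. -/
lemma partialDeriv_indicator {V : Set (Space 2)} (hV : IsOpen V) {f : Space 2 → ℝ}
    (hc : IsClosed (tsupport f ∩ V)) (i : Fin 2) :
    partialDeriv i (V.indicator f) = V.indicator (partialDeriv i f) := by
  funext x
  by_cases hx : x ∈ V
  · have h : V.indicator f =ᶠ[𝓝 x] f := by
      filter_upwards [hV.mem_nhds hx] with y hy using Set.indicator_of_mem hy f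
    rw [Set.indicator_of_mem hx, partialDeriv, partialDeriv, h.fderiv_eq]
  · have h : V.indicator f =ᶠ[𝓝 x] fun _ => 0 := by
      filter_upwards [hc.isOpen_compl.mem_nhds fun h => hx h.2] with y hy
      by_cases hyV : y ∈ V
      · rw [Set.indicator_of_mem hyV]
        exact image_eq_zero_of_notMem_tsupport fun h => hy ⟨h, hyV⟩
      · exact Set.indicator_of_notMem hyV f
    rw [Set.indicator_of_notMem hx, partialDeriv, h.fderiv_eq]
    simp

lemma IsTestFunction.indicator {Ω V : Set (Space 2)} (hV : IsOpen V) {f : Space 2 → ℝ}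
    (hf : IsTestFunction Ω f) (hc : IsClosed (tsupport f ∩ V)) :
    IsTestFunction V (V.indicator f) := by
  have hs : tsupport (V.indicator f) ⊆ tsupport f ∩ V := by
    refine closure_minimal (fun x hx => ?_) hc
    have hxV : x ∈ V := Set.mem_of_indicator_ne_zero hx
    refine ⟨subset_tsupport f ?_, hxV⟩
    rwa [Function.mem_support, Set.indicator_of_mem hxV] at hx
  refine ⟨contDiff_iff_contDiffAt.2 fun x => ?_,
    hf.hasCompactSupport.of_isClosed_subset (isClosed_tsupport _)
      (hs.trans Set.inter_subset_left), hs.trans Set.inter_subset_right⟩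
  by_cases hx : x ∈ V
  · refine (hf.contDiff.contDiffAt (x := x)).congr_of_eventuallyEq ?_
    filter_upwards [hV.mem_nhds hx] with y hy using Set.indicator_of_mem hy f
  · refine (contDiffAt_const (c := (0:ℝ))).congr_of_eventuallyEq ?_
    filter_upwards [(isClosed_tsupport (V.indicator f)).isOpen_compl.mem_nhds
      fun h => hx (hs h).2] with y hy using image_eq_zero_of_notMem_tsupport hy

lemma lap_gradSq_eq_zero_of_notMem_tsupport {φ : Space 2 → ℝ} {x : Space 2} (hx : x ∉ tsupport φ) :
    lap φ x = 0 ∧ gradSq φ x = 0 := by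
  have h1 : ∀ i, x ∉ tsupport (partialDeriv i φ) := fun i h =>
    hx (tsupport_partialDeriv_subset φ i h)
  have h2 : ∀ i, x ∉ tsupport (partialDeriv i (partialDeriv i φ)) := fun i h =>
    h1 i (tsupport_partialDeriv_subset _ i h)
  constructor
  · exact Finset.sum_eq_zero fun i _ => image_eq_zero_of_notMem_tsupport (h2 i)
  · exact Finset.sum_eq_zero fun i _ => by
      rw [image_eq_zero_of_notMem_tsupport (h1 i), sq, zero_mul]

lemma IsTestFunction.integrable_gradSq {Ω : Set (Space 2)} {φ : Space 2 → ℝ}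
    (hφ : IsTestFunction Ω φ) : Integrable (gradSq φ) :=
  integrable_finsetSum _ fun i _ => (hφ.partialDeriv i).integrable_sq

/-- The energies of a function cut off to `V` are the energies in `V`. -/
lemma energy_indicator {V : Set (Space 2)} (hV : IsOpen V) {φ : Space 2 → ℝ}
    (hc : IsClosed (tsupport φ ∩ V)) :
    lapEnergy (V.indicator φ) = ∫ x in V, lap φ x ^ 2 ∧
      gradEnergy (V.indicator φ) = ∫ x in V, gradSq φ x := by
  have hc' : ∀ i, IsClosed (tsupport (partialDeriv i φ) ∩ V) := by
    intro i
    have : tsupport (partialDeriv i φ) ∩ V = tsupport (partialDeriv i φ) ∩ (tsupport φ ∩ V) := by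
      rw [← Set.inter_assoc, Set.inter_eq_left.2 (tsupport_partialDeriv_subset φ i)]
    rw [this]
    exact (isClosed_tsupport _).inter hc
  rw [← integral_indicator hV.measurableSet, ← integral_indicator hV.measurableSet, lapEnergy,
    gradEnergy]
  constructor
  · congr 1; funext x
    simp only [lap, partialDeriv_indicator hV hc, partialDeriv_indicator hV (hc' _)]
    by_cases hx : x ∈ V <;> simp [hx]
  · congr 1; funext x
    simp only [gradSq, partialDeriv_indicator hV hc]
    by_cases hx : x ∈ V
    · simp [hx, gradSq]
    · simp [hx]

/-- The support of a test function meets finitely many components of `Ω`, the energies are sums over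
these components, and one of the components has a Rayleigh quotient below `M` if the sum has. -/
theorem BucklesBelow.exists_component {Ω : Set (Space 2)} (hΩ : IsOpen Ω) {M : ℝ}
    (h : BucklesBelow Ω M) : ∃ c ∈ Ω, BucklesBelow (connectedComponentIn Ω c) M := by
  classical
  obtain ⟨φ, hφ, hlt⟩ := h
  by_contra! hno
  obtain ⟨t, htK, hcov⟩ := hφ.hasCompactSupport.isCompact.elim_nhds_subcover
    (connectedComponentIn Ω) fun x hx =>
      hΩ.connectedComponentIn.mem_nhds (mem_connectedComponentIn (hφ.tsupport_subset hx))
  set s : Finset (Set (Space 2)) := t.image (connectedComponentIn Ω) with hs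
  have hso : ∀ V ∈ s, IsOpen V := by
    intro V hV
    obtain ⟨x, -, rfl⟩ := Finset.mem_image.1 hV
    exact hΩ.connectedComponentIn
  have hcov' : tsupport φ ⊆ ⋃ V ∈ s, V := by
    intro x hx
    obtain ⟨y, hy, hxy⟩ := Set.mem_iUnion₂.1 (hcov hx)
    exact Set.mem_iUnion₂.2 ⟨_, Finset.mem_image_of_mem _ hy, hxy⟩
  have heq : ∀ V ∈ s, ∀ W ∈ s, ∀ x ∈ V, x ∈ W → V = W := by
    intro V hV W hW x hxV hxW
    obtain ⟨v, -, rfl⟩ := Finset.mem_image.1 hV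
    obtain ⟨w, -, rfl⟩ := Finset.mem_image.1 hW
    rw [connectedComponentIn_eq hxV, connectedComponentIn_eq hxW]
  have hdisj : (s : Set (Set (Space 2))).Pairwise (Function.onFun Disjoint id) := by
    intro V hV W hW hne
    exact Set.disjoint_left.2 fun x hxV hxW => hne (heq V hV W hW x hxV hxW)
  have hclosed : ∀ V ∈ s, IsClosed (tsupport φ ∩ V) := by
    intro V hV
    -- the part of the support in `V` is what the other components leave
    have : tsupport φ ∩ V = tsupport φ ∩ (⋃ W ∈ s.erase V, W)ᶜ := by
      ext x
      refine and_congr_right fun hx => ⟨fun hxV hxU => ?_, fun hxU => ?_⟩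
      · obtain ⟨W, hW, hxW⟩ := Set.mem_iUnion₂.1 hxU
        exact (Finset.mem_erase.1 hW).1 (heq W (Finset.mem_erase.1 hW).2 V hV x hxW hxV)
      · obtain ⟨W, hW, hxW⟩ := Set.mem_iUnion₂.1 (hcov' hx)
        by_contra hxV
        refine hxU (Set.mem_iUnion₂.2 ⟨W, Finset.mem_erase.2 ⟨?_, hW⟩, hxW⟩)
        rintro rfl; exact hxV hxW
    rw [this]
    exact (isClosed_tsupport φ).inter (isOpen_biUnion fun W hW =>
      hso W (Finset.mem_of_mem_erase hW)).isClosed_compl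
  have hsum : ∀ f : Space 2 → ℝ, Integrable f → (∀ x, x ∉ tsupport φ → f x = 0) →
      ∫ x, f x = ∑ V ∈ s, ∫ x in V, f x := by
    intro f hf h0
    rw [← integral_biUnion_finset s (fun V hV => (hso V hV).measurableSet) hdisj
      fun V _ => hf.integrableOn]
    exact (setIntegral_eq_integral_of_forall_compl_eq_zero fun x hx =>
      h0 x fun h => hx (hcov' h)).symm
  have hN : lapEnergy φ = ∑ V ∈ s, lapEnergy (V.indicator φ) := by
    rw [lapEnergy, hsum _ hφ.lap.integrable_sq
      fun x hx => by
        rw [(lap_gradSq_eq_zero_of_notMem_tsupport hx).1, sq, zero_mul]]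
    exact Finset.sum_congr rfl fun V hV => (energy_indicator (hso V hV) (hclosed V hV)).1.symm
  have hD : gradEnergy φ = ∑ V ∈ s, gradEnergy (V.indicator φ) := by
    rw [gradEnergy, hsum _ hφ.integrable_gradSq fun x hx =>
      (lap_gradSq_eq_zero_of_notMem_tsupport hx).2]
    exact Finset.sum_congr rfl fun V hV => (energy_indicator (hso V hV) (hclosed V hV)).2.symm
  rw [hN, hD, Finset.mul_sum] at hlt
  refine hlt.not_ge (Finset.sum_le_sum fun V hV => ?_)
  obtain ⟨x, hx, hxV⟩ := Finset.mem_image.1 hV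
  by_contra! h
  refine hno x (hφ.tsupport_subset (htK x hx)) ⟨_, ?_, h⟩
  rw [hxV]
  exact hφ.indicator (hso V hV) (hclosed V hV)

/-! ### A lower bound for the inradius -/

lemma sq_setIntegral_le {X : Type*} [MeasurableSpace X] {μ : Measure X} {Q : Set X}
    (hQ : μ Q ≠ ⊤) {k : X → ℝ} (h1 : IntegrableOn k Q μ)
    (h2 : IntegrableOn (fun x => k x ^ 2) Q μ) :
    (∫ x in Q, k x ∂μ) ^ 2 ≤ μ.real Q * ∫ x in Q, k x ^ 2 ∂μ := by
  -- the discriminant of the nonnegative polynomial `t ↦ ∫ (t + k)²`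
  have h : ∀ t : ℝ, 0 ≤ μ.real Q * (t * t) + (2 * ∫ x in Q, k x ∂μ) * t + ∫ x in Q, k x ^ 2 ∂μ := by
    intro t
    have h0 : 0 ≤ ∫ x in Q, (t + k x) ^ 2 ∂μ := integral_nonneg fun _ => sq_nonneg _
    have e : ∀ x, (t + k x) ^ 2 = t * t + (2 * t) * k x + k x ^ 2 := fun x => by ring
    simp_rw [e] at h0
    have i0 : IntegrableOn (fun _ => t * t) Q μ := integrableOn_const hQ
    have i1 : IntegrableOn (fun x => (2 * t) * k x) Q μ := h1.const_mul (2 * t)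
    have i01 : IntegrableOn (fun x => t * t + (2 * t) * k x) Q μ := i0.add i1
    rw [integral_add i01 h2, integral_add i0 i1, setIntegral_const, smul_eq_mul,
      integral_const_mul (2 * t) k] at h0
    linarith
  have := discrim_le_zero h
  rw [discrim] at this
  nlinarith

/-- The value of `φ` changes along a segment of length `a' - a` in the direction `eᵢ` by the
integral of the mixed second derivative over the rectangle between the segment and a parallel
segment outside the support. -/
lemma IsTestFunction.sq_sub_le {Ω : Set (Space 2)} {φ : Space 2 → ℝ} (hφ : IsTestFunction Ω φ)
    {i j : Fin 2} (hij : i ≠ j) {a a' L y : ℝ} (ha : a ≤ a') (hL : L ≤ y)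
    (hsupp : ∀ s : ℝ, s • (EuclideanSpace.single i 1 : Space 2)
      + L • EuclideanSpace.single j 1 ∉ tsupport φ) :
    (φ (a' • EuclideanSpace.single i 1 + y • EuclideanSpace.single j 1)
      - φ (a • EuclideanSpace.single i 1 + y • EuclideanSpace.single j 1)) ^ 2
      ≤ ((a' - a) * (y - L)) * ∫ x, Buckling.partialDeriv j (Buckling.partialDeriv i φ) x ^ 2 := by
  set e : Space 2 := EuclideanSpace.single i 1 with he
  set f : Space 2 := EuclideanSpace.single j 1 with hf
  have hef : inner ℝ e f = 0 := by
    simp [he, hf, EuclideanSpace.inner_single_left, hij]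
  set F := frameEquiv (norm_single_one i) (norm_single_one j) hef with hF
  have hFp := measurePreserving_frameEquiv (norm_single_one i) (norm_single_one j) hef
  have hFa : ∀ p, F p = p.1 • e + p.2 • f := fun p => rfl
  have hFc : Continuous F := by
    have : (F : ℝ × ℝ → Space 2) = fun p => p.1 • e + p.2 • f := rfl
    rw [this]; fun_prop
  set g := Buckling.partialDeriv i φ with hg
  set h := Buckling.partialDeriv j g with hh
  have tg : IsTestFunction Ω g := hφ.partialDeriv i
  have th : IsTestFunction Ω h := tg.partialDeriv j
  have e1 : ∀ s, g (s • e + y • f) = ∫ t in L..y, h (F (s, t)) := by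
    intro s
    have hder : ∀ t : ℝ, HasDerivAt (fun t : ℝ => g (s • e + t • f)) (h (F (s, t))) t := by
      intro t
      have h1 := (tg.contDiff.differentiable (by simp) (s • e + t • f)).hasFDerivAt
      have h2 : HasDerivAt (fun t : ℝ => s • e + t • f) f t := by
        simpa using ((hasDerivAt_id t).smul_const f).const_add (s • e)
      exact h1.comp_hasDerivAt t h2
    rw [intervalIntegral.integral_eq_sub_of_hasDerivAt (fun t _ => hder t)
      ((th.continuous.comp (hFc.comp
        (by fun_prop : Continuous fun t : ℝ => (s, t)))).intervalIntegrable _ _)]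
    have : g (s • e + L • f) = 0 := image_eq_zero_of_notMem_tsupport fun hm =>
      hsupp s (tsupport_partialDeriv_subset φ i hm)
    rw [this, sub_zero]
  have e2 : φ (a' • e + y • f) - φ (a • e + y • f) = ∫ s in a..a', g (s • e + y • f) := by
    have hder : ∀ s : ℝ, HasDerivAt (fun s : ℝ => φ (s • e + y • f)) (g (s • e + y • f)) s := by
      intro s
      have h1 := (hφ.contDiff.differentiable (by simp) (s • e + y • f)).hasFDerivAt
      have h2 : HasDerivAt (fun s : ℝ => s • e + y • f) e s := by
        simpa using ((hasDerivAt_id s).smul_const e).add_const (y • f)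
      exact h1.comp_hasDerivAt s h2
    rw [intervalIntegral.integral_eq_sub_of_hasDerivAt (fun t _ => hder t)
      ((tg.continuous.comp (by fun_prop)).intervalIntegrable _ _)]
  set Q : Set (ℝ × ℝ) := Set.Ioc a a' ×ˢ Set.Ioc L y with hQ
  have hk : Continuous (h ∘ F) := th.continuous.comp hFc
  have hki : Integrable (h ∘ F) :=
    (hFp.integrable_comp_emb F.measurableEmbedding).2 th.integrable
  have hki2 : Integrable (fun p => (h ∘ F) p ^ 2) :=
    (hFp.integrable_comp_emb F.measurableEmbedding).2 th.integrable_sq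
  have e3 : φ (a' • e + y • f) - φ (a • e + y • f) = ∫ p in Q, (h ∘ F) p := by
    rw [e2, intervalIntegral.integral_of_le ha]
    simp only [e1, intervalIntegral.integral_of_le hL]
    exact (setIntegral_prod (μ := volume) (ν := volume) (h ∘ F) hki.integrableOn).symm
  have hvol : (volume : Measure (ℝ × ℝ)) Q = ENNReal.ofReal ((a' - a) * (y - L)) := by
    rw [hQ, Measure.volume_eq_prod, Measure.prod_prod, Real.volume_Ioc, Real.volume_Ioc,
      ENNReal.ofReal_mul (by linarith)]
  have hnn : 0 ≤ (a' - a) * (y - L) := mul_nonneg (by linarith) (by linarith)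
  rw [e3]
  refine (sq_setIntegral_le (by rw [hvol]; exact ENNReal.ofReal_ne_top) hki.integrableOn
    hki2.integrableOn).trans ?_
  rw [measureReal_def, hvol, ENNReal.toReal_ofReal hnn]
  refine mul_le_mul_of_nonneg_left ?_ hnn
  rw [← hFp.integral_comp F.measurableEmbedding (fun x => h x ^ 2)]
  exact setIntegral_le_integral hki2 (Eventually.of_forall fun _ => sq_nonneg _)

lemma IsTestFunction.sq_sub_le_abs {Ω : Set (Space 2)} {φ : Space 2 → ℝ} (hφ : IsTestFunction Ω φ)
    {i j : Fin 2} (hij : i ≠ j) {a a' L y : ℝ} (hL : L ≤ y)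
    (hsupp : ∀ s : ℝ, s • (EuclideanSpace.single i 1 : Space 2)
      + L • EuclideanSpace.single j 1 ∉ tsupport φ) :
    (φ (a' • EuclideanSpace.single i 1 + y • EuclideanSpace.single j 1)
      - φ (a • EuclideanSpace.single i 1 + y • EuclideanSpace.single j 1)) ^ 2
      ≤ (|a' - a| * (y - L)) * lapEnergy φ := by
  have hm : ∫ x, Buckling.partialDeriv j (Buckling.partialDeriv i φ) x ^ 2 ≤ lapEnergy φ := by
    have h := hφ.integral_mixed_sq_le
    fin_cases i <;> fin_cases j
    · exact absurd rfl hij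
    · exact h
    · rw [partialDeriv_comm hφ.contDiff] at h; exact h
    · exact absurd rfl hij
  have hn : 0 ≤ |a' - a| * (y - L) := mul_nonneg (abs_nonneg _) (by linarith)
  refine le_trans ?_ (mul_le_mul_of_nonneg_left hm hn)
  rcases le_total a a' with h | h
  · rw [abs_of_nonneg (by linarith)]
    exact hφ.sq_sub_le hij h hL hsupp
  · rw [abs_of_nonpos (by linarith), neg_sub, ← neg_sub, neg_sq]
    simpa only [neg_sub, neg_sq] using hφ.sq_sub_le hij h hL hsupp

/-- A planar set of bounded diameter with bounded first buckling eigenvalue contains a disc of fixed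
radius: around the maximum of `|φ|`, the Hölder estimate `sq_sub_le` in terms of the Laplacian keeps
a competitor `φ` away from zero. -/
theorem exists_ball_subset_of_bucklesBelow (M : ℝ) {R : ℝ} (hR : 0 < R) :
    ∃ r > 0, ∀ C : Set (Space 2), (∀ x ∈ C, ∀ y ∈ C, dist x y ≤ R) → BucklesBelow C M →
      ∃ x₀ ∈ C, Metric.ball x₀ r ⊆ C := by
  set V := volume.real (Metric.closedBall (0 : Space 2) R) with hV
  have hV0 : 0 ≤ V := measureReal_nonneg
  have hpos : 0 < 10 * R * M ^ 2 * V + 1 := by positivity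
  refine ⟨min R (10 * R * M ^ 2 * V + 1)⁻¹, lt_min hR (inv_pos.2 hpos), fun C hC hb => ?_⟩
  have hM := hb.pos
  obtain ⟨φ, hφ, hlt⟩ := hb
  set r := min R (10 * R * M ^ 2 * V + 1)⁻¹ with hr
  have hrR : r ≤ R := min_le_left _ _
  have hr0 : 0 < r := lt_min hR (inv_pos.2 hpos)
  have hr1 : 10 * R * M ^ 2 * V * r ≤ 1 := by
    calc 10 * R * M ^ 2 * V * r ≤ (10 * R * M ^ 2 * V + 1) * (10 * R * M ^ 2 * V + 1)⁻¹ := by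
          refine mul_le_mul (by linarith) (min_le_right _ _) hr0.le hpos.le
      _ = 1 := mul_inv_cancel₀ hpos.ne'
  have hN0 := lapEnergy_nonneg φ
  have hD : 0 < gradEnergy φ := by
    by_contra hD
    have := mul_nonpos_of_nonneg_of_nonpos hM.le (not_lt.1 hD)
    linarith
  obtain ⟨x₀, hx₀⟩ := hφ.continuous.norm.exists_forall_ge_of_hasCompactSupport
    hφ.hasCompactSupport.norm
  set S := ‖φ x₀‖ with hS
  have hx₀C : x₀ ∈ C := by
    by_contra h
    have hz : φ = 0 := by
      funext x
      have := hx₀ x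
      rw [hS, hφ.eq_zero_of_notMem h, norm_zero] at this
      exact norm_le_zero_iff.1 this
    have : gradEnergy φ = 0 := by rw [hφ.gradEnergy_eq_neg_integral, hz]; simp
    exact hD.ne' this
  have hA : ∫ x, φ x ^ 2 ≤ S ^ 2 * V := by
    have h1 : ∫ x in Metric.closedBall x₀ R, φ x ^ 2 = ∫ x, φ x ^ 2 :=
      setIntegral_eq_integral_of_forall_compl_eq_zero fun x hx => by
        have : x ∉ C := fun h => hx (hC x h x₀ hx₀C)
        rw [hφ.eq_zero_of_notMem this, sq, zero_mul]
    have h2 := norm_setIntegral_le_of_norm_le_const (μ := volume) (f := fun x => φ x ^ 2)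
      (s := Metric.closedBall x₀ R) (C := S ^ 2) measure_closedBall_lt_top fun x _ => by
        rw [norm_pow]; exact pow_le_pow_left₀ (norm_nonneg _) (hx₀ x) 2
    rw [← h1, hV, measureReal_def, ← Measure.addHaar_closedBall_center volume x₀ R]
    exact (le_abs_self _).trans h2
  -- `D² ≤ ‖φ‖² N` and `N < M D` bound `D` by `M ‖φ‖²`, hence `N` by `M² ‖φ‖²`
  have hNS : lapEnergy φ < M ^ 2 * V * S ^ 2 := by
    have h1 := hφ.gradEnergy_sq_le
    have hA0 : 0 ≤ ∫ x, φ x ^ 2 := integral_nonneg fun _ => sq_nonneg _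
    have h2 : gradEnergy φ * gradEnergy φ ≤ ((∫ x, φ x ^ 2) * M) * gradEnergy φ := by
      nlinarith [mul_le_mul_of_nonneg_left hlt.le hA0]
    have h3 := le_of_mul_le_mul_right h2 hD
    calc lapEnergy φ < M * gradEnergy φ := hlt
      _ ≤ M * ((∫ x, φ x ^ 2) * M) := mul_le_mul_of_nonneg_left h3 hM.le
      _ ≤ M * ((S ^ 2 * V) * M) := by gcongr
      _ = _ := by ring
  refine ⟨x₀, hx₀C, fun x hx => ?_⟩
  by_contra hxC
  set e₀ : Space 2 := EuclideanSpace.single 0 1 with he₀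
  set e₁ : Space 2 := EuclideanSpace.single 1 1 with he₁
  have n0 : ‖e₀‖ = 1 := norm_single_one 0
  have n1 : ‖e₁‖ = 1 := norm_single_one 1
  have n01 : inner ℝ e₀ e₁ = 0 := inner_single_zero_one
  have n10 : inner ℝ e₁ e₀ = 0 := by rw [real_inner_comm]; exact n01
  have hxe := frame_expand n0 n1 n01 x
  have hx₀e := frame_expand n0 n1 n01 x₀
  set p := inner ℝ e₀ x with hp
  set q := inner ℝ e₁ x with hq
  set p₀ := inner ℝ e₀ x₀ with hp₀
  set q₀ := inner ℝ e₁ x₀ with hq₀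
  have hdist : ‖x - x₀‖ < r := by rwa [Metric.mem_ball, dist_eq_norm] at hx
  have hpp : |p - p₀| ≤ r := by
    have := abs_real_inner_le_norm e₀ (x - x₀)
    rw [inner_sub_right, n0, one_mul] at this
    exact this.trans hdist.le
  have hqq : |q - q₀| ≤ r := by
    have := abs_real_inner_le_norm e₁ (x - x₀)
    rw [inner_sub_right, n1, one_mul] at this
    exact this.trans hdist.le
  -- points at distance greater than `R` from `x₀` lie outside the support
  have hfar : ∀ {y v : Space 2}, ‖v‖ = 1 → R < |inner ℝ v y - inner ℝ v x₀| → y ∉ tsupport φ := by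
    intro y v hv hy hmem
    have h1 := hC y (hφ.tsupport_subset hmem) x₀ hx₀C
    have h2 := abs_real_inner_le_norm v (y - x₀)
    rw [inner_sub_right, hv, one_mul, ← dist_eq_norm] at h2
    linarith
  have h1 := hφ.sq_sub_le_abs (i := 0) (j := 1) (by decide) (a := p₀) (a' := p)
    (L := q₀ - 2 * R) (y := q₀) (by linarith) fun s => by
      refine hfar n1 ?_
      change R < |inner ℝ e₁ (s • e₀ + (q₀ - 2 * R) • e₁) - q₀|
      rw [inner_add_right, inner_smul_right, inner_smul_right, n10, real_inner_self_eq_norm_sq, n1,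
        abs_of_nonpos (by linarith)]
      linarith
  have h2 := hφ.sq_sub_le_abs (i := 1) (j := 0) (by decide) (a := q₀) (a' := q)
    (L := p - 3 * R) (y := p) (by linarith) fun s => by
      refine hfar n0 ?_
      change R < |inner ℝ e₀ (s • e₁ + (p - 3 * R) • e₀) - p₀|
      have := (abs_le.1 hpp).2
      rw [inner_add_right, inner_smul_right, inner_smul_right, n01, real_inner_self_eq_norm_sq, n0,
        abs_of_nonpos (by linarith)]
      linarith
  rw [← he₀, ← he₁] at h1 h2
  rw [add_comm (q • e₁), add_comm (q₀ • e₁), hxe, hφ.eq_zero_of_notMem hxC] at h2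
  rw [hx₀e] at h1
  -- `m` is the value at the corner of the path from `x₀` to `x` along the axes
  set m := φ (p • e₀ + q₀ • e₁) with hm
  have h1' : (m - φ x₀) ^ 2 ≤ r * (2 * R) * lapEnergy φ := by
    refine h1.trans (mul_le_mul_of_nonneg_right ?_ hN0)
    refine mul_le_mul hpp (by linarith) (by linarith) hr0.le
  have h2' : (0 - m) ^ 2 ≤ r * (3 * R) * lapEnergy φ := by
    refine h2.trans (mul_le_mul_of_nonneg_right ?_ hN0)
    refine mul_le_mul hqq (by linarith) (by linarith) hr0.le
  have h3 : S ^ 2 ≤ 10 * r * R * lapEnergy φ := by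
    rw [hS, Real.norm_eq_abs, sq_abs]
    nlinarith [sq_nonneg (m - φ x₀ - (0 - m))]
  have h4 : 10 * r * R * lapEnergy φ < 10 * r * R * (M ^ 2 * V * S ^ 2) :=
    mul_lt_mul_of_pos_left hNS (by positivity)
  have h5 : 10 * R * M ^ 2 * V * r * S ^ 2 ≤ 1 * S ^ 2 :=
    mul_le_mul_of_nonneg_right hr1 (sq_nonneg _)
  linarith

end Buckling

/-! ### The first buckling eigenvalue in terms of test functions -/

namespace Buckling

lemma tendsto_integral_sq {X : Type*} [MeasurableSpace X] {μ : Measure X} {f : ℕ → X → ℝ}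
    {g : X → ℝ} (hf : ∀ n, MemLp (f n) 2 μ) (hg : MemLp g 2 μ)
    (h : Tendsto (fun n => eLpNorm (f n - g) 2 μ) atTop (𝓝 0)) :
    Tendsto (fun n => ∫ x, f n x ^ 2 ∂μ) atTop (𝓝 (∫ x, g x ^ 2 ∂μ)) := by
  have key : ∀ {k : X → ℝ} (hk : MemLp k 2 μ), ∫ x, k x ^ 2 ∂μ = ‖hk.toLp k‖ ^ 2 := by
    intro k hk
    rw [← real_inner_self_eq_norm_sq, L2.inner_def]
    refine integral_congr_ae ?_
    filter_upwards [hk.coeFn_toLp] with x hx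
    rw [hx, real_inner_self_eq_norm_sq, Real.norm_eq_abs, sq_abs]
  have h1 := (Lp.tendsto_Lp_iff_tendsto_eLpNorm'' f hf g hg).2 h
  simp_rw [key (hf _), key hg]
  exact h1.norm.pow 2

lemma IsTestFunction.setIntegral_eq {Ω : Set (Space 2)} {ψ : Space 2 → ℝ}
    (hψ : IsTestFunction Ω ψ) : ∫ x in Ω, ψ x = ∫ x, ψ x :=
  setIntegral_eq_integral_of_forall_compl_eq_zero fun _ hx => hψ.eq_zero_of_notMem hx

lemma IsTestFunction.setIntegral_sq_eq {Ω : Set (Space 2)} {ψ : Space 2 → ℝ}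
    (hψ : IsTestFunction Ω ψ) : ∫ x in Ω, ψ x ^ 2 = ∫ x, ψ x ^ 2 :=
  setIntegral_eq_integral_of_forall_compl_eq_zero fun _ hx => by
    rw [hψ.eq_zero_of_notMem hx, sq, zero_mul]

lemma IsTestFunction.hasWeakPartialDeriv {Ω : Set (Space 2)} {φ : Space 2 → ℝ}
    (hφ : IsTestFunction Ω φ) (i : Fin 2) :
    HasWeakPartialDeriv Ω i φ (Buckling.partialDeriv i φ) where
  locallyIntegrableOn := hφ.integrable.locallyIntegrable.locallyIntegrableOn Ω
  locallyIntegrableOn_deriv :=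
    (hφ.partialDeriv i).integrable.locallyIntegrable.locallyIntegrableOn Ω
  integral_eq ψ hψ := by
    have h1 := (hφ.mul_right (hψ.partialDeriv i).contDiff).setIntegral_eq
    have h2 := ((hφ.partialDeriv i).mul_right hψ.contDiff).setIntegral_eq
    simp only [Pi.mul_apply] at h1 h2
    rw [h1, h2, IsTestFunction.integral_mul_partialDeriv hφ.contDiff hψ i]

/-- A test function is its own constant approximating sequence in `H²₀`. -/
lemma IsTestFunction.memH2Zero {Ω : Set (Space 2)} {φ : Space 2 → ℝ} (hφ : IsTestFunction Ω φ) :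
    MemH2Zero Ω φ (fun i => Buckling.partialDeriv i φ)
      (fun i j => Buckling.partialDeriv i (Buckling.partialDeriv j φ)) where
  memLp := hφ.memLp.restrict Ω
  memLp_grad i := (hφ.partialDeriv i).memLp.restrict Ω
  memLp_hess i j := ((hφ.partialDeriv j).partialDeriv i).memLp.restrict Ω
  weakGrad i := hφ.hasWeakPartialDeriv i
  weakHess i j := (hφ.partialDeriv j).hasWeakPartialDeriv i
  approx := ⟨fun _ => φ, fun _ => hφ, by simp, by simp, by simp⟩

lemma rayleigh_eq {Ω : Set (Space 2)} {G : Fin 2 → Space 2 → ℝ} {H : Fin 2 → Fin 2 → Space 2 → ℝ}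
    (hG : ∀ i, MemLp (G i) 2 (volume.restrict Ω))
    (hH : ∀ i j, MemLp (H i j) 2 (volume.restrict Ω)) :
    rayleigh Ω G H = ENNReal.ofReal (∫ x in Ω, (∑ i, H i i x) ^ 2)
      / ENNReal.ofReal (∫ x in Ω, ∑ i, G i x ^ 2) := by
  have h1 : MemLp (fun x => ∑ i, H i i x) 2 (volume.restrict Ω) :=
    memLp_finsetSum _ fun i _ => hH i i
  rw [rayleigh, ofReal_integral_eq_lintegral_ofReal h1.integrable_sq
      (Eventually.of_forall fun _ => sq_nonneg _),
    ofReal_integral_eq_lintegral_ofReal (integrable_finsetSum _ fun i _ => (hG i).integrable_sq)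
      (Eventually.of_forall fun _ => Finset.sum_nonneg fun _ _ => sq_nonneg _)]

lemma BucklesBelow.firstBucklingEigenvalue_le {Ω : Set (Space 2)} (hΩ : IsOpen Ω) {M : ℝ}
    (h : BucklesBelow Ω M) : firstBucklingEigenvalue Ω ≤ ENNReal.ofReal M := by
  have hM := h.pos
  obtain ⟨φ, hφ, hlt⟩ := h
  have hD : 0 < gradEnergy φ := by
    by_contra hD
    have := mul_nonpos_of_nonneg_of_nonpos hM.le (not_lt.1 hD)
    linarith [lapEnergy_nonneg φ]
  have hm := hφ.memH2Zero
  have hne : ¬ φ =ᵐ[volume.restrict Ω] 0 := by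
    intro h0
    -- a continuous function vanishing almost everywhere on an open set vanishes on it
    have hz : φ = 0 := by
      have h1 : Set.EqOn φ 0 Ω := Measure.eqOn_open_of_ae_eq h0 hΩ hφ.continuous.continuousOn
        continuousOn_const
      funext x
      by_cases hx : x ∈ Ω
      · exact h1 hx
      · exact hφ.eq_zero_of_notMem hx
    have : gradEnergy φ = 0 := by
      rw [hφ.gradEnergy_eq_neg_integral, hz]; simp
    exact hD.ne' this
  have hle : firstBucklingEigenvalue Ω ≤ rayleigh Ω _ _ := sInf_le ⟨φ, _, _, hm, hne, rfl⟩
  refine hle.trans ?_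
  have e1 : ∫ x in Ω, (∑ i, partialDeriv i (partialDeriv i φ) x) ^ 2 = lapEnergy φ :=
    hφ.lap.setIntegral_sq_eq
  have e2 : ∫ x in Ω, ∑ i, partialDeriv i φ x ^ 2 = gradEnergy φ :=
    setIntegral_eq_integral_of_forall_compl_eq_zero fun x hx => Finset.sum_eq_zero fun i _ => by
      rw [(hφ.partialDeriv i).eq_zero_of_notMem hx, sq, zero_mul]
  rw [rayleigh_eq hm.memLp_grad hm.memLp_hess, e1, e2, ← ENNReal.ofReal_div_of_pos hD]
  exact ENNReal.ofReal_le_ofReal ((div_le_iff₀ hD).2 hlt.le)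

/-- A consequence of the Poincaré inequality in a set of finite measure: test functions whose
gradients tend to zero in `L²` tend to zero. -/
lemma eLpNorm_tendsto_zero_of_grad {Ω : Set (Space 2)} (hvol : volume Ω < ⊤)
    {φ : ℕ → Space 2 → ℝ} (hφ : ∀ n, IsTestFunction Ω (φ n))
    (h : ∀ i, Tendsto (fun n => eLpNorm (partialDeriv i (φ n)) 2 (volume.restrict Ω)) atTop (𝓝 0)) :
    Tendsto (fun n => eLpNorm (φ n) 2 (volume.restrict Ω)) atTop (𝓝 0) := by
  set K := eLpNormLESNormFDerivOneConst (volume : Measure (Space 2)) 2 with hK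
  have hconj : NNReal.HolderConjugate (Module.finrank ℝ (Space 2)) 2 := by
    rw [finrank_euclideanSpace_fin]
    exact_mod_cast (NNReal.holderConjugate_iff.2 ⟨one_lt_two, by
      rw [← NNReal.coe_inj]; push_cast; norm_num⟩)
  set v := (volume.restrict Ω) Set.univ ^ (1 / (1:ℝ≥0∞).toReal - 1 / (2:ℝ≥0∞).toReal) with hv
  have hv' : v ≠ ⊤ := ENNReal.rpow_ne_top_of_nonneg (by norm_num) (by simpa using hvol.ne)
  have hb : ∀ n, eLpNorm (φ n) 2 (volume.restrict Ω)
      ≤ K * (∑ i, eLpNorm (partialDeriv i (φ n)) 2 (volume.restrict Ω) * v) := by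
    intro n
    have h1 := eLpNorm_le_eLpNorm_fderiv_one (volume : Measure (Space 2))
      ((hφ n).contDiff.of_le (by simp)) (hφ n).hasCompactSupport hconj
    refine ((eLpNorm_mono_measure _ Measure.restrict_le_self).trans h1).trans ?_
    refine mul_le_mul_right ?_ _
    have h2 : eLpNorm (fderiv ℝ (φ n)) 1 volume
        ≤ eLpNorm (fun x => ∑ i, ‖partialDeriv i (φ n) x‖) 1 volume := by
      refine eLpNorm_mono_real fun x => ?_
      refine ContinuousLinearMap.opNorm_le_bound _ (Finset.sum_nonneg fun _ _ => norm_nonneg _)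
        fun w => ?_
      have hw := frame_expand (norm_single_one 0) (norm_single_one 1) inner_single_zero_one w
      have hi : ∀ i, |inner ℝ (EuclideanSpace.single i 1 : Space 2) w| ≤ ‖w‖ := fun i => by
        simpa using abs_real_inner_le_norm (EuclideanSpace.single i 1 : Space 2) w
      conv_lhs => rw [← hw, map_add, map_smul, map_smul]
      refine (norm_add_le _ _).trans ?_
      rw [norm_smul, norm_smul, Fin.sum_univ_two, add_mul, mul_comm, mul_comm ‖inner _ _ _‖]
      exact add_le_add (mul_le_mul_of_nonneg_left (hi 0) (norm_nonneg _))
        (mul_le_mul_of_nonneg_left (hi 1) (norm_nonneg _))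
    refine h2.trans ?_
    have h3 : eLpNorm (∑ i, fun x => ‖partialDeriv i (φ n) x‖) 1 volume
        ≤ ∑ i, eLpNorm (fun x => ‖partialDeriv i (φ n) x‖) 1 volume :=
      eLpNorm_sum_le (fun i _ =>
        ((hφ n).partialDeriv i).continuous.norm.aestronglyMeasurable) le_rfl
    have h4 : (∑ i, fun x => ‖partialDeriv i (φ n) x‖)
        = fun x => ∑ i, ‖partialDeriv i (φ n) x‖ := by
      funext x; simp
    rw [h4] at h3
    refine h3.trans (Finset.sum_le_sum fun i _ => ?_)
    rw [eLpNorm_norm, ← eLpNorm_restrict_eq_of_support_subset (s := Ω)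
      ((subset_tsupport _).trans ((hφ n).partialDeriv i).tsupport_subset)]
    exact eLpNorm_le_eLpNorm_mul_rpow_measure_univ one_le_two
      ((hφ n).partialDeriv i).continuous.aestronglyMeasurable
  have hlim : Tendsto (fun n => K * (∑ i, eLpNorm (partialDeriv i (φ n)) 2 (volume.restrict Ω) * v))
      atTop (𝓝 (K * ∑ i : Fin 2, 0 * v)) := by
    refine ENNReal.Tendsto.const_mul (tendsto_finsetSum _ fun i _ =>
      ENNReal.Tendsto.mul_const (h i) (Or.inr hv')) (Or.inr ENNReal.coe_ne_top)
  simp only [zero_mul, Finset.sum_const_zero, mul_zero] at hlim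
  exact tendsto_of_tendsto_of_tendsto_of_le_of_le tendsto_const_nhds hlim (fun _ => zero_le) hb

theorem bucklesBelow_of_firstBucklingEigenvalue_lt {Ω : Set (Space 2)} (hvol : volume Ω < ⊤) {M : ℝ}
    (h : firstBucklingEigenvalue Ω < ENNReal.ofReal M) : BucklesBelow Ω M := by
  obtain ⟨r, ⟨u, G, H, hu, hne, rfl⟩, hr⟩ := sInf_lt_iff.1 h
  obtain ⟨φ, hφ, hφ0, hφ1, hφ2⟩ := hu.approx
  have tG : ∀ i, Tendsto (fun n => ∫ x, partialDeriv i (φ n) x ^ 2) atTop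
      (𝓝 (∫ x in Ω, G i x ^ 2)) := by
    intro i
    have := tendsto_integral_sq (fun n => ((hφ n).partialDeriv i).memLp.restrict Ω)
      (hu.memLp_grad i) (hφ1 i)
    simpa only [((hφ _).partialDeriv i).setIntegral_sq_eq] using this
  have tD : Tendsto (fun n => gradEnergy (φ n)) atTop (𝓝 (∫ x in Ω, ∑ i, G i x ^ 2)) := by
    rw [integral_finsetSum _ fun i _ => (hu.memLp_grad i).integrable_sq]
    simp only [(hφ _).gradEnergy_eq]
    exact tendsto_finsetSum _ fun i _ => tG i
  have tN : Tendsto (fun n => lapEnergy (φ n)) atTop (𝓝 (∫ x in Ω, (∑ i, H i i x) ^ 2)) := by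
    have h1 : MemLp (fun x => ∑ i, H i i x) 2 (volume.restrict Ω) :=
      memLp_finsetSum _ fun i _ => hu.memLp_hess i i
    have hlim : Tendsto (fun n => ∑ i, eLpNorm (partialDeriv i (partialDeriv i (φ n)) - H i i) 2
        (volume.restrict Ω)) atTop (𝓝 (∑ _i : Fin 2, 0)) :=
      tendsto_finsetSum _ fun i _ => hφ2 i i
    rw [Finset.sum_const_zero] at hlim
    have := tendsto_integral_sq (fun n => (hφ n).lap.memLp.restrict Ω) h1
      (tendsto_of_tendsto_of_tendsto_of_le_of_le tendsto_const_nhds hlim (fun _ => zero_le)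
        fun n => by
          have e : lap (φ n) - (fun x => ∑ i, H i i x)
              = ∑ i, (partialDeriv i (partialDeriv i (φ n)) - H i i) := by
            funext x; simp [lap, Finset.sum_sub_distrib]
          rw [e]
          exact eLpNorm_sum_le (fun i _ => ((((hφ n).partialDeriv i).partialDeriv i).memLp.restrict
            Ω).aestronglyMeasurable.sub (hu.memLp_hess i i).aestronglyMeasurable) one_le_two)
    simpa only [(hφ _).lap.setIntegral_sq_eq, lapEnergy] using this
  rw [rayleigh_eq hu.memLp_grad hu.memLp_hess] at hr
  have hD0 : 0 ≤ ∫ x in Ω, ∑ i, G i x ^ 2 :=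
    integral_nonneg fun _ => Finset.sum_nonneg fun _ _ => sq_nonneg _
  have hN0 : 0 ≤ ∫ x in Ω, (∑ i, H i i x) ^ 2 := integral_nonneg fun _ => sq_nonneg _
  have hD : 0 < ∫ x in Ω, ∑ i, G i x ^ 2 := by
    refine hD0.lt_of_ne' fun hD => hne ?_
    -- a vanishing weak gradient makes the gradients of the approximations small
    have hGi : ∀ i, G i =ᵐ[volume.restrict Ω] 0 := by
      have h1 := (integral_eq_zero_iff_of_nonneg
        (fun _ => Finset.sum_nonneg fun _ _ => sq_nonneg _)
        (integrable_finsetSum _ fun i _ => (hu.memLp_grad i).integrable_sq)).1 hD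
      intro i
      filter_upwards [h1] with x hx
      have := (Finset.sum_eq_zero_iff_of_nonneg fun i _ => sq_nonneg (G i x)).1 hx i
        (Finset.mem_univ i)
      simpa using this
    have h2 := eLpNorm_tendsto_zero_of_grad hvol hφ fun i => by
      refine (hφ1 i).congr fun n => eLpNorm_congr_ae ?_
      filter_upwards [hGi i] with x hx
      simp [hx]
    have h3 : eLpNorm u 2 (volume.restrict Ω) = 0 := by
      have h4 := hφ0.add h2
      rw [add_zero] at h4
      refine le_antisymm (ge_of_tendsto h4 (Eventually.of_forall fun n => ?_)) zero_le
      have e : u = (-(φ n - u)) + φ n := by funext x; simp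
      conv_lhs => rw [e]
      refine (eLpNorm_add_le (((hφ n).memLp.restrict Ω).sub hu.memLp).neg.aestronglyMeasurable
        ((hφ n).memLp.restrict Ω).aestronglyMeasurable one_le_two).trans ?_
      rw [eLpNorm_neg]
    exact (eLpNorm_eq_zero_iff hu.memLp.aestronglyMeasurable two_ne_zero).1 h3
  have hM : 0 < M := ENNReal.ofReal_pos.1 (zero_le.trans_lt h)
  rw [← ENNReal.ofReal_div_of_pos hD, ENNReal.ofReal_lt_ofReal_iff hM, div_lt_iff₀ hD] at hr
  obtain ⟨n, hn⟩ := (tN.eventually_lt (tD.const_mul M) hr).exists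
  exact ⟨φ n, hφ n, hn⟩

end Buckling

/-! ### Compactness of convex domains -/

namespace Buckling

namespace IsConvexDomain

variable {C : Set (Space 2)}

lemma preimage_add (hC : IsConvexDomain C) {c : Space 2} (hc : c ∈ C) :
    IsConvexDomain ((fun x => (1:ℝ) • x + c) ⁻¹' C) where
  isOpen := hC.isOpen.preimage (by fun_prop)
  convex := convex_preimage_smul_add hC.convex 1 c
  isBounded := by
    obtain ⟨R, hR⟩ := hC.isBounded.subset_closedBall c
    refine (Metric.isBounded_closedBall (x := (0 : Space 2)) (r := R)).subset fun x hx => ?_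
    have h := hR hx
    simpa [mem_closedBall_iff_norm] using h
  zero_mem := by simpa using hc

lemma perimeter_lt_top (hC : IsConvexDomain C) : perimeter C < ⊤ := by
  have h := hC.eVariationOn_bdryCurve_le (Finset.univ : Finset (Fin 2))
    (fun i => EuclideanSpace.single i 1) norm_single_one (c := 1) (fun v => by
      have hv := frame_expand (norm_single_one 0) (norm_single_one 1) inner_single_zero_one v
      rw [one_mul]
      conv_lhs => rw [← hv]
      refine (norm_add_le _ _).trans ?_
      rw [norm_smul, norm_smul, norm_single_one, norm_single_one, mul_one, mul_one,
        Fin.sum_univ_two]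
      rfl) one_pos
  rw [ENNReal.ofReal_one, one_mul, ← hC.perimeter_eq_eVariationOn] at h
  refine h.trans_lt (ENNReal.sum_lt_top.2 fun i _ => ENNReal.mul_lt_top (by simp) ?_)
  obtain ⟨R, hR⟩ := hC.isBounded.subset_closedBall 0
  refine lt_of_le_of_lt (measure_mono (t := Set.Icc (-R) R) ?_) (by simp)
  rintro _ ⟨x, hx, rfl⟩
  have h1 := abs_real_inner_le_norm (EuclideanSpace.single i 1 : Space 2) x
  rw [norm_single_one, one_mul] at h1
  exact abs_le.1 (h1.trans (mem_closedBall_zero_iff.1 (hR hx)))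

end IsConvexDomain

/-- A convex set containing a disc around the origin absorbs its small neighbourhoods after a slight
contraction. -/
lemma smul_mem_interior {B : Set (Space 2)} (hB : Convex ℝ B) {r δ : ℝ}
    (hr : Metric.ball 0 r ⊆ B) (hδ : 0 < δ) {x y : Space 2} (hy : y ∈ B) (hxy : dist x y < δ * r) :
    (1 + δ)⁻¹ • x + 0 ∈ interior B := by
  have h1 : (δ⁻¹) • (x - y) ∈ interior B := by
    refine interior_maximal hr Metric.isOpen_ball ?_
    rw [mem_ball_zero_iff, norm_smul, norm_inv, Real.norm_of_nonneg hδ.le, ← dist_eq_norm]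
    rwa [inv_mul_lt_iff₀ hδ]
  have h2 := hB.combo_self_interior_mem_interior hy h1 (a := (1 + δ)⁻¹) (b := (1 + δ)⁻¹ * δ)
    (by positivity) (by positivity) (by field_simp)
  convert! h2 using 1
  rw [smul_smul, mul_assoc, mul_inv_cancel₀ hδ.ne', mul_one, smul_sub, add_zero, add_sub_cancel]

lemma exists_dist_lt_of_dist_lt {K L : TopologicalSpace.NonemptyCompacts (Space 2)} {ε : ℝ}
    (h : dist K L < ε) {x : Space 2} (hx : x ∈ K) : ∃ y ∈ L, dist x y < ε :=
  Metric.exists_dist_lt_of_hausdorffDist_lt hx h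
    (Metric.hausdorffEDist_ne_top_of_nonempty_of_bounded K.nonempty L.nonempty
      K.isCompact.isBounded L.isCompact.isBounded)

lemma ofReal_le_of_forall_pos {a : ℝ≥0∞} {f : ℝ → ℝ} (hf : Continuous f)
    (h : ∀ δ > 0, a ≤ ENNReal.ofReal (f δ)) : a ≤ ENNReal.ofReal (f 0) := by
  have h1 : Tendsto (fun δ => ENNReal.ofReal (f δ)) (𝓝[>] 0) (𝓝 (ENNReal.ofReal (f 0))) :=
    ENNReal.tendsto_ofReal ((hf.tendsto 0).mono_left nhdsWithin_le_nhds)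
  exact ge_of_tendsto h1 (by filter_upwards [self_mem_nhdsWithin] with δ hδ using h δ hδ)

/-- Blaschke's selection theorem for uniformly bounded convex domains that contain a common disc: a
subsequence is squeezed between slight dilations of a limit domain. -/
theorem exists_convexDomain_limit {C : ℕ → Set (Space 2)} (hC : ∀ n, IsConvexDomain (C n)) {r R : ℝ}
    (hr : 0 < r) (hball : ∀ n, Metric.ball 0 r ⊆ C n) (hR : ∀ n, C n ⊆ Metric.closedBall 0 R) :
    ∃ D, IsConvexDomain D ∧ ∃ k : ℕ → ℕ, StrictMono k ∧ ∀ δ : ℝ, 0 < δ → ∀ᶠ n in atTop,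
      C (k n) ⊆ (fun x => (1 + δ)⁻¹ • x + 0) ⁻¹' D ∧
        D ⊆ (fun x => (1 + δ)⁻¹ • x + 0) ⁻¹' C (k n) := by
  let K : ℕ → TopologicalSpace.NonemptyCompacts (Space 2) := fun n =>
    ⟨⟨closure (C n), (hC n).isBounded.isCompact_closure⟩, ⟨0, subset_closure (hC n).zero_mem⟩⟩
  have hKC : ∀ n x, x ∈ K n ↔ x ∈ closure (C n) := fun n x => Iff.rfl
  obtain ⟨L, hLR, k, hk, hlim⟩ :=
    (TopologicalSpace.NonemptyCompacts.isCompact_subsets_of_isCompact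
      (isCompact_closedBall (0 : Space 2) R)).tendsto_subseq (x := K)
      fun n => closure_minimal (hR n) Metric.isClosed_closedBall
  have hclose : ∀ ε > 0, ∀ᶠ n in atTop, dist (K (k n)) L < ε := fun ε hε =>
    Metric.tendsto_nhds.1 hlim ε hε
  have hLclosed : IsClosed (L : Set (Space 2)) := L.isCompact.isClosed
  have hconv : Convex ℝ (L : Set (Space 2)) := by
    intro x hx y hy a b ha hb hab
    rw [← hLclosed.closure_eq, Metric.mem_closure_iff]
    intro ε hε
    obtain ⟨n, hn⟩ := (hclose (ε / 2) (half_pos hε)).exists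
    obtain ⟨x', hx', hxx'⟩ := exists_dist_lt_of_dist_lt (by rwa [dist_comm]) hx
    obtain ⟨y', hy', hyy'⟩ := exists_dist_lt_of_dist_lt (by rwa [dist_comm]) hy
    obtain ⟨z, hz, hzz⟩ := exists_dist_lt_of_dist_lt hn
      (x := a • x' + b • y') ((hC (k n)).convex.closure hx' hy' ha hb hab)
    refine ⟨z, hz, ?_⟩
    have h1 : dist (a • x + b • y) (a • x' + b • y') ≤ ε / 2 := by
      refine (dist_add_add_le _ _ _ _).trans ?_
      rw [dist_smul₀, dist_smul₀, Real.norm_of_nonneg ha, Real.norm_of_nonneg hb]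
      calc a * dist x x' + b * dist y y' ≤ a * (ε / 2) + b * (ε / 2) := by gcongr
        _ = ε / 2 := by rw [← add_mul, hab, one_mul]
    linarith [dist_triangle (a • x + b • y) (a • x' + b • y') z]
  have hballL : Metric.ball 0 r ⊆ (L : Set (Space 2)) := by
    intro x hx
    rw [← hLclosed.closure_eq, Metric.mem_closure_iff]
    intro ε hε
    obtain ⟨n, hn⟩ := (hclose ε hε).exists
    exact exists_dist_lt_of_dist_lt hn (subset_closure (hball (k n) hx))
  refine ⟨interior L, ⟨isOpen_interior, hconv.interior,
    L.isCompact.isBounded.subset interior_subset,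
    interior_maximal hballL Metric.isOpen_ball (Metric.mem_ball_self hr)⟩, k, hk, fun δ hδ => ?_⟩
  filter_upwards [hclose (δ * r) (mul_pos hδ hr)] with n hn
  constructor
  · intro x hx
    obtain ⟨y, hy, hxy⟩ := exists_dist_lt_of_dist_lt hn (subset_closure hx)
    exact smul_mem_interior hconv hballL hδ hy hxy
  · intro x hx
    obtain ⟨y, hy, hxy⟩ := exists_dist_lt_of_dist_lt (by rwa [dist_comm]) (interior_subset hx)
    have h := smul_mem_interior (hC (k n)).convex.closure
      ((hball (k n)).trans subset_closure) hδ hy hxy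
    rwa [(hC (k n)).convex.interior_closure_eq_interior_of_nonempty_interior
      (by rw [(hC (k n)).isOpen.interior_eq]; exact ⟨0, (hC (k n)).zero_mem⟩),
      (hC (k n)).isOpen.interior_eq] at h

/-- Convex domains of bounded perimeter and bounded eigenvalue have a limit along which the
perimeter and the eigenvalue are lower semicontinuous. -/
theorem exists_convexDomain_le {C : ℕ → Set (Space 2)} (hC : ∀ n, IsConvexDomain (C n)) {p μ : ℝ}
    (hP : ∀ n, perimeter (C n) ≤ ENNReal.ofReal p) {M : ℕ → ℝ} (hM : Tendsto M atTop (𝓝 μ))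
    (hb : ∀ n, BucklesBelow (C n) (M n)) :
    ∃ D, IsConvexDomain D ∧ perimeter D ≤ ENNReal.ofReal p ∧
      firstBucklingEigenvalue D ≤ ENNReal.ofReal μ := by
  obtain ⟨B, hB⟩ := hM.bddAbove_range
  have hMB : ∀ n, M n ≤ B := fun n => hB ⟨n, rfl⟩
  set R := max 1 p with hR
  have hR0 : 0 < R := lt_max_of_lt_left one_pos
  have hdist : ∀ n, ∀ x ∈ C n, ∀ y ∈ C n, dist x y ≤ R := by
    intro n x hx y hy
    refine (dist_le_perimeter (hC n).isOpen (hC n).volume_lt_top (hC n).perimeter_lt_top.ne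
      subset_rfl (hC n).isConnected hx hy).trans (ENNReal.toReal_le_of_le_ofReal hR0.le ?_)
    exact (hP n).trans (ENNReal.ofReal_le_ofReal (le_max_right _ _))
  obtain ⟨r, hr, hin⟩ := exists_ball_subset_of_bucklesBelow B hR0
  choose c hc hball using fun n => hin (C n) (hdist n) ((hb n).mono subset_rfl (hMB n))
  set C' : ℕ → Set (Space 2) := fun n => (fun x => (1:ℝ) • x + c n) ⁻¹' C n with hC'
  have hCD : ∀ n, IsConvexDomain (C' n) := fun n => (hC n).preimage_add (hc n)
  have hP' : ∀ n, perimeter (C' n) ≤ ENNReal.ofReal p := fun n => by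
    rw [hC', perimeter_preimage (hC n).isOpen.measurableSet one_pos]; simpa using hP n
  have hb' : ∀ n, BucklesBelow (C' n) (M n) := fun n => by
    have h := (hb n).preimage one_pos (c n)
    rwa [one_pow, one_mul] at h
  obtain ⟨D, hD, k, hk, hsq⟩ := exists_convexDomain_limit hCD hr
    (fun n x hx => hball n (by simpa [dist_eq_norm] using hx))
    (fun n x hx => by
      have := hdist n _ hx _ (hc n)
      simpa [dist_eq_norm] using this)
  refine ⟨D, hD, ?_, ?_⟩
  · have h : ∀ δ > 0, perimeter D ≤ ENNReal.ofReal ((1 + δ) * p) := by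
      intro δ hδ
      have h1δ : 0 < (1 + δ)⁻¹ := by positivity
      obtain ⟨n, -, hn⟩ := (hsq δ hδ).exists
      refine (hD.perimeter_mono ((hCD (k n)).preimage_smul h1δ) hn).trans ?_
      rw [perimeter_preimage (hCD (k n)).isOpen.measurableSet h1δ, inv_inv,
        ENNReal.ofReal_mul (by positivity)]
      exact mul_le_mul_right (hP' (k n)) _
    simpa using ofReal_le_of_forall_pos (by fun_prop) h
  · have h : ∀ δ > 0, firstBucklingEigenvalue D ≤ ENNReal.ofReal ((1 + δ) ^ 2 * μ) := by
      intro δ hδ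
      have h1δ : 0 < 1 + δ := by positivity
      have h1 : Tendsto (fun n => ENNReal.ofReal ((1 + δ) ^ 2 * M (k n))) atTop
          (𝓝 (ENNReal.ofReal ((1 + δ) ^ 2 * μ))) :=
        ENNReal.tendsto_ofReal ((hM.comp hk.tendsto_atTop).const_mul _)
      refine ge_of_tendsto h1 ?_
      filter_upwards [hsq δ hδ] with n hn
      have h2 := ((hb' (k n)).mono hn.1 le_rfl).preimage h1δ 0
      have h3 : (fun x : Space 2 => (1 + δ) • x + 0) ⁻¹' ((fun x => (1 + δ)⁻¹ • x + 0) ⁻¹' D)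
          = D := by
        ext x; simp [smul_smul, inv_mul_cancel₀ h1δ.ne']
      rw [h3] at h2
      exact h2.firstBucklingEigenvalue_le hD.isOpen
    simpa using ofReal_le_of_forall_pos (by fun_prop) h

/-! ### Existence of an optimal shape -/

lemma exists_bucklesBelow {Ω : Set (Space 2)} (hΩ : IsOpen Ω) {x : Space 2} (hx : x ∈ Ω) :
    ∃ M, BucklesBelow Ω M := by
  obtain ⟨φ, h1, h2, h3, -, h5⟩ := exists_contDiff_tsupport_subset (n := ⊤) (hΩ.mem_nhds hx)
  have hφ : IsTestFunction Ω φ := ⟨h3, h2, h1⟩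
  have hD : 0 < gradEnergy φ := by
    refine (gradEnergy_nonneg φ).lt_of_ne' fun hD => ?_
    have hz : ∀ i y, partialDeriv i φ y = 0 := by
      intro i
      have hsum := hφ.gradEnergy_eq
      rw [hD, eq_comm, Finset.sum_eq_zero_iff_of_nonneg
        fun _ _ => integral_nonneg fun _ => sq_nonneg _] at hsum
      have ti := (hφ.partialDeriv i).mul_right (hφ.partialDeriv i).contDiff
      by_contra! hy
      obtain ⟨y, hy⟩ := hy
      have h6 := ti.continuous.integral_pos_of_hasCompactSupport_nonneg_nonzero (μ := volume)
        ti.hasCompactSupport (fun z => mul_self_nonneg _) (mul_ne_zero hy hy)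
      refine h6.ne' ?_
      simpa only [sq, Pi.mul_apply] using hsum i (Finset.mem_univ i)
    have hconst := is_const_of_fderiv_eq_zero (𝕜 := ℝ) (h3.differentiable (by simp)) fun y => by
      ext w
      rw [← frame_expand (norm_single_one 0) (norm_single_one 1) inner_single_zero_one w, map_add,
        map_smul, map_smul]
      have h7 := hz 0 y
      have h8 := hz 1 y
      simp only [partialDeriv] at h7 h8
      rw [h7, h8]; simp
    obtain ⟨z, hzs⟩ := (Set.ne_univ_iff_exists_notMem _).1 h2.isCompact.ne_univ
    have := hconst x z
    rw [h5, image_eq_zero_of_notMem_tsupport hzs] at this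
    exact one_ne_zero this
  refine ⟨lapEnergy φ / gradEnergy φ + 1, φ, hφ, ?_⟩
  rw [add_mul, div_mul_cancel₀ _ hD.ne']
  linarith

/-- A convex domain can be rescaled to have any given perimeter. -/
lemma IsConvexDomain.perimeter_rescale {C : Set (Space 2)} (hC : IsConvexDomain C) {p : ℝ}
    (hp : 0 < p) :
    perimeter ((fun x => (p / (perimeter C).toReal)⁻¹ • x + 0) ⁻¹' C) = ENNReal.ofReal p := by
  have h0 : 0 < (perimeter C).toReal :=
    ENNReal.toReal_pos hC.perimeter_pos.ne' hC.perimeter_lt_top.ne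
  rw [perimeter_preimage hC.isOpen.measurableSet (by positivity), inv_inv,
    ENNReal.ofReal_div_of_pos h0, ENNReal.ofReal_toReal hC.perimeter_lt_top.ne,
    ENNReal.div_mul_cancel hC.perimeter_pos.ne' hC.perimeter_lt_top.ne]

/-- Every admissible set can be replaced by a convex domain that satisfies the same bounds
on the perimeter and on the eigenvalue: the translated convex hull of a suitable component. -/
lemma exists_convexDomain_of_lt {p M : ℝ} {Ω : Set (Space 2)} (hΩ : Ω ∈ admissible 2 p)
    (h : firstBucklingEigenvalue Ω < ENNReal.ofReal M) :
    ∃ C, IsConvexDomain C ∧ perimeter C ≤ ENNReal.ofReal p ∧ BucklesBelow C M := by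
  obtain ⟨ho, hvol, hP⟩ := hΩ
  obtain ⟨c, hc, hb⟩ := (bucklesBelow_of_firstBucklingEigenvalue_lt hvol h).exists_component ho
  have hconn := isConnected_connectedComponentIn_iff.2 hc
  have hsub := connectedComponentIn_subset Ω c
  obtain ⟨h1, h2⟩ := convexHull_isConvexDomain ho hvol (hP.trans_lt ENNReal.ofReal_lt_top).ne hsub
    hconn ho.connectedComponentIn (mem_connectedComponentIn hc)
  refine ⟨_, h1, h2.trans hP, ?_⟩
  simpa using (hb.mono (subset_convexHull ℝ _) le_rfl).preimage one_pos c

end Buckling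

theorem mainTheorem6 (p : ℝ) (hp : 0 < p) :
    ∃ Ω : Set (Buckling.Space 2),
      Ω ∈ Buckling.admissible 2 p ∧
      IsMinOn Buckling.firstBucklingEigenvalue (Buckling.admissible 2 p) Ω ∧
      Bornology.IsBounded Ω ∧ IsOpen Ω ∧ Convex ℝ Ω ∧
      Buckling.perimeter Ω = ENNReal.ofReal p ∧
      MeasureTheory.Measure.hausdorffMeasure 1 (frontier Ω) = ENNReal.ofReal p := by
  -- the strict upper bounds for the eigenvalues of the convex competitors
  set S : Set ℝ := {M | ∃ C, Buckling.IsConvexDomain C ∧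
    Buckling.perimeter C ≤ ENNReal.ofReal p ∧ Buckling.BucklesBelow C M} with hS
  have hSb : BddBelow S := ⟨0, by rintro M ⟨C, -, -, h⟩; exact h.pos.le⟩
  have hSn : S.Nonempty := by
    have hB : Buckling.IsConvexDomain (Metric.ball 0 1) := ⟨Metric.isOpen_ball, convex_ball 0 1,
      Metric.isBounded_ball, Metric.mem_ball_self one_pos⟩
    have h0 := ENNReal.toReal_pos hB.perimeter_pos.ne' hB.perimeter_lt_top.ne
    have hB' := hB.preimage_smul (t := (p / (Buckling.perimeter (Metric.ball 0 1)).toReal)⁻¹)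
      (by positivity)
    obtain ⟨M, hM⟩ := Buckling.exists_bucklesBelow hB'.isOpen hB'.zero_mem
    exact ⟨M, _, hB', (hB.perimeter_rescale hp).le, hM⟩
  set μ := sInf S with hμ
  have hμ0 : 0 ≤ μ := le_csInf hSn (by rintro M ⟨C, -, -, h⟩; exact h.pos.le)
  have hseq : ∀ n : ℕ, ∃ M ∈ S, M < μ + 1 / ((n : ℝ) + 1) := fun n =>
    exists_lt_of_csInf_lt hSn (lt_add_of_pos_right _ (by positivity))
  choose M hMS hM using hseq
  choose C hC hP hb using hMS
  have hlim : Tendsto M atTop (𝓝 μ) := by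
    have h1 : Tendsto (fun n : ℕ => μ + 1 / ((n : ℝ) + 1)) atTop (𝓝 (μ + 0)) :=
      tendsto_const_nhds.add tendsto_one_div_add_atTop_nhds_zero_nat
    rw [add_zero] at h1
    exact tendsto_of_tendsto_of_tendsto_of_le_of_le tendsto_const_nhds h1
      (fun n => csInf_le hSb ⟨C n, hC n, hP n, hb n⟩) fun n => (hM n).le
  obtain ⟨D, hD, hDP, hDΛ⟩ := Buckling.exists_convexDomain_le hC hP hlim hb
  have hD0 := ENNReal.toReal_pos hD.perimeter_pos.ne' hD.perimeter_lt_top.ne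
  set t := p / (Buckling.perimeter D).toReal with ht
  have ht0 : 0 < t := by positivity
  have ht1 : 1 ≤ t := (one_le_div₀ hD0).2 (ENNReal.toReal_le_of_le_ofReal hp.le hDP)
  have hti : 0 < t⁻¹ := inv_pos.2 ht0
  set Ω : Set (Buckling.Space 2) := (fun x => t⁻¹ • x + 0) ⁻¹' D with hΩ
  have hΩD : Buckling.IsConvexDomain Ω := hD.preimage_smul hti
  have hΩP : Buckling.perimeter Ω = ENNReal.ofReal p := hD.perimeter_rescale hp
  have hΩΛ : Buckling.firstBucklingEigenvalue Ω ≤ ENNReal.ofReal μ := by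
    have h : ∀ δ > 0, Buckling.firstBucklingEigenvalue Ω ≤ ENNReal.ofReal (μ + δ) := by
      intro δ hδ
      have h1 := (Buckling.bucklesBelow_of_firstBucklingEigenvalue_lt hD.volume_lt_top
        (hDΛ.trans_lt ((ENNReal.ofReal_lt_ofReal_iff (by linarith)).2
          (lt_add_of_pos_right μ hδ)))).preimage hti 0
      refine (h1.mono subset_rfl (M' := μ + δ) ?_).firstBucklingEigenvalue_le hΩD.isOpen
      exact mul_le_of_le_one_left (by linarith)
        (pow_le_one₀ hti.le (inv_le_one_of_one_le₀ ht1))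
    simpa using Buckling.ofReal_le_of_forall_pos (by fun_prop) h
  refine ⟨Ω, ⟨hΩD.isOpen, hΩD.volume_lt_top, hΩP.le⟩, fun Ω' hΩ' => ?_, hΩD.isBounded, hΩD.isOpen,
    hΩD.convex, hΩP, hΩD.hausdorffMeasure_frontier_eq_perimeter.trans hΩP⟩
  refine hΩΛ.trans (not_lt.1 fun hlt => ?_)
  obtain ⟨M', hM'0, h1, h2⟩ := ENNReal.lt_iff_exists_real_btwn.1 hlt
  have h3 : μ ≤ M' := csInf_le hSb (Buckling.exists_convexDomain_of_lt hΩ' h1)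
  exact h2.not_ge (ENNReal.ofReal_le_ofReal h3)
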